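/- Let $G=(N,A,c)$ be a connected undirected graph without loops and parallel arcs, with $n$ nodes, $m$ arcs and non-negative real capacities $c(e)$, $e\in A$, and let $s\neq t$ be two nodes of $G$. A feasible flow on a subgraph $(N,A',c)$, $A'\subseteq A$, is obtained by replacing each arc of $A'$ by two oppositely directed arcs of the same capacity and assigning to each directed arc a flow between $0$ and its capacity so that inflow equals outflow at every node other than $s,t$; its value is the net outflow at $s$, and $\mathrm{maxFlow}$ denotes the maximum value. The vitality of $e\in A$ is $\mathrm{flowVit}(e)=\mathrm{maxFlow}(G)-\mathrm{maxFlow}(G-e)$, where $G-e=(N,A\setminus\{e\},c)$. Consider algorithms on a random access machine with exact real numbers (unit cost for reading and writing variables and array cells, integer successor and predecessor, real addition and subtraction, and integer and real comparisons), which may also call a given max-flow routine, i.e. a black box that returns some maximum flow assignment for any instance of the above kind (connected undirected graph without loops and parallel arcs, non-negative real capacities, two distinct terminals). **Theorem.** There are such an algorithm and a constant $K$, both independent of the routine, such that for every max-flow routine and every input $(G,s,t)$, with $G$ given by its list of arcs and capacities, the algorithm computes $\mathrm{flowVit}(e)$ for all $e\in A$ with at most $2(n-1)$ calls to the routine, each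 on an instance with at most $n$ nodes and at most $m$ arcs, and at most $K\,m\,n$ further elementary steps. Consequently, if $\mathrm{MF}(n,m)$ bounds the worst-case time of the routine on instances with at most $n$ nodes and at most $m$ arcs, then the total running time is at most $K\,(n\cdot \mathrm{MF}(n,m)+m\cdot n)$, that is, $O(n\cdot \mathrm{MF}(n,m)+m\cdot n)$. -/

import Mathlib

namespace MaxFlowVitality

/-- A max-flow instance: a connected undirected graph without loops and parallel arcs, on the nodes
`0, …, n - 1`, whose arcs are listed as `0, …, m - 1` (arc `i` joins `tail i` and `head i`, the
order of the two endpoints carries no meaning), with non-negative real capacities and two distinct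
terminals `s`, `t`. -/
structure Network where
  n : ℕ
  m : ℕ
  tail : Fin m → Fin n
  head : Fin m → Fin n
  cap : Fin m → ℝ
  s : Fin n
  t : Fin n
  cap_nonneg : ∀ i, 0 ≤ cap i
  s_ne_t : s ≠ t
  loopless : ∀ i, tail i ≠ head i
  simple : Function.Injective fun i => s(tail i, head i)
  connected : (SimpleGraph.fromEdgeSet (Set.range fun i => s(tail i, head i))).Connected

namespace Network

variable (I : Network)

/-- The directed arcs obtained by replacing each undirected arc `i` by the pair
`(i, false) = (tail i, head i)` and `(i, true) = (head i, tail i)`. -/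
abbrev DArc : Type := Fin I.m × Bool

def src (d : I.DArc) : Fin I.n := if d.2 then I.head d.1 else I.tail d.1

def dst (d : I.DArc) : Fin I.n := if d.2 then I.tail d.1 else I.head d.1

/-- Total flow of `f` leaving `v` in the subgraph with arc set `A`. -/
noncomputable def outflow (A : Finset (Fin I.m)) (f : I.DArc → ℝ) (v : Fin I.n) : ℝ :=
  ∑ d : I.DArc with d.1 ∈ A ∧ I.src d = v, f d

/-- Total flow of `f` entering `v` in the subgraph with arc set `A`. -/
noncomputable def inflow (A : Finset (Fin I.m)) (f : I.DArc → ℝ) (v : Fin I.n) : ℝ :=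
  ∑ d : I.DArc with d.1 ∈ A ∧ I.dst d = v, f d

/-- `f` is a feasible flow assignment from `s` to `t` in the subgraph with arc set `A`. -/
def Feasible (A : Finset (Fin I.m)) (f : I.DArc → ℝ) : Prop :=
  (∀ d : I.DArc, d.1 ∈ A → 0 ≤ f d ∧ f d ≤ I.cap d.1) ∧
    ∀ v, v ≠ I.s → v ≠ I.t → I.inflow A f v = I.outflow A f v

/-- The flow from `s` to `t` under the assignment `f`, in the subgraph with arc set `A`. -/
noncomputable def value (A : Finset (Fin I.m)) (f : I.DArc → ℝ) : ℝ :=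
  I.outflow A f I.s - I.inflow A f I.s

/-- The maximum flow in the subgraph with arc set `A`. The set of values contains `0` and is
bounded by the sum of the capacities, so the supremum is never a default value. -/
noncomputable def maxFlow (A : Finset (Fin I.m)) : ℝ :=
  sSup (I.value A '' {f | I.Feasible A f})

/-- The vitality of the arc `e`: the loss of maximum flow when `e` is removed. -/
noncomputable def flowVit (e : Fin I.m) : ℝ :=
  I.maxFlow Finset.univ - I.maxFlow (Finset.univ.erase e)

/-- `f` is a maximum flow assignment of the whole network. -/
def IsMaxFlowAssignment (f : I.DArc → ℝ) : Prop :=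
  I.Feasible Finset.univ f ∧
    ∀ g, I.Feasible Finset.univ g → I.value Finset.univ g ≤ I.value Finset.univ f

end Network

/-- A max-flow routine: on every network it returns some maximum flow assignment, and it takes
a certain time. Nothing else is known about the assignment that it returns. -/
structure MaxFlowRoutine where
  flow : (I : Network) → I.DArc → ℝ
  time : Network → ℕ
  correct : ∀ I : Network, I.IsMaxFlowAssignment (flow I)

/-- `MF n m` bounds the worst-case time of the routine on networks with at most `n` nodes and at
most `m` arcs. -/
def MaxFlowRoutine.RunsIn (R : MaxFlowRoutine) (MF : ℕ → ℕ → ℕ) : Prop :=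
  ∀ (n m : ℕ) (J : Network), J.n ≤ n → J.m ≤ m → R.time J ≤ MF n m

/-! A real random access machine, programmed in a structured imperative language. Variables and
arrays are named by numbers; a program mentions only finitely many of them. The only integer
operations are successor and predecessor, so that an integer grows by at most one per step; the
only real operations are addition, subtraction and comparison, the only real constant is `0`. -/

/-- Memory: integer variables, integer arrays, real variables, real arrays. -/
structure State where
  ivar : ℕ → ℕ
  iarr : ℕ → ℕ → ℕ
  rvar : ℕ → ℝ
  rarr : ℕ → ℕ → ℝ

/-- Integer expressions. -/
inductive IExp where
  | lit (k : ℕ)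
  | var (x : ℕ)
  | read (a : ℕ) (i : IExp)
  | succ (e : IExp)
  | pred (e : IExp)

def IExp.eval (σ : State) : IExp → ℕ
  | .lit k => k
  | .var x => σ.ivar x
  | .read a i => σ.iarr a (i.eval σ)
  | .succ e => e.eval σ + 1
  | .pred e => e.eval σ - 1

/-- The number of elementary operations that evaluating an expression takes. -/
def IExp.cost : IExp → ℕ
  | .lit _ => 1
  | .var _ => 1
  | .read _ i => i.cost + 1
  | .succ e => e.cost + 1
  | .pred e => e.cost + 1

/-- Real expressions. -/
inductive RExp where
  | zero
  | var (x : ℕ)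
  | read (a : ℕ) (i : IExp)
  | add (e₁ e₂ : RExp)
  | sub (e₁ e₂ : RExp)

noncomputable def RExp.eval (σ : State) : RExp → ℝ
  | .zero => 0
  | .var x => σ.rvar x
  | .read a i => σ.rarr a (i.eval σ)
  | .add e₁ e₂ => e₁.eval σ + e₂.eval σ
  | .sub e₁ e₂ => e₁.eval σ - e₂.eval σ

def RExp.cost : RExp → ℕ
  | .zero => 1
  | .var _ => 1
  | .read _ i => i.cost + 1
  | .add e₁ e₂ => e₁.cost + e₂.cost + 1
  | .sub e₁ e₂ => e₁.cost + e₂.cost + 1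

/-- Tests. -/
inductive BExp where
  | eqI (e₁ e₂ : IExp)
  | ltI (e₁ e₂ : IExp)
  | ltR (e₁ e₂ : RExp)
  | not (b : BExp)
  | and (b₁ b₂ : BExp)

def BExp.Holds (σ : State) : BExp → Prop
  | .eqI e₁ e₂ => e₁.eval σ = e₂.eval σ
  | .ltI e₁ e₂ => e₁.eval σ < e₂.eval σ
  | .ltR e₁ e₂ => e₁.eval σ < e₂.eval σ
  | .not b => ¬ b.Holds σ
  | .and b₁ b₂ => b₁.Holds σ ∧ b₂.Holds σ

def BExp.cost : BExp → ℕ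
  | .eqI e₁ e₂ => e₁.cost + e₂.cost + 1
  | .ltI e₁ e₂ => e₁.cost + e₂.cost + 1
  | .ltR e₁ e₂ => e₁.cost + e₂.cost + 1
  | .not b => b.cost + 1
  | .and b₁ b₂ => b₁.cost + b₂.cost + 1

/-- Where a network is stored: integer variables for `n`, `m`, `s`, `t`, integer arrays for the
endpoints of the arcs, a real array for the capacities. -/
structure Layout where
  n : ℕ
  m : ℕ
  s : ℕ
  t : ℕ
  tail : ℕ
  head : ℕ
  cap : ℕ

/-- The network `I` is stored in the memory `σ` at the places given by `L`. -/
structure Stored (L : Layout) (I : Network) (σ : State) : Prop where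
  n : σ.ivar L.n = I.n
  m : σ.ivar L.m = I.m
  s : σ.ivar L.s = I.s
  t : σ.ivar L.t = I.t
  tail : ∀ i : Fin I.m, σ.iarr L.tail i = I.tail i
  head : ∀ i : Fin I.m, σ.iarr L.head i = I.head i
  cap : ∀ i : Fin I.m, σ.rarr L.cap i = I.cap i

/-- Programs. `maxflow L a b` calls the max-flow routine on the network stored at `L`; the routine
writes its flow on the directed arcs `(tail i, head i)` to the real array `a` and its flow on the
directed arcs `(head i, tail i)` to the real array `b`. -/
inductive Cmd where
  | skip
  | setI (x : ℕ) (e : IExp)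
  | setR (x : ℕ) (e : RExp)
  | storeI (a : ℕ) (i : IExp) (e : IExp)
  | storeR (a : ℕ) (i : IExp) (e : RExp)
  | seq (c₁ c₂ : Cmd)
  | cond (b : BExp) (c₁ c₂ : Cmd)
  | loop (b : BExp) (c : Cmd)
  | maxflow (L : Layout) (a b : ℕ)

/-- Overwrite the first `k` entries of an array. -/
def overwrite {k : ℕ} (g : Fin k → ℝ) (old : ℕ → ℝ) : ℕ → ℝ :=
  fun j => if h : j < k then g ⟨j, h⟩ else old j

noncomputable def State.writeFlow (σ : State) (I : Network) (f : I.DArc → ℝ) (a b : ℕ) : State :=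
  let r := Function.update σ.rarr a (overwrite (fun i => f (i, false)) (σ.rarr a))
  { σ with rarr := Function.update r b (overwrite (fun i => f (i, true)) (r b)) }

/-- `Exec R c σ σ' k l`: with `R` as the max-flow routine, the program `c` started in memory `σ`
halts in memory `σ'`, after `k` elementary steps outside the routine and after calling the routine
successively on the networks in the list `l`. A call on data that are not a network never halts. -/
inductive Exec (R : MaxFlowRoutine) : Cmd → State → State → ℕ → List Network → Prop where
  | skip (σ : State) : Exec R .skip σ σ 1 []
  | setI (σ : State) (x : ℕ) (e : IExp) :
      Exec R (.setI x e) σ { σ with ivar := Function.update σ.ivar x (e.eval σ) } (e.cost + 1) []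
  | setR (σ : State) (x : ℕ) (e : RExp) :
      Exec R (.setR x e) σ { σ with rvar := Function.update σ.rvar x (e.eval σ) } (e.cost + 1) []
  | storeI (σ : State) (a : ℕ) (i e : IExp) :
      Exec R (.storeI a i e) σ
        { σ with
          iarr := Function.update σ.iarr a (Function.update (σ.iarr a) (i.eval σ) (e.eval σ)) }
        (i.cost + e.cost + 1) []
  | storeR (σ : State) (a : ℕ) (i : IExp) (e : RExp) :
      Exec R (.storeR a i e) σ
        { σ with
          rarr := Function.update σ.rarr a (Function.update (σ.rarr a) (i.eval σ) (e.eval σ)) }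
        (i.cost + e.cost + 1) []
  | seq {c₁ c₂ : Cmd} {σ σ₁ σ₂ : State} {k₁ k₂ : ℕ} {l₁ l₂ : List Network}
      (h₁ : Exec R c₁ σ σ₁ k₁ l₁) (h₂ : Exec R c₂ σ₁ σ₂ k₂ l₂) :
      Exec R (.seq c₁ c₂) σ σ₂ (k₁ + k₂) (l₁ ++ l₂)
  | condTrue {b : BExp} {c₁ c₂ : Cmd} {σ σ' : State} {k : ℕ} {l : List Network}
      (hb : b.Holds σ) (h : Exec R c₁ σ σ' k l) :
      Exec R (.cond b c₁ c₂) σ σ' (b.cost + k) l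
  | condFalse {b : BExp} {c₁ c₂ : Cmd} {σ σ' : State} {k : ℕ} {l : List Network}
      (hb : ¬ b.Holds σ) (h : Exec R c₂ σ σ' k l) :
      Exec R (.cond b c₁ c₂) σ σ' (b.cost + k) l
  | loopDone {b : BExp} {c : Cmd} {σ : State} (hb : ¬ b.Holds σ) :
      Exec R (.loop b c) σ σ b.cost []
  | loopStep {b : BExp} {c : Cmd} {σ σ₁ σ₂ : State} {k₁ k₂ : ℕ} {l₁ l₂ : List Network}
      (hb : b.Holds σ) (h₁ : Exec R c σ σ₁ k₁ l₁) (h₂ : Exec R (.loop b c) σ₁ σ₂ k₂ l₂) :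
      Exec R (.loop b c) σ σ₂ (b.cost + k₁ + k₂) (l₁ ++ l₂)
  | maxflow {L : Layout} {a b : ℕ} {σ : State} (I : Network) (h : Stored L I σ) :
      Exec R (.maxflow L a b) σ (σ.writeFlow I (R.flow I) a b) 1 [I]

/-- Where the input of the vitality problem is stored. -/
def inputLayout : Layout where
  n := 0
  m := 1
  s := 2
  t := 3
  tail := 0
  head := 1
  cap := 0

/-- The real array that receives the vitalities: entry `i` is the vitality of arc `i`. -/
def outputArray : ℕ := 1

end MaxFlowVitality

open MaxFlowVitality

/-! Write `x(u, v)` for the least capacity of a cut that separates `s` from `t` and `u` from `v`. By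
max-flow min-cut, the minimum cuts of `G - e` are found among the minimum cuts of `G` and the
cheapest cuts that `e` crosses, so with `F = maxFlow(G)` and `e = uv`,
`flowVit(e) = F - min F (x(u, v) - c(e))`.

All values `x(u, v)` are stored in a single tree on the nodes, as in the Gomory–Hu tree and its
generalisations to families of cuts that need not be closed under uncrossing: whatever the family,
`x(u, w) ≥ min (x(u, v)) (x(v, w))`. Node `k` is attached by a cheapest cut `C` separating it from
its current parent `p`, and it takes over the nodes attached to some `q` that lie on its side of
`C` and satisfy `x(q, p) > c(C)`. Each weight of a tree arc `(a, par a)` serves for all nodes below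
`a` at once: `x(a, b) = min (x(a, par a)) (x(par a, b))` for `b < a`.

A cut separating `{s, t}` and `{k, p}` either keeps `k` with `s` and `p` with `t`, or the other way
round. Each of the two cases is a minimum cut of the network in which these pairs are merged, and
two calls of the max-flow routine find it; the merged network has no more nodes and arcs than `G`.
The rest of a round takes time `O(m)`, and walking along the tree gives `x(u, v)` in time `O(n)`.
-/

namespace MaxFlowVitality

open Finset Relation Filter Topology

/-! ### Maximum flows and minimum cuts -/

namespace Network

variable {I : Network} {A : Finset (Fin I.m)} {f : I.DArc → ℝ} {g : Fin I.m → ℝ} {D : ℕ → Bool}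

/-- The net outflow, at every node, of a flow that sends `g i` along arc `i` from its tail to its
head. -/
noncomputable def boundary (I : Network) : (Fin I.m → ℝ) →ₗ[ℝ] Fin I.n → ℝ :=
  Fintype.linearCombination ℝ fun i => Pi.single (I.tail i) 1 - Pi.single (I.head i) 1

/-- The net flow of `f` along arc `i`, from its tail to its head, in the subgraph with arc set
`A`. -/
noncomputable def net (A : Finset (Fin I.m)) (f : I.DArc → ℝ) (i : Fin I.m) : ℝ :=
  if i ∈ A then f (i, false) - f (i, true) else 0

/-- The flow assignment with net flow `g` that uses only one direction of each arc. -/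
noncomputable def ofNet (g : Fin I.m → ℝ) (d : I.DArc) : ℝ := if d.2 then (g d.1)⁻ else (g d.1)⁺

/-- The net flows of the feasible flow assignments in the subgraph with arc set `A`. -/
def netFlows (A : Finset (Fin I.m)) : Set (Fin I.m → ℝ) :=
  {g | (∀ i, |g i| ≤ I.cap i) ∧ (∀ i ∉ A, g i = 0) ∧
    ∀ v, v ≠ I.s → v ≠ I.t → I.boundary g v = 0}

/-- `D` is the indicator of a node set that contains `s` and misses `t`. Node sets are sets of
natural numbers, so that they can be pulled back along any renumbering of the nodes. -/
def IsCut (I : Network) (D : ℕ → Bool) : Prop := D I.s = true ∧ D I.t = false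

/-- The capacity, in the subgraph with arc set `A`, of the arcs between `D` and its complement. -/
noncomputable def cutCap (A : Finset (Fin I.m)) (D : ℕ → Bool) : ℝ :=
  ∑ i ∈ A with D (I.tail i) ≠ D (I.head i), I.cap i

/-- Arc `i` of the subgraph with arc set `A` contributes the arc from `x` to `y` to the residual
graph of `f`. -/
def ResidualAt (A : Finset (Fin I.m)) (f : I.DArc → ℝ) (i : Fin I.m) (x y : ℕ) : Prop :=
  (x = I.tail i ∧ y = I.head i ∧ net A f i < I.cap i) ∨
    (x = I.head i ∧ y = I.tail i ∧ -I.cap i < net A f i)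

/-- The arcs of the residual graph of `f` in the subgraph with arc set `A`. -/
def Residual (A : Finset (Fin I.m)) (f : I.DArc → ℝ) (x y : ℕ) : Prop :=
  ∃ i ∈ A, ResidualAt A f i x y

theorem Residual.lt {x y : ℕ} (h : Residual A f x y) : y < I.n := by
  obtain ⟨i, -, ⟨-, rfl, -⟩ | ⟨-, rfl, -⟩⟩ := h <;> exact Fin.is_lt _

theorem boundary_apply (g : Fin I.m → ℝ) (v : Fin I.n) :
    I.boundary g v =
      ∑ i, g i * ((if I.tail i = v then 1 else 0) - (if I.head i = v then 1 else 0)) := by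
  simp [boundary, Fintype.linearCombination_apply, Pi.single_apply, @eq_comm _ v]

theorem sum_boundary (g : Fin I.m → ℝ) (D : ℕ → Bool) :
    ∑ v : Fin I.n, (if D v then I.boundary g v else 0) =
      ∑ i, g i * ((if D (I.tail i) then 1 else 0) - (if D (I.head i) then 1 else 0)) := by
  simp only [boundary_apply]
  simp only [← sum_filter]
  rw [sum_comm]
  refine sum_congr rfl fun i _ => ?_
  rw [← mul_sum, sum_sub_distrib]
  simp

theorem boundary_net (A : Finset (Fin I.m)) (f : I.DArc → ℝ) (v : Fin I.n) :
    I.boundary (net A f) v = I.outflow A f v - I.inflow A f v := by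
  simp only [boundary_apply, outflow, inflow, sum_filter, Fintype.sum_prod_type,
    ← sum_sub_distrib]
  refine sum_congr rfl fun i _ => ?_
  simp only [Fintype.sum_bool, src, dst, net, if_true, Bool.false_eq_true, if_false]
  split_ifs <;> simp_all <;> ring

theorem Feasible.abs_net_le (hf : I.Feasible A f) {i : Fin I.m} (hi : i ∈ A) :
    |net A f i| ≤ I.cap i := by
  have h1 := hf.1 (i, false) hi
  have h2 := hf.1 (i, true) hi
  rw [net, if_pos hi]
  exact abs_sub_le_of_nonneg_of_le h1.1 h1.2 h2.1 h2.2

theorem Feasible.value_eq_sum_net (hf : I.Feasible A f) (hD : I.IsCut D) :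
    I.value A f = ∑ i ∈ A,
      net A f i * ((if D (I.tail i) then 1 else 0) - (if D (I.head i) then 1 else 0)) := by
  have hvalue : I.value A f = ∑ v : Fin I.n, if D v then I.boundary (net A f) v else 0 := by
    rw [Fintype.sum_eq_single I.s, if_pos hD.1, boundary_net, value]
    intro v hvs
    rcases eq_or_ne v I.t with rfl | hvt
    · simp [hD.2]
    · rw [boundary_net, hf.2 v hvs hvt, sub_self, ite_self]
  rw [hvalue, sum_boundary]
  exact (sum_subset (subset_univ A) fun i _ hi => by simp [net, hi]).symm

theorem Feasible.value_le_cutCap (hf : I.Feasible A f) (hD : I.IsCut D) :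
    I.value A f ≤ I.cutCap A D := by
  rw [hf.value_eq_sum_net hD, cutCap, sum_filter]
  refine sum_le_sum fun i hi => ?_
  have := abs_le.1 (hf.abs_net_le hi)
  cases D (I.tail i) <;> cases D (I.head i) <;> simp <;> linarith

theorem Feasible.value_eq_cutCap (hf : I.Feasible A f) (hD : I.IsCut D)
    (hclosed : ∀ x y, Residual A f x y → D x = true → D y = true) :
    I.value A f = I.cutCap A D := by
  rw [hf.value_eq_sum_net hD, cutCap, sum_filter]
  refine sum_congr rfl fun i hi => ?_
  have hcap := abs_le.1 (hf.abs_net_le hi)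
  have hforward : D (I.tail i) = true → D (I.head i) = false → net A f i = I.cap i := by
    intro ht hh
    by_contra hne
    simpa [hh] using hclosed _ _ ⟨i, hi, .inl ⟨rfl, rfl, lt_of_le_of_ne hcap.2 hne⟩⟩ ht
  have hbackward : D (I.tail i) = false → D (I.head i) = true → net A f i = -I.cap i := by
    intro ht hh
    by_contra hne
    simpa [ht] using hclosed _ _ ⟨i, hi, .inr ⟨rfl, rfl, lt_of_le_of_ne hcap.1 (Ne.symm hne)⟩⟩ hh
  cases ht : D (I.tail i) <;> cases hh : D (I.head i) <;> simp_all

theorem net_ofNet (hg : ∀ i ∉ A, g i = 0) : net A (ofNet g) = g := by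
  ext i
  by_cases hi : i ∈ A
  · simp [net, ofNet, hi]
  · simp [net, hi, hg]

theorem Feasible.net_mem_netFlows (hf : I.Feasible A f) : net A f ∈ netFlows A := by
  refine ⟨fun i => ?_, fun i hi => by simp [net, hi], fun v hs ht => ?_⟩
  · by_cases hi : i ∈ A
    · exact hf.abs_net_le hi
    · simp [net, hi, I.cap_nonneg]
  · rw [boundary_net, hf.2 v hs ht, sub_self]

theorem feasible_ofNet (hg : g ∈ netFlows A) : I.Feasible A (ofNet g) := by
  obtain ⟨hcap, hsupp, hcons⟩ := hg
  refine ⟨fun d _ => ?_, fun v hs ht => ?_⟩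
  · have := abs_le.1 (hcap d.1)
    have := I.cap_nonneg d.1
    simp only [ofNet]
    split_ifs
    · exact ⟨negPart_nonneg _, max_le (by linarith) this⟩
    · exact ⟨posPart_nonneg _, max_le (by linarith) this⟩
  · have := boundary_net A (ofNet g) v
    rw [net_ofNet hsupp, hcons v hs ht] at this
    linarith

theorem value_ofNet (hg : g ∈ netFlows A) : I.value A (ofNet g) = I.boundary g I.s := by
  rw [value, ← boundary_net, net_ofNet hg.2.1]

theorem isCompact_netFlows (A : Finset (Fin I.m)) : IsCompact (netFlows A) := by
  have hbox := isCompact_univ_pi fun i => isCompact_Icc (a := -I.cap i) (b := I.cap i)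
  have hcont : Continuous I.boundary := I.boundary.continuous_of_finiteDimensional
  refine hbox.of_isClosed_subset ?_ fun g hg i _ => abs_le.1 (hg.1 i)
  simp only [netFlows, Set.ofPred_and, Set.ofPred_forall]
  refine .inter (isClosed_iInter fun i => isClosed_le (by fun_prop) (by fun_prop)) (.inter ?_ ?_)
  · exact isClosed_iInter fun i => isClosed_iInter fun _ => isClosed_eq (by fun_prop) (by fun_prop)
  · exact isClosed_iInter fun v => isClosed_iInter fun _ => isClosed_iInter fun _ =>
      isClosed_eq (by fun_prop) (by fun_prop)

theorem exists_isMaxOn_value (A : Finset (Fin I.m)) :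
    ∃ f, I.Feasible A f ∧ IsMaxOn (I.value A) {f | I.Feasible A f} f := by
  have hcont : Continuous I.boundary := I.boundary.continuous_of_finiteDimensional
  have hzero : (0 : Fin I.m → ℝ) ∈ netFlows A := by simp [netFlows, I.cap_nonneg]
  obtain ⟨g, hg, hmax⟩ := (isCompact_netFlows A).exists_isMaxOn ⟨0, hzero⟩
    (f := fun g => I.boundary g I.s) (by fun_prop)
  refine ⟨ofNet g, feasible_ofNet hg, fun f hf => ?_⟩
  have : I.boundary (net A f) I.s ≤ I.boundary g I.s := hmax (Feasible.net_mem_netFlows hf)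
  rwa [boundary_net, ← value_ofNet hg] at this

/-- `g` lives on `A` and respects the residual capacities of `f` to first order. -/
def IsResidualDirection (A : Finset (Fin I.m)) (f : I.DArc → ℝ) (g : Fin I.m → ℝ) : Prop :=
  (∀ i ∉ A, g i = 0) ∧ (∀ i, 0 < g i → net A f i < I.cap i) ∧
    ∀ i, g i < 0 → -I.cap i < net A f i

theorem IsResidualDirection.add_single {i : Fin I.m} {a : ℝ} (hg : IsResidualDirection A f g)
    (hi : i ∈ A) (hpos : 0 < a → net A f i < I.cap i) (hneg : a < 0 → -I.cap i < net A f i) :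
    IsResidualDirection A f (g + Pi.single i a) := by
  obtain ⟨hsupp, hgpos, hgneg⟩ := hg
  refine ⟨fun j hj => ?_, fun j hj => ?_, fun j hj => ?_⟩
  · have : j ≠ i := fun h => hj (h ▸ hi)
    simp [hsupp j hj, this]
  · rcases eq_or_ne j i with rfl | hji
    · have hsum : 0 < g j + a := by simpa using hj
      rcases lt_or_ge 0 a with h | h
      exacts [hpos h, hgpos j (by linarith)]
    · exact hgpos j (by simpa [hji] using hj)
  · rcases eq_or_ne j i with rfl | hji
    · have hsum : g j + a < 0 := by simpa using hj
      rcases lt_or_ge a 0 with h | h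
      exacts [hneg h, hgneg j (by linarith)]
    · exact hgneg j (by simpa [hji] using hj)

theorem exists_residualDirection_of_reflTransGen {x : ℕ}
    (h : ReflTransGen (Residual A f) I.s x) :
    ∃ g, IsResidualDirection A f g ∧
      ∀ y : Fin I.n, x = y → I.boundary g = Pi.single I.s 1 - Pi.single y 1 := by
  induction h with
  | refl =>
    refine ⟨0, ⟨by simp, by simp, by simp⟩, fun y hy => ?_⟩
    rw [Fin.ext hy, sub_self, map_zero]
  | tail _ hres ih =>
    obtain ⟨g, hg, hbdry⟩ := ih
    obtain ⟨i, hi, ⟨rfl, rfl, hlt⟩ | ⟨rfl, rfl, hlt⟩⟩ := hres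
    · refine ⟨_, hg.add_single (a := 1) hi (fun _ => hlt) fun h => absurd h (by norm_num),
        fun y hy => ?_⟩
      rw [map_add, hbdry _ rfl, boundary, Fintype.linearCombination_apply_single, one_smul,
        Fin.ext hy, sub_add_sub_cancel]
    · refine ⟨_, hg.add_single (a := -1) hi (fun h => absurd h (by norm_num)) fun _ => hlt,
        fun y hy => ?_⟩
      rw [map_add, hbdry _ rfl, boundary, Fintype.linearCombination_apply_single, neg_one_smul,
        neg_sub, Fin.ext hy, sub_add_sub_cancel]

theorem eventually_abs_add_mul_le {a b c : ℝ} (hac : |a| ≤ c) (hpos : 0 < b → a < c)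
    (hneg : b < 0 → -c < a) : ∀ᶠ ε in 𝓝[>] (0 : ℝ), |a + ε * b| ≤ c := by
  have htendsto : Tendsto (fun ε : ℝ => a + ε * b) (𝓝[>] 0) (𝓝 a) := by
    have : ContinuousAt (fun ε : ℝ => a + ε * b) 0 := by fun_prop
    simpa [ContinuousAt] using this.tendsto.mono_left nhdsWithin_le_nhds
  obtain ⟨h1, h2⟩ := abs_le.1 hac
  rcases lt_trichotomy b 0 with hb | rfl | hb
  · filter_upwards [self_mem_nhdsWithin, htendsto.eventually_const_lt (hneg hb)] with ε hε hlt
    have : ε * b < 0 := mul_neg_of_pos_of_neg hε hb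
    exact abs_le.2 ⟨hlt.le, by linarith⟩
  · simpa using hac
  · filter_upwards [self_mem_nhdsWithin, htendsto.eventually_lt_const (hpos hb)] with ε hε hlt
    have : 0 < ε * b := mul_pos hε hb
    exact abs_le.2 ⟨by linarith, hlt.le⟩

theorem IsResidualDirection.exists_pos_mem_netFlows (hf : I.Feasible A f)
    (hg : IsResidualDirection A f g) (hcons : ∀ v, v ≠ I.s → v ≠ I.t → I.boundary g v = 0) :
    ∃ ε : ℝ, 0 < ε ∧ net A f + ε • g ∈ netFlows A := by
  obtain ⟨hcap, hsupp, hfcons⟩ := hf.net_mem_netFlows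
  have hevent : ∀ᶠ ε in 𝓝[>] (0 : ℝ), ∀ i, |net A f i + ε * g i| ≤ I.cap i :=
    eventually_all.2 fun i => eventually_abs_add_mul_le (hcap i) (hg.2.1 i) (hg.2.2 i)
  obtain ⟨ε, hle, hε⟩ := (hevent.and self_mem_nhdsWithin).exists
  refine ⟨ε, hε, hle, fun i hi => ?_, fun v hs ht => ?_⟩
  · simp [hsupp i hi, hg.1 i hi]
  · simp [hfcons v hs ht, hcons v hs ht]

theorem not_reflTransGen_residual (hf : I.Feasible A f)
    (hmax : IsMaxOn (I.value A) {f | I.Feasible A f} f) :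
    ¬ ReflTransGen (Residual A f) I.s I.t := by
  intro hreach
  obtain ⟨g, hg, hbdry⟩ := exists_residualDirection_of_reflTransGen hreach
  specialize hbdry I.t rfl
  obtain ⟨ε, hε, hmem⟩ := hg.exists_pos_mem_netFlows hf fun v hs ht => by simp [hbdry, hs, ht]
  have hvalue : I.value A (ofNet (net A f + ε • g)) = I.value A f + ε := by
    rw [value_ofNet hmem, map_add, map_smul, hbdry, Pi.add_apply, boundary_net, value]
    simp [I.s_ne_t]
  have : I.value A (ofNet (net A f + ε • g)) ≤ I.value A f := hmax (feasible_ofNet hmem)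
  linarith

theorem isCut_and_cutCap_eq_value (hf : I.Feasible A f)
    (hmax : IsMaxOn (I.value A) {f | I.Feasible A f} f) (hs : D I.s = true)
    (hclosed : ∀ x y, Residual A f x y → D x = true → D y = true)
    (hreach : ∀ x, D x = true → ReflTransGen (Residual A f) I.s x) :
    I.IsCut D ∧ I.cutCap A D = I.value A f := by
  have hD : I.IsCut D :=
    ⟨hs, Bool.eq_false_iff.2 fun h => not_reflTransGen_residual hf hmax (hreach _ h)⟩
  exact ⟨hD, (hf.value_eq_cutCap hD hclosed).symm⟩

theorem isLeast_cutCap_maxFlow (A : Finset (Fin I.m)) :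
    IsLeast (I.cutCap A '' {D | I.IsCut D}) (I.maxFlow A) := by
  classical
  obtain ⟨f, hf, hmax⟩ := exists_isMaxOn_value A
  have hmaxFlow : I.maxFlow A = I.value A f := by
    refine IsGreatest.csSup_eq ⟨⟨f, hf, rfl⟩, ?_⟩
    rintro _ ⟨g, hg, rfl⟩
    exact hmax hg
  rw [hmaxFlow]
  have hcut := isCut_and_cutCap_eq_value (D := fun x => ReflTransGen (Residual A f) I.s x) hf hmax
    (decide_eq_true .refl) (fun x y hxy => by simpa using fun h => h.tail hxy) (by simp)
  refine ⟨⟨_, hcut.1, hcut.2⟩, ?_⟩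
  rintro _ ⟨D, hD, rfl⟩
  exact hf.value_le_cutCap hD

theorem cutCap_erase (e : Fin I.m) (D : ℕ → Bool) :
    I.cutCap (univ.erase e) D =
      I.cutCap univ D - if D (I.tail e) ≠ D (I.head e) then I.cap e else 0 := by
  simp only [cutCap, sum_filter]
  rw [sum_erase_eq_sub (mem_univ e)]

/-- A minimum cut of `G - e` is a minimum cut of `G`, unless `e` crosses it. -/
theorem flowVit_eq (e : Fin I.m) {F x : ℝ}
    (hF : IsGLB (I.cutCap univ '' {D | I.IsCut D}) F)
    (hx : IsGLB (I.cutCap univ '' {D | I.IsCut D ∧ D (I.tail e) ≠ D (I.head e)}) x) :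
    I.flowVit e = F - min F (x - I.cap e) := by
  have hmaxFlow : I.maxFlow univ = F := (isLeast_cutCap_maxFlow univ).isGLB.unique hF
  have herase : I.maxFlow (univ.erase e) = min F (x - I.cap e) := by
    refine (isLeast_cutCap_maxFlow _).isGLB.unique ⟨?_, fun y hy => le_min (hF.2 ?_)
      (le_sub_iff_add_le.2 (hx.2 ?_))⟩
    · rintro _ ⟨D, hD, rfl⟩
      rw [cutCap_erase]
      split_ifs with h
      · exact (min_le_right _ _).trans (sub_le_sub_right (hx.1 ⟨D, ⟨hD, h⟩, rfl⟩) _)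
      · exact (min_le_left _ _).trans (by simpa using hF.1 ⟨D, hD, rfl⟩)
    · rintro _ ⟨D, hD, rfl⟩
      have := hy ⟨D, hD, rfl⟩
      have := I.cap_nonneg e
      rw [cutCap_erase] at *
      split_ifs at * <;> linarith
    · rintro _ ⟨D, hD, rfl⟩
      have := hy ⟨D, hD.1, rfl⟩
      rw [cutCap_erase, if_pos hD.2] at this
      linarith
  rw [flowVit, hmaxFlow, herase]

end Network

/-! ### Trees of cheapest cuts -/

section Separation

variable {V L : Type*} [CompleteLinearOrder L] {F : Set (V → Bool)} {w : (V → Bool) → L}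
  {u v x : V} {y : L} {C : V → Bool}

/-- The least weight of a bipartition in `F` that separates `u` from `v`. -/
noncomputable def sepVal (F : Set (V → Bool)) (w : (V → Bool) → L) (u v : V) : L :=
  ⨅ D, ⨅ (_ : D ∈ F ∧ D u ≠ D v), w D

/-- `C` is a cheapest bipartition in `F` that separates `u` from `v`. -/
structure IsMinSep (F : Set (V → Bool)) (w : (V → Bool) → L) (u v : V) (C : V → Bool) : Prop where
  mem : C ∈ F
  ne : C u ≠ C v
  le : w C ≤ sepVal F w u v

theorem sepVal_le (hC : C ∈ F) (h : C u ≠ C v) : sepVal F w u v ≤ w C := iInf₂_le C ⟨hC, h⟩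

theorem le_sepVal (h : ∀ D ∈ F, D u ≠ D v → y ≤ w D) : y ≤ sepVal F w u v :=
  le_iInf₂ fun D hD => h D hD.1 hD.2

theorem IsMinSep.eq (h : IsMinSep F w u v C) : w C = sepVal F w u v :=
  h.le.antisymm (sepVal_le h.mem h.ne)

theorem sepVal_self (u : V) : sepVal F w u u = ⊤ :=
  top_le_iff.1 (le_sepVal fun _ _ h => absurd rfl h)

theorem sepVal_comm (u v : V) : sepVal F w u v = sepVal F w v u := by
  simp only [sepVal, ne_comm]

theorem IsMinSep.symm (h : IsMinSep F w u v C) : IsMinSep F w v u C :=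
  ⟨h.mem, h.ne.symm, h.le.trans (sepVal_comm u v).le⟩

theorem min_le_sepVal (u v x : V) :
    min (sepVal F w u v) (sepVal F w v x) ≤ sepVal F w u x := by
  refine le_sepVal fun D hD h => ?_
  by_cases huv : D u = D v
  · exact (min_le_right _ _).trans (sepVal_le hD (huv ▸ h))
  · exact (min_le_left _ _).trans (sepVal_le hD huv)

theorem lt_sepVal_trans (h₁ : y < sepVal F w u v) (h₂ : y < sepVal F w v x) :
    y < sepVal F w u x :=
  (lt_min h₁ h₂).trans_le (min_le_sepVal u v x)

theorem eq_of_lt_sepVal (hC : C ∈ F) (h : w C < sepVal F w u v) : C u = C v := by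
  by_contra hne
  exact (sepVal_le hC hne).not_gt h

end Separation

section Tree

variable {L : Type*} [CompleteLinearOrder L] {F : Set (ℕ → Bool)} {w : (ℕ → Bool) → L}
  {n k q r : ℕ} {ρ par par' : ℕ → ℕ} {val val' : ℕ → L} {C D : ℕ → Bool}

/-- The tree node that represents `x` once `0, …, k - 1` are the tree nodes and every other node is
attached to its parent. -/
def treeRep (k : ℕ) (par : ℕ → ℕ) (x : ℕ) : ℕ := if x < k then x else par x

/-- The parents after round `k`, in which `k` becomes a tree node and `C` separates it from its
parent: `k` takes over the nodes on its side of `C` that are attached to a tree node which is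
costlier to separate from `par k` than `k` is. -/
noncomputable def reattach (F : Set (ℕ → Bool)) (w : (ℕ → Bool) → L) (C : ℕ → Bool) (k : ℕ)
    (par : ℕ → ℕ) (x : ℕ) : ℕ :=
  if k < x ∧ C x = C k ∧ w C < sepVal F w (par x) (par k) then k else par x

/-- `D` is a cheapest bipartition separating `q` from `r`, and it keeps each node `x < n` with `q`
(or with `r`) whenever its representative `ρ x` is costlier to separate from `q` (or from `r`). -/
structure IsCompatibleSep (F : Set (ℕ → Bool)) (w : (ℕ → Bool) → L) (n : ℕ) (ρ : ℕ → ℕ) (q r : ℕ)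
    (D : ℕ → Bool) : Prop extends IsMinSep F w q r D where
  left : ∀ x < n, sepVal F w q r < sepVal F w (ρ x) q → D x = D q
  right : ∀ x < n, sepVal F w q r < sepVal F w (ρ x) r → D x = D r

/-- After `k` rounds: the nodes below `k` form a tree with parents `par` whose arcs `(a, par a)` of
weight `val a` represent `sepVal`, and every other node `x < n` is attached to the tree node
`par x`. -/
structure TreeInv (F : Set (ℕ → Bool)) (w : (ℕ → Bool) → L) (n k : ℕ) (par : ℕ → ℕ)
    (val : ℕ → L) : Prop where
  par_lt_self : ∀ x < n, 0 < x → par x < x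
  par_lt : ∀ x < n, k ≤ x → par x < k
  sep : ∀ a < k, ∀ b < a, sepVal F w a b = min (val a) (sepVal F w (par a) b)
  cut : ∀ q < k, ∀ r < k, q ≠ r → ∃ D, IsCompatibleSep F w n (treeRep k par) q r D

open Classical in
/-- The root of the component of `x` if each tree node `a` with `keep a` stays joined to its parent
`par a`, and all other arcs of the tree are deleted. -/
noncomputable def componentRoot (par : ℕ → ℕ) (keep : ℕ → Prop) (x : ℕ) : ℕ :=
  if _ : par x < x ∧ keep x then componentRoot par keep (par x) else x

theorem componentRoot_le (par : ℕ → ℕ) (keep : ℕ → Prop) (x : ℕ) :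
    componentRoot par keep x ≤ x := by
  induction x using Nat.strong_induction_on with
  | _ x ih =>
    rw [componentRoot]
    split_ifs with hx
    · exact (ih _ hx.1).trans hx.1.le
    · exact le_rfl

theorem IsCompatibleSep.symm (h : IsCompatibleSep F w n ρ q r D) :
    IsCompatibleSep F w n ρ r q D where
  toIsMinSep := h.toIsMinSep.symm
  left := by rw [sepVal_comm r q]; exact h.right
  right := by rw [sepVal_comm r q]; exact h.left

theorem treeInv_one (hpar : ∀ x < n, par x = 0) : TreeInv F w n 1 par val where
  par_lt_self x hx h0 := by rwa [hpar x hx]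
  par_lt x hx _ := by rw [hpar x hx]; exact one_pos
  sep a ha b hb := by omega
  cut q hq r hr hne := by omega

namespace TreeInv

theorem congr (h : TreeInv F w n k par val) (hkn : k ≤ n) (hpar : ∀ x < n, par' x = par x)
    (hval : ∀ a < k, val' a = val a) : TreeInv F w n k par' val' where
  par_lt_self x hx h0 := by rw [hpar x hx]; exact h.par_lt_self x hx h0
  par_lt x hx hkx := by rw [hpar x hx]; exact h.par_lt x hx hkx
  sep a ha b hb := by rw [hpar a (by omega), hval a ha]; exact h.sep a ha b hb
  cut q hq r hr hqr := by
    obtain ⟨D, hD⟩ := h.cut q hq r hr hqr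
    have hrep : ∀ x < n, treeRep k par' x = treeRep k par x := fun x hx => by
      rw [treeRep, treeRep, hpar x hx]
    exact ⟨D, hD.toIsMinSep, fun x hx => by rw [hrep x hx]; exact hD.left x hx,
      fun x hx => by rw [hrep x hx]; exact hD.right x hx⟩

theorem sepVal_new (h : TreeInv F w n k par val) (hkn : k < n) (hC : IsMinSep F w k (par k) C)
    (hq : q < k) : sepVal F w k q = min (w C) (sepVal F w (par k) q) := by
  refine le_antisymm ?_ (hC.eq ▸ min_le_sepVal _ _ _)
  have hle : sepVal F w k q ≤ sepVal F w (par k) q := by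
    rcases eq_or_ne (par k) q with hpq | hpq
    · rw [hpq, sepVal_self]; exact le_top
    rcases eq_top_or_lt_top (sepVal F w (par k) q) with ht | ht
    · rw [ht]; exact le_top
    obtain ⟨D, hD⟩ := h.cut _ (h.par_lt k hkn le_rfl) q hq hpq
    have hDk : D k = D (par k) := hD.left k hkn (by simpa [treeRep, sepVal_self] using ht)
    exact (sepVal_le hD.mem (hDk ▸ hD.ne)).trans hD.le
  refine le_min ?_ hle
  rcases le_or_gt (sepVal F w (par k) q) (w C) with hqC | hCq
  · exact hle.trans hqC
  · exact sepVal_le hC.mem (eq_of_lt_sepVal hC.mem hCq ▸ hC.ne)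

theorem treeRep_reattach (h : TreeInv F w n k par val) (hC : IsMinSep F w k (par k) C)
    (htop : w C < ⊤) {x : ℕ} (hx : x < n) :
    (treeRep (k + 1) (reattach F w C k par) x = k ∧ C x = C k ∧
        w C < sepVal F w (treeRep k par x) (par k)) ∨
      (treeRep (k + 1) (reattach F w C k par) x = treeRep k par x ∧ treeRep k par x < k ∧
        (w C < sepVal F w (treeRep k par x) (par k) → C x ≠ C k)) := by
  rcases lt_trichotomy x k with hxk | rfl | hxk
  · have hrep : treeRep k par x = x := if_pos hxk
    rw [hrep, treeRep, if_pos (by omega)]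
    exact .inr ⟨rfl, hxk, fun hlt => eq_of_lt_sepVal hC.mem hlt ▸ hC.ne.symm⟩
  · simp [treeRep, sepVal_self, htop]
  · have hrep : treeRep k par x = par x := if_neg (by omega)
    rw [hrep, treeRep, if_neg (by omega), reattach]
    split_ifs with hc
    · exact .inl ⟨rfl, hc.2⟩
    · exact .inr ⟨rfl, h.par_lt x hx hxk.le, fun hlt hCx => hc ⟨hxk, hCx, hlt⟩⟩

theorem isCompatibleSep_reattach_new (h : TreeInv F w n k par val) (hkn : k < n)
    (hC : IsMinSep F w k (par k) C) (htop : w C < ⊤) (hr : r < k)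
    (hlt : w C < sepVal F w (par k) r) :
    IsCompatibleSep F w n (treeRep (k + 1) (reattach F w C k par)) k r C := by
  have hkr : sepVal F w k r = w C := by rw [h.sepVal_new hkn hC hr, min_eq_left hlt.le]
  have hCr : C (par k) = C r := eq_of_lt_sepVal hC.mem hlt
  refine ⟨⟨hC.mem, hCr ▸ hC.ne, hkr.ge⟩, fun x hx hxlt => ?_, fun x hx hxlt => ?_⟩
  · rcases h.treeRep_reattach hC htop hx with ⟨-, hCx, -⟩ | ⟨hrep, hxk, -⟩
    · exact hCx
    · rw [hrep, hkr, sepVal_comm _ k, h.sepVal_new hkn hC hxk] at hxlt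
      exact absurd (min_le_left _ _) hxlt.not_ge
  · rcases h.treeRep_reattach hC htop hx with ⟨hrep, -, -⟩ | ⟨hrep, -, hCx⟩
    · rw [hrep] at hxlt
      exact absurd hxlt (lt_irrefl _)
    · rw [hrep, hkr] at hxlt
      have hCxk := hCx (lt_sepVal_trans hxlt (by rwa [sepVal_comm]))
      exact ((Bool.eq_not_of_ne hCxk).trans (Bool.eq_not_of_ne hC.ne.symm).symm).trans hCr

theorem isCompatibleSep_reattach_par (h : TreeInv F w n k par val) (hkn : k < n)
    (hC : IsMinSep F w k (par k) C) (htop : w C < ⊤) (hr : r < k)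
    (hle : sepVal F w (par k) r ≤ w C) (hD : IsCompatibleSep F w n (treeRep k par) (par k) r D) :
    IsCompatibleSep F w n (treeRep (k + 1) (reattach F w C k par)) k r D := by
  have hkr : sepVal F w k r = sepVal F w (par k) r := by
    rw [h.sepVal_new hkn hC hr, min_eq_right hle]
  have hDk : D k = D (par k) :=
    hD.left k hkn (by simpa [treeRep, sepVal_self] using hle.trans_lt htop)
  refine ⟨⟨hD.mem, hDk ▸ hD.ne, hkr ▸ hD.le⟩, fun x hx hxlt => ?_, fun x hx hxlt => ?_⟩
  · rw [hDk]
    refine hD.left x hx ?_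
    rcases h.treeRep_reattach hC htop hx with ⟨-, -, hlt⟩ | ⟨hrep, hxk, -⟩
    · exact hle.trans_lt hlt
    · rw [hrep, hkr, sepVal_comm _ k, h.sepVal_new hkn hC hxk] at hxlt
      rw [sepVal_comm _ (par k)]
      exact hxlt.trans_le (min_le_right _ _)
  · rcases h.treeRep_reattach hC htop hx with ⟨hrep, -, -⟩ | ⟨hrep, -, -⟩
    · rw [hrep] at hxlt
      exact absurd hxlt (lt_irrefl _)
    · rw [hrep, hkr] at hxlt
      exact hD.right x hx hxlt

theorem isCompatibleSep_reattach_old (h : TreeInv F w n k par val) (hkn : k < n)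
    (hC : IsMinSep F w k (par k) C) (htop : w C < ⊤) (hq : q < k) (hr : r < k)
    (hD : IsCompatibleSep F w n (treeRep k par) q r D) :
    IsCompatibleSep F w n (treeRep (k + 1) (reattach F w C k par)) q r D := by
  have hlift : ∀ y < k, ∀ x < n,
      sepVal F w q r < sepVal F w (treeRep (k + 1) (reattach F w C k par) x) y →
      sepVal F w q r < sepVal F w (treeRep k par x) y := by
    intro y hy x hx hxlt
    rcases h.treeRep_reattach hC htop hx with ⟨hrep, -, hlt⟩ | ⟨hrep, -, -⟩
    · rw [hrep, h.sepVal_new hkn hC hy, lt_min_iff] at hxlt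
      exact lt_sepVal_trans (hxlt.1.trans hlt) hxlt.2
    · rwa [hrep] at hxlt
  exact ⟨hD.toIsMinSep, fun x hx hlt => hD.left x hx (hlift q hq x hx hlt),
    fun x hx hlt => hD.right x hx (hlift r hr x hx hlt)⟩

theorem exists_isCompatibleSep_reattach (h : TreeInv F w n k par val) (hkn : k < n)
    (hC : IsMinSep F w k (par k) C) (htop : w C < ⊤) (hr : r < k) :
    ∃ D, IsCompatibleSep F w n (treeRep (k + 1) (reattach F w C k par)) k r D := by
  rcases lt_or_ge (w C) (sepVal F w (par k) r) with hlt | hle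
  · exact ⟨C, h.isCompatibleSep_reattach_new hkn hC htop hr hlt⟩
  · have hpr : par k ≠ r := by
      rintro rfl
      rw [sepVal_self] at hle
      exact hle.not_gt htop
    obtain ⟨D, hD⟩ := h.cut _ (h.par_lt k hkn le_rfl) r hr hpr
    exact ⟨D, h.isCompatibleSep_reattach_par hkn hC htop hr hle hD⟩

theorem reattach (h : TreeInv F w n k par val) (hkn : k < n) (hC : IsMinSep F w k (par k) C)
    (htop : w C < ⊤) :
    TreeInv F w n (k + 1) (reattach F w C k par) (Function.update val k (w C)) where
  par_lt_self x hx h0 := by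
    unfold MaxFlowVitality.reattach
    split_ifs with hc
    exacts [hc.1, h.par_lt_self x hx h0]
  par_lt x hx hkx := by
    unfold MaxFlowVitality.reattach
    split_ifs
    exacts [k.lt_succ_self, (h.par_lt x hx (by omega)).trans k.lt_succ_self]
  sep a ha b hb := by
    rw [MaxFlowVitality.reattach, if_neg (by omega)]
    rcases Nat.lt_succ_iff_lt_or_eq.1 ha with hak | rfl
    · rw [Function.update_of_ne hak.ne]
      exact h.sep a hak b hb
    · rw [Function.update_self]
      exact h.sepVal_new hkn hC hb
  cut q hq r hr hqr := by
    rcases Nat.lt_succ_iff_lt_or_eq.1 hq with hqk | rfl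
    · rcases Nat.lt_succ_iff_lt_or_eq.1 hr with hrk | rfl
      · exact (h.cut q hqk r hrk hqr).imp fun D =>
          h.isCompatibleSep_reattach_old hkn hC htop hqk hrk
      · exact (h.exists_isCompatibleSep_reattach hkn hC htop hqk).imp fun D => .symm
    · exact h.exists_isCompatibleSep_reattach hkn hC htop (by omega)

theorem lt_sepVal_iff (h : TreeInv F w n k par val) (hkn : k ≤ n) {y : L} (hy : y < ⊤) {a b : ℕ}
    (ha : a < k) (hb : b < k) :
    componentRoot par (y < val ·) a = componentRoot par (y < val ·) b ↔ y < sepVal F w a b := by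
  have hlt : ∀ a < k, ∀ b < a, componentRoot par (y < val ·) a = componentRoot par (y < val ·) b ↔
      y < sepVal F w a b := by
    intro a
    induction a using Nat.strong_induction_on with
    | _ a ih =>
      intro ha b hb
      have hp := h.par_lt_self a (by omega) (by omega)
      rw [componentRoot, h.sep a ha b hb, lt_min_iff]
      split_ifs with hc
      · rw [and_iff_right hc.2]
        rcases lt_trichotomy (par a) b with hpb | rfl | hpb
        · rw [eq_comm, ih b hb (by omega) _ hpb, sepVal_comm]
        · simp [sepVal_self, hy]
        · exact ih _ hp (by omega) b hpb
      · have hle := componentRoot_le par (y < val ·) b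
        exact ⟨fun hab => by omega, fun hsep => absurd ⟨hp, hsep.1⟩ hc⟩
  rcases lt_trichotomy a b with hab | rfl | hab
  · rw [eq_comm, hlt b hb a hab, sepVal_comm]
  · simp [sepVal_self, hy]
  · exact hlt a ha b hab

end TreeInv

end Tree

/-! ### Running times of programs -/

infixr:60 ";;" => Cmd.seq

/-- `c.rate * X` bounds the number of steps of `c` if `1 ≤ X` and the iteration bounds of nested
loops have product at most `X`. -/
def Cmd.rate : Cmd → ℕ
  | .skip => 1
  | .setI _ e => e.cost + 1
  | .setR _ e => e.cost + 1
  | .storeI _ i e => i.cost + e.cost + 1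
  | .storeR _ i e => i.cost + e.cost + 1
  | .seq c₁ c₂ => c₁.rate + c₂.rate
  | .cond b c₁ c₂ => b.cost + c₁.rate + c₂.rate
  | .loop b c => b.cost + c.rate + b.cost
  | .maxflow _ _ _ => 1

/-- Programs without loops and without calls of the routine. -/
def Cmd.Straight : Cmd → Prop
  | .seq c₁ c₂ => c₁.Straight ∧ c₂.Straight
  | .cond _ c₁ c₂ => c₁.Straight ∧ c₂.Straight
  | .loop _ _ => False
  | .maxflow _ _ _ => False
  | _ => True

open Classical in
/-- The effect of a straight program on the memory (loops and calls are ignored). -/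
noncomputable def Cmd.sem : Cmd → State → State
  | .skip, σ => σ
  | .setI x e, σ => { σ with ivar := Function.update σ.ivar x (e.eval σ) }
  | .setR x e, σ => { σ with rvar := Function.update σ.rvar x (e.eval σ) }
  | .storeI a i e, σ =>
    { σ with iarr := Function.update σ.iarr a (Function.update (σ.iarr a) (i.eval σ) (e.eval σ)) }
  | .storeR a i e, σ =>
    { σ with rarr := Function.update σ.rarr a (Function.update (σ.rarr a) (i.eval σ) (e.eval σ)) }
  | .seq c₁ c₂, σ => c₂.sem (c₁.sem σ)
  | .cond b c₁ c₂, σ => if b.Holds σ then c₁.sem σ else c₂.sem σ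
  | .loop _ _, σ => σ
  | .maxflow _ _ _, σ => σ

/-- The integer variables that a program may change. -/
def Cmd.writesIvar : Cmd → List ℕ
  | .setI x _ => [x]
  | .seq c₁ c₂ => c₁.writesIvar ++ c₂.writesIvar
  | .cond _ c₁ c₂ => c₁.writesIvar ++ c₂.writesIvar
  | .loop _ c => c.writesIvar
  | _ => []

/-- The integer arrays that a program may change. -/
def Cmd.writesIarr : Cmd → List ℕ
  | .storeI a _ _ => [a]
  | .seq c₁ c₂ => c₁.writesIarr ++ c₂.writesIarr
  | .cond _ c₁ c₂ => c₁.writesIarr ++ c₂.writesIarr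
  | .loop _ c => c.writesIarr
  | _ => []

/-- The real variables that a program may change. -/
def Cmd.writesRvar : Cmd → List ℕ
  | .setR x _ => [x]
  | .seq c₁ c₂ => c₁.writesRvar ++ c₂.writesRvar
  | .cond _ c₁ c₂ => c₁.writesRvar ++ c₂.writesRvar
  | .loop _ c => c.writesRvar
  | _ => []

/-- The real arrays that a program may change. -/
def Cmd.writesRarr : Cmd → List ℕ
  | .storeR a _ _ => [a]
  | .seq c₁ c₂ => c₁.writesRarr ++ c₂.writesRarr
  | .cond _ c₁ c₂ => c₁.writesRarr ++ c₂.writesRarr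
  | .loop _ c => c.writesRarr
  | .maxflow _ a b => [a, b]
  | _ => []

/-- The memories `σ` and `τ` agree wherever `c` does not write. -/
structure Frame (c : Cmd) (σ τ : State) : Prop where
  ivar : ∀ x, x ∉ c.writesIvar → τ.ivar x = σ.ivar x
  iarr : ∀ x, x ∉ c.writesIarr → τ.iarr x = σ.iarr x
  rvar : ∀ x, x ∉ c.writesRvar → τ.rvar x = σ.rvar x
  rarr : ∀ x, x ∉ c.writesRarr → τ.rarr x = σ.rarr x

theorem Frame.refl (c : Cmd) (σ : State) : Frame c σ σ :=
  ⟨fun _ _ => rfl, fun _ _ => rfl, fun _ _ => rfl, fun _ _ => rfl⟩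

theorem Frame.trans {c : Cmd} {σ τ υ : State} (h₁ : Frame c σ τ) (h₂ : Frame c τ υ) :
    Frame c σ υ :=
  ⟨fun x hx => (h₂.ivar x hx).trans (h₁.ivar x hx), fun x hx => (h₂.iarr x hx).trans (h₁.iarr x hx),
    fun x hx => (h₂.rvar x hx).trans (h₁.rvar x hx),
    fun x hx => (h₂.rarr x hx).trans (h₁.rarr x hx)⟩

theorem Frame.mono {c c' : Cmd} {σ τ : State} (h : Frame c σ τ)
    (h₁ : c.writesIvar ⊆ c'.writesIvar) (h₂ : c.writesIarr ⊆ c'.writesIarr)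
    (h₃ : c.writesRvar ⊆ c'.writesRvar) (h₄ : c.writesRarr ⊆ c'.writesRarr) : Frame c' σ τ :=
  ⟨fun x hx => h.ivar x fun hh => hx (h₁ hh), fun x hx => h.iarr x fun hh => hx (h₂ hh),
    fun x hx => h.rvar x fun hh => hx (h₃ hh), fun x hx => h.rarr x fun hh => hx (h₄ hh)⟩

theorem Frame.seq_left {c c' : Cmd} {σ τ : State} (h : Frame c σ τ) : Frame (c ;; c') σ τ :=
  h.mono (List.subset_append_left _ _) (List.subset_append_left _ _)
    (List.subset_append_left _ _) (List.subset_append_left _ _)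

theorem Frame.seq_right {c c' : Cmd} {σ τ : State} (h : Frame c' σ τ) : Frame (c ;; c') σ τ :=
  h.mono (List.subset_append_right _ _) (List.subset_append_right _ _)
    (List.subset_append_right _ _) (List.subset_append_right _ _)

theorem Frame.cond_left {b : BExp} {c c' : Cmd} {σ τ : State} (h : Frame c σ τ) :
    Frame (.cond b c c') σ τ :=
  h.mono (List.subset_append_left _ _) (List.subset_append_left _ _)
    (List.subset_append_left _ _) (List.subset_append_left _ _)

theorem Frame.cond_right {b : BExp} {c c' : Cmd} {σ τ : State} (h : Frame c' σ τ) :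
    Frame (.cond b c c') σ τ :=
  h.mono (List.subset_append_right _ _) (List.subset_append_right _ _)
    (List.subset_append_right _ _) (List.subset_append_right _ _)

theorem Frame.of_loop {b : BExp} {c : Cmd} {σ τ : State} (h : Frame (.loop b c) σ τ) :
    Frame c σ τ := h.mono (fun _ h => h) (fun _ h => h) (fun _ h => h) (fun _ h => h)

theorem Frame.loop {b : BExp} {c : Cmd} {σ τ : State} (h : Frame c σ τ) :
    Frame (.loop b c) σ τ := h.mono (fun _ h => h) (fun _ h => h) (fun _ h => h) (fun _ h => h)

theorem Exec.frame {R : MaxFlowRoutine} {c : Cmd} {σ τ : State} {k : ℕ} {l : List Network}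
    (h : Exec R c σ τ k l) : Frame c σ τ := by
  induction h with
  | skip => exact Frame.refl _ _
  | setI => exact ⟨fun x hx => Function.update_of_ne (by simpa [Cmd.writesIvar] using hx) _ _,
      fun _ _ => rfl, fun _ _ => rfl, fun _ _ => rfl⟩
  | setR => exact ⟨fun _ _ => rfl, fun _ _ => rfl,
      fun x hx => Function.update_of_ne (by simpa [Cmd.writesRvar] using hx) _ _, fun _ _ => rfl⟩
  | storeI => exact ⟨fun _ _ => rfl,
      fun x hx => Function.update_of_ne (by simpa [Cmd.writesIarr] using hx) _ _,
      fun _ _ => rfl, fun _ _ => rfl⟩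
  | storeR => exact ⟨fun _ _ => rfl, fun _ _ => rfl, fun _ _ => rfl,
      fun x hx => Function.update_of_ne (by simpa [Cmd.writesRarr] using hx) _ _⟩
  | seq _ _ ih₁ ih₂ => exact ih₁.seq_left.trans ih₂.seq_right
  | condTrue _ _ ih => exact ih.cond_left
  | condFalse _ _ ih => exact ih.cond_right
  | loopDone => exact Frame.refl _ _
  | loopStep _ _ _ ih₁ ih₂ => exact ih₁.loop.trans ih₂
  | maxflow I _ =>
    refine ⟨fun _ _ => rfl, fun _ _ => rfl, fun _ _ => rfl, fun x hx => ?_⟩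
    simp only [Cmd.writesRarr, List.mem_cons, List.not_mem_nil, or_false, not_or] at hx
    simp [State.writeFlow, hx.1, hx.2]

/-- Total correctness: `c` started in `σ` halts after at most `B` steps, and the final memory and
the list of calls satisfy `Q`. -/
def HaltsWithin (R : MaxFlowRoutine) (B : ℕ) (c : Cmd) (σ : State)
    (Q : State → List Network → Prop) : Prop :=
  ∃ τ k l, Exec R c σ τ k l ∧ k ≤ B ∧ Q τ l

/-- Total correctness within the time given by the rate of `c`. -/
def Runs (R : MaxFlowRoutine) (X : ℕ) (c : Cmd) (σ : State) (Q : State → List Network → Prop) :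
    Prop :=
  HaltsWithin R (c.rate * X) c σ Q

/-- Total correctness, without calls of the routine, within the time given by the rate of `c`. -/
def Computes (R : MaxFlowRoutine) (X : ℕ) (c : Cmd) (σ : State) (P : State → Prop) : Prop :=
  Runs R X c σ fun τ l => l = [] ∧ P τ

/-- `for x from e while x < y do c`, where `x` and `y` are integer variables. -/
def Cmd.upto (x : ℕ) (e : IExp) (y : ℕ) (c : Cmd) : Cmd :=
  .setI x e ;; .loop (.ltI (.var x) (.var y)) (c ;; .setI x (.succ (.var x)))

section Runs

variable {R : MaxFlowRoutine} {c c₁ c₂ : Cmd} {b : BExp} {σ : State} {B B₁ B₂ X : ℕ}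
  {Q Q₁ : State → List Network → Prop} {P P₁ : State → Prop}

theorem HaltsWithin.mono (h : HaltsWithin R B₁ c σ Q₁) (hB : B₁ ≤ B)
    (hQ : ∀ τ l, Frame c σ τ → Q₁ τ l → Q τ l) : HaltsWithin R B c σ Q := by
  obtain ⟨τ, k, l, he, hk, hq⟩ := h
  exact ⟨τ, k, l, he, hk.trans hB, hQ τ l he.frame hq⟩

theorem HaltsWithin.seq (h₁ : HaltsWithin R B₁ c₁ σ Q₁)
    (h₂ : ∀ τ l, Frame c₁ σ τ → Q₁ τ l → HaltsWithin R B₂ c₂ τ fun υ l' => Q υ (l ++ l')) :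
    HaltsWithin R (B₁ + B₂) (c₁ ;; c₂) σ Q := by
  obtain ⟨τ, k, l, he, hk, hq⟩ := h₁
  obtain ⟨υ, k', l', he', hk', hq'⟩ := h₂ τ l he.frame hq
  exact ⟨υ, _, _, .seq he he', add_le_add hk hk', hq'⟩

theorem HaltsWithin.cond (h₁ : b.Holds σ → HaltsWithin R B₁ c₁ σ Q)
    (h₂ : ¬ b.Holds σ → HaltsWithin R B₂ c₂ σ Q) :
    HaltsWithin R (b.cost + B₁ + B₂) (.cond b c₁ c₂) σ Q := by
  by_cases hb : b.Holds σ
  · obtain ⟨τ, k, l, he, hk, hq⟩ := h₁ hb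
    exact ⟨τ, _, _, .condTrue hb he, by omega, hq⟩
  · obtain ⟨τ, k, l, he, hk, hq⟩ := h₂ hb
    exact ⟨τ, _, _, .condFalse hb he, by omega, hq⟩

/-- The first argument of `Inv` bounds the number of remaining iterations. -/
theorem HaltsWithin.loop {Inv : ℕ → State → List Network → Prop}
    (step : ∀ f τ l, Inv f τ l → b.Holds τ →
      HaltsWithin R B c τ fun υ l' => ∃ f' < f, Inv f' υ (l ++ l'))
    (f : ℕ) (l₀ : List Network) (h₀ : Inv f σ l₀) :
    HaltsWithin R (f * (b.cost + B) + b.cost) (.loop b c) σ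
      fun τ l => ¬ b.Holds τ ∧ ∃ f', Inv f' τ (l₀ ++ l) := by
  induction f using Nat.strong_induction_on generalizing σ l₀ with
  | _ f ih =>
    by_cases hb : b.Holds σ
    · obtain ⟨τ, k, l, he, hk, f', hf', hinv⟩ := step f σ l₀ h₀ hb
      obtain ⟨υ, k', l', he', hk', hb', f'', hinv'⟩ := ih f' hf' _ hinv
      refine ⟨υ, _, _, .loopStep hb he he', ?_, hb', f'', by simpa using hinv'⟩
      have : (f' + 1) * (b.cost + B) ≤ f * (b.cost + B) := Nat.mul_le_mul_right _ hf'
      linarith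
    · exact ⟨σ, _, _, .loopDone hb, by omega, hb, f, by simpa using h₀⟩

theorem Runs.mono (h : Runs R X c σ Q₁) (hQ : ∀ τ l, Frame c σ τ → Q₁ τ l → Q τ l) :
    Runs R X c σ Q :=
  HaltsWithin.mono h le_rfl hQ

theorem Runs.seq (h₁ : Runs R X c₁ σ Q₁)
    (h₂ : ∀ τ l, Frame c₁ σ τ → Q₁ τ l → Runs R X c₂ τ fun υ l' => Q υ (l ++ l')) :
    Runs R X (c₁ ;; c₂) σ Q := by
  simpa only [Runs, Cmd.rate, add_mul] using HaltsWithin.seq h₁ h₂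

theorem Runs.cond (hX : 1 ≤ X) (h₁ : b.Holds σ → Runs R X c₁ σ Q)
    (h₂ : ¬ b.Holds σ → Runs R X c₂ σ Q) : Runs R X (.cond b c₁ c₂) σ Q := by
  refine (HaltsWithin.cond h₁ h₂).mono ?_ fun _ _ _ h => h
  have : b.cost ≤ b.cost * X := Nat.le_mul_of_pos_right _ hX
  simp only [Cmd.rate, add_mul]
  omega

theorem Computes.mono (h : Computes R X c σ P₁) (hP : ∀ τ, Frame c σ τ → P₁ τ → P τ) :
    Computes R X c σ P :=
  Runs.mono h fun τ _ hf h => ⟨h.1, hP τ hf h.2⟩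

theorem Computes.runs (h : Computes R X c σ P) (hQ : ∀ τ, Frame c σ τ → P τ → Q τ []) :
    Runs R X c σ Q :=
  Runs.mono h fun τ _ hf h => h.1 ▸ hQ τ hf h.2

theorem Computes.runs_seq (h₁ : Computes R X c₁ σ P₁)
    (h₂ : ∀ τ, Frame c₁ σ τ → P₁ τ → Runs R X c₂ τ Q) : Runs R X (c₁ ;; c₂) σ Q :=
  Runs.seq h₁ fun τ l hf h => by simpa [h.1] using h₂ τ hf h.2

theorem Computes.seq (h₁ : Computes R X c₁ σ P₁)
    (h₂ : ∀ τ, Frame c₁ σ τ → P₁ τ → Computes R X c₂ τ P) : Computes R X (c₁ ;; c₂) σ P :=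
  h₁.runs_seq h₂

theorem Runs.seq_computes (h₁ : Runs R X c₁ σ Q₁)
    (h₂ : ∀ τ l, Frame c₁ σ τ → Q₁ τ l → Computes R X c₂ τ fun υ => Q υ l) :
    Runs R X (c₁ ;; c₂) σ Q :=
  h₁.seq fun τ l hf h => Runs.mono (h₂ τ l hf h) fun υ l' _ h' => by simpa [h'.1] using h'.2

theorem Cmd.Straight.exec (hc : c.Straight) (σ : State) :
    ∃ k ≤ c.rate, Exec R c σ (c.sem σ) k [] := by
  induction c generalizing σ with
  | skip => exact ⟨_, le_rfl, .skip σ⟩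
  | setI x e => exact ⟨_, le_rfl, .setI σ x e⟩
  | setR x e => exact ⟨_, le_rfl, .setR σ x e⟩
  | storeI a i e => exact ⟨_, le_rfl, .storeI σ a i e⟩
  | storeR a i e => exact ⟨_, le_rfl, .storeR σ a i e⟩
  | seq c₁ c₂ ih₁ ih₂ =>
    obtain ⟨k, hk, he⟩ := ih₁ hc.1 σ
    obtain ⟨k', hk', he'⟩ := ih₂ hc.2 (c₁.sem σ)
    exact ⟨_, add_le_add hk hk', .seq he he'⟩
  | cond b c₁ c₂ ih₁ ih₂ =>
    by_cases hb : b.Holds σ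
    · obtain ⟨k, hk, he⟩ := ih₁ hc.1 σ
      refine ⟨b.cost + k, by simp only [Cmd.rate]; omega, ?_⟩
      simp only [Cmd.sem, if_pos hb]
      exact .condTrue hb he
    · obtain ⟨k, hk, he⟩ := ih₂ hc.2 σ
      refine ⟨b.cost + k, by simp only [Cmd.rate]; omega, ?_⟩
      simp only [Cmd.sem, if_neg hb]
      exact .condFalse hb he
  | loop => exact hc.elim
  | maxflow => exact hc.elim

theorem Cmd.Straight.computes (hc : c.Straight) (hX : 1 ≤ X) (h : P (c.sem σ)) :
    Computes R X c σ P := by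
  obtain ⟨k, hk, he⟩ := hc.exec (R := R) σ
  exact ⟨_, k, _, he, hk.trans (Nat.le_mul_of_pos_right _ hX), rfl, h⟩

theorem Runs.loop {Y : ℕ} (hX : 1 ≤ X) (hY : 1 ≤ Y) (Inv : ℕ → State → List Network → Prop)
    {f : ℕ} (hf : f ≤ Y) (h₀ : Inv f σ [])
    (step : ∀ f τ l, Frame c σ τ → Inv f τ l → b.Holds τ →
      Runs R X c τ fun υ l' => ∃ f' < f, Inv f' υ (l ++ l')) :
    Runs R (X * Y) (.loop b c) σ fun τ l => ¬ b.Holds τ ∧ ∃ f', Inv f' τ l := by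
  have hloop := HaltsWithin.loop (Inv := fun f τ l => Frame c σ τ ∧ Inv f τ l)
    (fun f τ l h hb => (step f τ l h.1 h.2 hb).mono fun υ l' hf ⟨f', hf', hinv⟩ =>
      ⟨f', hf', h.1.trans hf, hinv⟩) f [] ⟨Frame.refl _ _, h₀⟩
  refine HaltsWithin.mono hloop ?_ fun τ l _ ⟨hb, f', _, hinv⟩ => ⟨hb, f', hinv⟩
  calc f * (b.cost + c.rate * X) + b.cost
      ≤ Y * (b.cost * X + c.rate * X) + b.cost * (X * Y) := by
        have hXY : 1 ≤ X * Y := Nat.mul_pos hX hY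
        gcongr
        exacts [Nat.le_mul_of_pos_right _ hX, Nat.le_mul_of_pos_right _ hXY]
    _ = (Cmd.loop b c).rate * (X * Y) := by rw [Cmd.rate]; ring

theorem Computes.loop (hX : 1 ≤ X) (hc : c.Straight) (Inv : ℕ → State → Prop) {f : ℕ} (hf : f ≤ X)
    (h₀ : Inv f σ)
    (step : ∀ f τ, Frame c σ τ → Inv f τ → b.Holds τ → ∃ f' < f, Inv f' (c.sem τ)) :
    Computes R X (.loop b c) σ fun τ => ¬ b.Holds τ ∧ ∃ f', Inv f' τ := by
  have hloop : Runs R (1 * X) (.loop b c) σ _ :=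
    Runs.loop le_rfl hX (fun f τ l => l = [] ∧ Inv f τ) hf ⟨rfl, h₀⟩
      fun f τ l hτ ⟨hl, hinv⟩ hb =>
        Computes.runs (hc.computes (P := fun υ => ∃ f' < f, Inv f' υ) le_rfl
          (step f τ hτ hinv hb)) fun υ _ ⟨f', hf', hinv'⟩ =>
            ⟨f', hf', by rw [hl, List.append_nil], hinv'⟩
  rw [one_mul] at hloop
  exact hloop.mono fun τ l _ ⟨hb, f', hl, hinv⟩ => ⟨hl, hb, f', hinv⟩

theorem Computes.loop_lt {x y j₀ N : ℕ} (hX : 1 ≤ X) (hc : c.Straight) (Inv : ℕ → State → Prop)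
    (hj₀ : σ.ivar x = j₀) (hN : σ.ivar y = N) (hjN : j₀ ≤ N) (hNX : N ≤ X)
    (hx : x ∉ c.writesIvar) (hy : y ∉ c.writesIvar) (hxy : y ≠ x) (h₀ : Inv j₀ σ)
    (step : ∀ j τ, Frame (c ;; .setI x (.succ (.var x))) σ τ → τ.ivar x = j → j₀ ≤ j → j < N →
      Inv j τ → Inv (j + 1) ((c ;; .setI x (.succ (.var x))).sem τ)) :
    Computes R X (.loop (.ltI (.var x) (.var y)) (c ;; .setI x (.succ (.var x)))) σ
      fun τ => τ.ivar x = N ∧ Inv N τ := by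
  have hyN : ∀ {τ}, Frame (c ;; .setI x (.succ (.var x))) σ τ → τ.ivar y = N := fun hf => by
    rw [hf.ivar y (by simp [Cmd.writesIvar, hy, hxy]), hN]
  refine (Computes.loop hX (c := c ;; .setI x (.succ (.var x))) ⟨hc, trivial⟩
    (fun f τ => ∃ j, f = N - j ∧ j₀ ≤ j ∧ j ≤ N ∧ τ.ivar x = j ∧ Inv j τ) (f := N - j₀) (by omega)
    ⟨j₀, rfl, le_rfl, hjN, hj₀, h₀⟩ ?_).mono ?_
  · rintro f τ hf ⟨j, rfl, hj, -, hxj, hinv⟩ hb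
    have hlt : j < N := by simpa [BExp.Holds, IExp.eval, hxj, hyN hf] using hb
    obtain ⟨k, -, he⟩ := hc.exec (R := R) τ
    have hsucc : ((c ;; .setI x (.succ (.var x))).sem τ).ivar x = j + 1 := by
      simp [Cmd.sem, IExp.eval, he.frame.ivar x hx, hxj]
    exact ⟨N - (j + 1), by omega, j + 1, rfl, by omega, hlt, hsucc, step j τ hf hxj hj hlt hinv⟩
  · rintro τ hf ⟨hb, f, j, -, -, hjN', hxj, hinv⟩
    have hlt : ¬ j < N := by simpa [BExp.Holds, IExp.eval, hxj, hyN hf.of_loop] using hb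
    obtain rfl : j = N := by omega
    exact ⟨hxj, hinv⟩

theorem Computes.upto {x y j₀ N : ℕ} {e : IExp} (hX : 1 ≤ X) (hc : c.Straight)
    (Inv : ℕ → State → Prop) (he : e.eval σ = j₀) (hN : σ.ivar y = N) (hjN : j₀ ≤ N) (hNX : N ≤ X)
    (hx : x ∉ c.writesIvar) (hy : y ∉ c.writesIvar) (hxy : y ≠ x)
    (h₀ : Inv j₀ { σ with ivar := Function.update σ.ivar x j₀ })
    (step : ∀ j τ, Frame (Cmd.upto x e y c) σ τ → τ.ivar x = j → j₀ ≤ j → j < N → Inv j τ →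
      Inv (j + 1) ((c ;; .setI x (.succ (.var x))).sem τ)) :
    Computes R X (Cmd.upto x e y c) σ fun τ => τ.ivar x = N ∧ Inv N τ := by
  refine Computes.seq (Cmd.Straight.computes (c := .setI x e)
    (P := fun τ => τ = { σ with ivar := Function.update σ.ivar x j₀ }) trivial hX
    (by rw [Cmd.sem, he])) ?_
  rintro τ₁ hf₁ rfl
  exact Computes.loop_lt hX hc Inv (by simp) (by simp [hxy, hN]) hjN hNX hx hy hxy h₀
    fun j τ hf => step j τ (hf₁.seq_left.trans (Frame.seq_right hf.loop))

end Runs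

/-! ### Contraction -/

theorem Iio_add_one (j : ℕ) : Set.Iio (j + 1) = insert j (Set.Iio j) :=
  Order.Iio_succ_eq_insert j

open Classical in
/-- The arcs `e' 0, …, e' (k - 1)` with capacities `c'` form the simple graph that arises from the
multigraph with arcs `e 0, …, e (j - 1)` and capacities `c` by deleting the loops and merging
parallel arcs. -/
structure Merges {α : Type*} (e : ℕ → Sym2 α) (c : ℕ → ℝ) (j : ℕ) (e' : ℕ → Sym2 α) (c' : ℕ → ℝ)
    (k : ℕ) : Prop where
  injOn : Set.InjOn e' (Set.Iio k)
  image : e' '' Set.Iio k = {a ∈ e '' Set.Iio j | ¬ a.IsDiag}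
  cap : ∀ i < k, c' i = ∑ l ∈ range j with e l = e' i, c l

namespace Merges

variable {α : Type*} {e e' : ℕ → Sym2 α} {c c' : ℕ → ℝ} {j k : ℕ}

theorem zero : Merges e c 0 e' c' 0 where
  injOn := by simp
  image := by simp
  cap := by simp

theorem exists_eq (h : Merges e c j e' c' k) {l : ℕ} (hl : l < j) (hd : ¬ (e l).IsDiag) :
    ∃ i < k, e' i = e l :=
  h.image.ge ⟨⟨l, hl, rfl⟩, hd⟩

theorem eq_and_not_isDiag (h : Merges e c j e' c' k) {i : ℕ} (hi : i < k) :
    (∃ l < j, e l = e' i) ∧ ¬ (e' i).IsDiag :=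
  h.image.le ⟨i, hi, rfl⟩

theorem le (h : Merges e c j e' c' k) : k ≤ j := by
  have hk : (e' '' Set.Iio k).ncard = k := by simp [h.injOn.ncard_image]
  calc k = {a ∈ e '' Set.Iio j | ¬ a.IsDiag}.ncard := by rw [← h.image, hk]
    _ ≤ (e '' Set.Iio j).ncard := Set.ncard_le_ncard (Set.sep_subset _ _)
    _ ≤ (Set.Iio j).ncard := Set.ncard_image_le
    _ = j := by simp

theorem cap_nonneg (h : Merges e c j e' c' k) (hc : ∀ l < j, 0 ≤ c l) {i : ℕ} (hi : i < k) :
    0 ≤ c' i := by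
  classical
  rw [h.cap i hi]
  exact sum_nonneg fun l hl => hc l (mem_range.1 (mem_filter.1 hl).1)

theorem sum_filter (h : Merges e c j e' c' k) {p : Sym2 α → Prop} [DecidablePred p]
    (hp : ∀ a, p a → ¬ a.IsDiag) :
    ∑ i ∈ range k with p (e' i), c' i = ∑ l ∈ range j with p (e l), c l := by
  classical
  have hinj : Set.InjOn e' ({i ∈ range k | p (e' i)} : Finset ℕ) :=
    h.injOn.mono fun i hi => by simpa using (mem_filter.1 hi).1
  have hmaps : ∀ l ∈ ({l ∈ range j | p (e l)} : Finset ℕ),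
      e l ∈ ({i ∈ range k | p (e' i)} : Finset ℕ).image e' := by
    intro l hl
    simp only [mem_filter, mem_range] at hl
    obtain ⟨i, hi, hil⟩ := h.exists_eq hl.1 (hp _ hl.2)
    exact mem_image.2 ⟨i, by simpa [hi, hil] using hl.2, hil⟩
  rw [← sum_fiberwise_of_maps_to hmaps, sum_image hinj]
  refine sum_congr rfl fun i hi => ?_
  simp only [mem_filter, mem_range] at hi
  rw [h.cap i hi.1, filter_filter]
  refine sum_congr (filter_congr fun l _ => ?_) fun _ _ => rfl
  exact ⟨fun hl => ⟨hl ▸ hi.2, hl⟩, And.right⟩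

theorem skip (h : Merges e c j e' c' k) (hj : (e j).IsDiag) : Merges e c (j + 1) e' c' k where
  injOn := h.injOn
  image := by
    rw [h.image, Iio_add_one, Set.image_insert_eq]
    ext a
    simp only [Set.mem_sep_iff, Set.mem_insert_iff]
    exact ⟨fun ha => ⟨.inr ha.1, ha.2⟩,
      fun ha => ⟨ha.1.resolve_left fun haj => ha.2 (haj ▸ hj), ha.2⟩⟩
  cap i hi := by
    have hne : e j ≠ e' i := fun hji => (h.eq_and_not_isDiag hi).2 (hji ▸ hj)
    rw [h.cap i hi, range_add_one, filter_insert, if_neg hne]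

theorem merge (h : Merges e c j e' c' k) {q : ℕ} (hq : q < k) (hqj : e' q = e j) :
    Merges e c (j + 1) e' (Function.update c' q (c' q + c j)) k where
  injOn := h.injOn
  image := by
    have hmem : e j ∈ {a ∈ e '' Set.Iio j | ¬ a.IsDiag} := hqj ▸ h.eq_and_not_isDiag hq
    rw [h.image, Iio_add_one, Set.image_insert_eq,
      Set.insert_eq_of_mem hmem.1]
  cap i hi := by
    rw [range_add_one, filter_insert]
    by_cases hiq : i = q
    · subst hiq
      rw [if_pos hqj.symm, sum_insert (by simp), Function.update_self, h.cap i hi, add_comm]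
    · have hne : e j ≠ e' i := fun hji => hiq (h.injOn hi hq (hji ▸ hqj).symm)
      rw [Function.update_of_ne hiq, if_neg hne, h.cap i hi]

open Classical in
theorem append (h : Merges e c j e' c' k) (hd : ¬ (e j).IsDiag) (hnew : ∀ l < j, e l ≠ e j) :
    Merges e c (j + 1) (Function.update e' k (e j)) (Function.update c' k (c j)) (k + 1) := by
  have hold : Set.EqOn (Function.update e' k (e j)) e' (Set.Iio k) := fun i hi =>
    Function.update_of_ne (ne_of_lt hi) _ _
  have hne : ∀ i < k, e' i ≠ e j := fun i hi hij => by
    obtain ⟨⟨l, hl, hli⟩, -⟩ := h.eq_and_not_isDiag hi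
    exact hnew l hl (hli.trans hij)
  refine ⟨?_, ?_, fun i hi => ?_⟩
  · rw [Iio_add_one, Set.injOn_insert (by simp)]
    refine ⟨h.injOn.congr hold.symm, ?_⟩
    rw [hold.image_eq, Function.update_self]
    rintro ⟨i, hi, hij⟩
    exact hne i hi hij
  · simp only [Iio_add_one, Set.image_insert_eq, hold.image_eq,
      h.image, Function.update_self]
    ext a
    simp only [Set.mem_insert_iff, Set.mem_sep_iff]
    exact ⟨fun ha => ha.elim (fun ha => ⟨.inl ha, ha ▸ hd⟩) fun ha => ⟨.inr ha.1, ha.2⟩,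
      fun ha => ha.1.imp id fun h' => ⟨h', ha.2⟩⟩
  · rw [range_add_one, filter_insert]
    rcases Nat.lt_succ_iff_lt_or_eq.1 hi with hik | rfl
    · rw [hold hik, Function.update_of_ne hik.ne, if_neg (hne i hik).symm, h.cap i hik]
    · have hempty : ({l ∈ range j | e l = e j} : Finset ℕ) = ∅ :=
        filter_eq_empty_iff.2 fun l hl => hnew l (mem_range.1 hl)
      rw [Function.update_self, Function.update_self, if_pos rfl, hempty, sum_insert (by simp),
        sum_empty, add_zero]

end Merges

section Stored

variable {L : Layout} {I : Network} {σ τ : State}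

theorem Stored.tail_lt (h : Stored L I σ) {i : ℕ} (hi : i < I.m) : σ.iarr L.tail i < I.n :=
  (h.tail ⟨i, hi⟩).trans_lt (Fin.is_lt _)

theorem Stored.head_lt (h : Stored L I σ) {i : ℕ} (hi : i < I.m) : σ.iarr L.head i < I.n :=
  (h.head ⟨i, hi⟩).trans_lt (Fin.is_lt _)

theorem Stored.simple (h : Stored L I σ) {i j : ℕ} (hi : i < I.m) (hj : j < I.m)
    (hij : s(σ.iarr L.tail i, σ.iarr L.head i) = s(σ.iarr L.tail j, σ.iarr L.head j)) : i = j := by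
  rw [h.tail ⟨i, hi⟩, h.head ⟨i, hi⟩, h.tail ⟨j, hj⟩, h.head ⟨j, hj⟩] at hij
  have hfin : (⟨i, hi⟩ : Fin I.m) = ⟨j, hj⟩ :=
    I.simple (by simpa [Sym2.eq_iff, Fin.ext_iff] using hij)
  simpa using hfin

theorem Stored.tail_ne_head (h : Stored L I σ) {i : ℕ} (hi : i < I.m) :
    σ.iarr L.tail i ≠ σ.iarr L.head i := by
  rw [h.tail ⟨i, hi⟩, h.head ⟨i, hi⟩]
  exact fun heq => I.loopless _ (Fin.ext heq)

theorem Stored.cap_nonneg (h : Stored L I σ) {i : ℕ} (hi : i < I.m) : 0 ≤ σ.rarr L.cap i :=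
  (I.cap_nonneg ⟨i, hi⟩).trans_eq (h.cap ⟨i, hi⟩).symm

theorem Stored.cutCap (h : Stored L I σ) (D : ℕ → Bool) :
    I.cutCap univ D =
      ∑ i ∈ range I.m with D (σ.iarr L.tail i) ≠ D (σ.iarr L.head i), σ.rarr L.cap i := by
  simp only [Network.cutCap, sum_filter, sum_range, h.tail, h.head, h.cap]

theorem Stored.of_eq (h : Stored L I σ) (h₁ : ∀ x ∈ [L.n, L.m, L.s, L.t], τ.ivar x = σ.ivar x)
    (h₂ : ∀ x ∈ [L.tail, L.head], τ.iarr x = σ.iarr x) (h₃ : τ.rarr L.cap = σ.rarr L.cap) :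
    Stored L I τ := by
  simp only [List.mem_cons, List.not_mem_nil, or_false, forall_eq_or_imp, forall_eq] at h₁ h₂
  exact ⟨h₁.1.trans h.n, h₁.2.1.trans h.m, h₁.2.2.1.trans h.s, h₁.2.2.2.trans h.t,
    fun i => (congrFun h₂.1 i).trans (h.tail i), fun i => (congrFun h₂.2 i).trans (h.head i),
    fun i => (congrFun h₃ i).trans (h.cap i)⟩

theorem Stored.frame {c : Cmd} (h : Stored L I σ) (hf : Frame c σ τ)
    (h₁ : ∀ x ∈ [L.n, L.m, L.s, L.t], x ∉ c.writesIvar)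
    (h₂ : ∀ x ∈ [L.tail, L.head], x ∉ c.writesIarr) (h₃ : L.cap ∉ c.writesRarr) : Stored L I τ :=
  h.of_eq (fun x hx => hf.ivar x (h₁ x hx)) (fun x hx => hf.iarr x (h₂ x hx)) (hf.rarr _ h₃)

theorem connected_fromEdgeSet_of_surjective {V W : Type*} {E : Set (Sym2 V)} {E' : Set (Sym2 W)}
    {f : V → W} (hf : f.Surjective) (hE : ∀ e ∈ E, ¬ (e.map f).IsDiag → e.map f ∈ E')
    (h : (SimpleGraph.fromEdgeSet E).Connected) : (SimpleGraph.fromEdgeSet E').Connected := by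
  have := h.nonempty.map f
  refine ⟨hf.forall₂.2 fun x y => ?_⟩
  have hxy := h.preconnected x y
  rw [SimpleGraph.reachable_iff_reflTransGen] at hxy ⊢
  refine hxy.lift' f fun a b hab => ?_
  by_cases heq : f a = f b
  · rw [Function.onFun_apply, heq]
  · rw [SimpleGraph.fromEdgeSet_adj] at hab
    exact .single ((SimpleGraph.fromEdgeSet_adj _).2 ⟨hE _ hab.1 (by simpa using heq), heq⟩)

theorem Stored.exists_of_merges (h : Stored L I σ) {ρ : ℕ → ℕ}
    (hρ : ρ '' Set.Iio I.n = Set.Iio (τ.ivar L.n))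
    (harcs : Merges (fun l => s(ρ (σ.iarr L.tail l), ρ (σ.iarr L.head l))) (σ.rarr L.cap) I.m
      (fun i => s(τ.iarr L.tail i, τ.iarr L.head i)) (τ.rarr L.cap) (τ.ivar L.m))
    (hs : τ.ivar L.s = ρ I.t) (ht : τ.ivar L.t = ρ I.s) (hst : ρ I.s ≠ ρ I.t) :
    ∃ J : Network, Stored L J τ := by
  have hlt : ∀ x < I.n, ρ x < τ.ivar L.n := fun x hx => hρ.le ⟨x, hx, rfl⟩
  have hends : ∀ i < τ.ivar L.m, τ.iarr L.tail i < τ.ivar L.n ∧ τ.iarr L.head i < τ.ivar L.n := by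
    intro i hi
    obtain ⟨⟨l, hl, hli⟩, -⟩ := harcs.eq_and_not_isDiag hi
    have hT := hlt _ (h.tail_lt hl)
    have hH := hlt _ (h.head_lt hl)
    rcases Sym2.eq_iff.1 hli with ⟨h₁, h₂⟩ | ⟨h₁, h₂⟩ <;> omega
  let tail' (i : Fin (τ.ivar L.m)) : Fin (τ.ivar L.n) := ⟨_, (hends i i.2).1⟩
  let head' (i : Fin (τ.ivar L.m)) : Fin (τ.ivar L.n) := ⟨_, (hends i i.2).2⟩
  have hsimple : Function.Injective fun i => s(tail' i, head' i) := fun i j hij =>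
    Fin.ext (harcs.injOn i.2 j.2 (by simpa [Sym2.eq_iff, tail', head'] using hij))
  have hconn : (SimpleGraph.fromEdgeSet (Set.range fun i => s(tail' i, head' i))).Connected := by
    refine connected_fromEdgeSet_of_surjective (f := fun x : Fin I.n =>
      (⟨ρ x, hlt x x.2⟩ : Fin (τ.ivar L.n))) (fun y => ?_) ?_ I.connected
    · obtain ⟨x, hx, hxy⟩ := hρ.ge y.2
      exact ⟨⟨x, hx⟩, Fin.ext hxy⟩
    · rintro _ ⟨l, rfl⟩ hd
      have hl : ¬ s(ρ (σ.iarr L.tail l), ρ (σ.iarr L.head l)).IsDiag := by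
        rw [h.tail, h.head]; simpa using hd
      obtain ⟨i, hi, hil⟩ := harcs.exists_eq l.2 hl
      rw [h.tail, h.head] at hil
      exact ⟨⟨i, hi⟩, by simpa [Sym2.eq_iff, tail', head'] using hil⟩
  exact ⟨{ n := τ.ivar L.n, m := τ.ivar L.m, tail := tail', head := head'
           cap := fun i => τ.rarr L.cap i
           s := ⟨τ.ivar L.s, hs ▸ hlt _ I.t.2⟩, t := ⟨τ.ivar L.t, ht ▸ hlt _ I.s.2⟩
           cap_nonneg := fun i => harcs.cap_nonneg (fun l hl => h.cap_nonneg hl) i.2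
           s_ne_t := fun hst' => hst (by simpa [hs, ht, eq_comm] using hst')
           loopless := fun i hi => (harcs.eq_and_not_isDiag i.2).2 (congrArg Fin.val hi)
           simple := hsimple, connected := hconn },
    ⟨rfl, rfl, rfl, rfl, fun _ => rfl, fun _ => rfl, fun _ => rfl⟩⟩

theorem Stored.cutCap_of_merges {J : Network} (h : Stored L I σ) (h' : Stored L J τ) {ρ : ℕ → ℕ}
    (harcs : Merges (fun l => s(ρ (σ.iarr L.tail l), ρ (σ.iarr L.head l))) (σ.rarr L.cap) I.m
      (fun i => s(τ.iarr L.tail i, τ.iarr L.head i)) (τ.rarr L.cap) J.m) (D : ℕ → Bool) :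
    J.cutCap univ D = I.cutCap univ (D ∘ ρ) := by
  have hsum := harcs.sum_filter (p := fun a => ¬ (a.map D).IsDiag) fun a ha hd => ha (hd.map)
  simpa [h.cutCap, h'.cutCap] using hsum

end Stored

/-- The node map that identifies `lo` with `hi`, where `lo < hi`, and closes the gap in the
numbering; it is the identity below `n` if `hi = n`. -/
def squash (lo hi x : ℕ) : ℕ := if x = hi then lo else if hi < x then x - 1 else x

theorem image_squash {n lo hi : ℕ} (hlo : lo < hi) (hhi : hi ≤ n) :
    squash lo hi '' Set.Iio n = Set.Iio (if hi = n then n else n - 1) := by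
  ext y
  simp only [Set.mem_image, Set.mem_Iio]
  constructor
  · rintro ⟨x, hx, rfl⟩
    unfold squash
    split_ifs <;> omega
  · intro hy
    refine ⟨if y < hi then y else y + 1, ?_, ?_⟩
    · split_ifs at hy ⊢ <;> omega
    · unfold squash
      split_ifs <;> omega

theorem squash_lt {n lo hi x : ℕ} (hlo : lo < hi) (hx : x < n) : squash lo hi x < n := by
  unfold squash
  split_ifs <;> omega

theorem squash_eq_squash_iff {lo hi x y : ℕ} (hlo : lo < hi) :
    squash lo hi x = squash lo hi y ↔ x = y ∨ x ∈ ({lo, hi} : Set ℕ) ∧ y ∈ ({lo, hi} : Set ℕ) := by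
  simp only [Set.mem_insert_iff, Set.mem_singleton_iff, squash]
  split_ifs <;> omega

theorem squash_lo {lo hi : ℕ} (hlo : lo < hi) : squash lo hi lo = lo := by
  rw [squash, if_neg hlo.ne, if_neg hlo.not_gt]

/-- `J` is obtained from `I` by merging the node `u` into `s` and exchanging the terminals; the
nodes are renamed by `ρ`. -/
structure Contracts (I J : Network) (ρ : ℕ → ℕ) (u : ℕ) : Prop where
  image : ρ '' Set.Iio I.n = Set.Iio J.n
  eq_iff : ∀ x < I.n, ∀ y < I.n,
    ρ x = ρ y ↔ x = y ∨ x ∈ ({u, ↑I.s} : Set ℕ) ∧ y ∈ ({u, ↑I.s} : Set ℕ)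
  m_le : J.m ≤ I.m
  cut : ∀ D, J.cutCap univ D = I.cutCap univ (D ∘ ρ)
  s_eq : (J.s : ℕ) = ρ I.t
  t_eq : (J.t : ℕ) = ρ I.s

namespace Contracts

variable {I J : Network} {ρ : ℕ → ℕ} {u : ℕ}

theorem lt (h : Contracts I J ρ u) {x : ℕ} (hx : x < I.n) : ρ x < J.n :=
  h.image.le ⟨x, hx, rfl⟩

theorem n_le (h : Contracts I J ρ u) : J.n ≤ I.n := by
  calc J.n = (ρ '' Set.Iio I.n).ncard := by simp [h.image]
    _ ≤ (Set.Iio I.n).ncard := Set.ncard_image_le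
    _ = I.n := by simp

theorem map_node (h : Contracts I J ρ u) (hu : u < I.n) : ρ u = ρ I.s :=
  (h.eq_iff u hu I.s I.s.2).2 (by simp)

theorem exists_comp_eq (h : Contracts I J ρ u) {D : ℕ → Bool} (hD : D u = D I.s) :
    ∃ E : ℕ → Bool, Set.EqOn (E ∘ ρ) D (Set.Iio I.n) := by
  have hfac : Function.FactorsThrough (fun x : Set.Iio I.n => D x) fun x => ρ x := by
    rintro ⟨x, hx⟩ ⟨y, hy⟩ hxy
    obtain rfl | ⟨rfl | rfl, rfl | rfl⟩ := (h.eq_iff x hx y hy).1 hxy <;> simp [hD]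
  exact ⟨Function.extend (fun x : Set.Iio I.n => ρ x) (fun x => D x) fun _ => false,
    fun x hx => hfac.extend_apply (fun _ => false) ⟨x, hx⟩⟩

end Contracts

/-! The registers of the program. The input occupies the registers prescribed by `inputLayout`, all
other networks are stored at `workLayout`. -/

namespace Var

@[simp] abbrev inN : ℕ := 0
@[simp] abbrev inM : ℕ := 1
@[simp] abbrev inS : ℕ := 2
@[simp] abbrev inT : ℕ := 3
@[simp] abbrev n : ℕ := 4
@[simp] abbrev m : ℕ := 5
@[simp] abbrev s : ℕ := 6
@[simp] abbrev t : ℕ := 7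
@[simp] abbrev node : ℕ := 8
@[simp] abbrev lo : ℕ := 9
@[simp] abbrev hi : ℕ := 10
@[simp] abbrev newN : ℕ := 11
@[simp] abbrev i : ℕ := 12
@[simp] abbrev len : ℕ := 13
@[simp] abbrev fst : ℕ := 14
@[simp] abbrev snd : ℕ := 15
@[simp] abbrev tmp : ℕ := 16
@[simp] abbrev sp : ℕ := 17
@[simp] abbrev top : ℕ := 18
@[simp] abbrev cell : ℕ := 19
@[simp] abbrev nbr : ℕ := 20
@[simp] abbrev src : ℕ := 21
@[simp] abbrev snk : ℕ := 22
@[simp] abbrev k : ℕ := 23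
@[simp] abbrev parent : ℕ := 24
@[simp] abbrev swap : ℕ := 25
@[simp] abbrev j : ℕ := 26
@[simp] abbrev u : ℕ := 27
@[simp] abbrev v : ℕ := 28
@[simp] abbrev e : ℕ := 29

end Var

namespace Arr

@[simp] abbrev inTail : ℕ := 0
@[simp] abbrev inHead : ℕ := 1
@[simp] abbrev tail : ℕ := 2
@[simp] abbrev head : ℕ := 3
@[simp] abbrev rename : ℕ := 4
@[simp] abbrev slot : ℕ := 5
@[simp] abbrev image : ℕ := 6
@[simp] abbrev first : ℕ := 7
@[simp] abbrev next : ℕ := 8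
@[simp] abbrev target : ℕ := 9
@[simp] abbrev visited : ℕ := 10
@[simp] abbrev stack : ℕ := 11
@[simp] abbrev side : ℕ := 12
@[simp] abbrev bestSide : ℕ := 13
@[simp] abbrev parent : ℕ := 14
@[simp] abbrev root : ℕ := 15

end Arr

namespace RVar

@[simp] abbrev cutCap : ℕ := 0
@[simp] abbrev bestCap : ℕ := 1
@[simp] abbrev maxFlow : ℕ := 2
@[simp] abbrev bottleneck : ℕ := 3

end RVar

namespace RArr

@[simp] abbrev inCap : ℕ := 0
@[simp] abbrev vitality : ℕ := outputArray
@[simp] abbrev cap : ℕ := 2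
@[simp] abbrev flow : ℕ := 3
@[simp] abbrev backflow : ℕ := 4
@[simp] abbrev weight : ℕ := 5

end RArr

/-- Where the networks under contraction are stored. -/
def workLayout : Layout where
  n := Var.n
  m := Var.m
  s := Var.s
  t := Var.t
  tail := Arr.tail
  head := Arr.head
  cap := RArr.cap

/-- `for x from 0 while x < y do c; a[x] := e`. -/
def Cmd.tabulate (a x y : ℕ) (c : Cmd) (e : IExp) : Cmd :=
  .upto x (.lit 0) y (c ;; .storeI a (.var x) e)

/-- Choose the pair `lo < hi` to be identified and the new number of nodes; `hi = n` if there is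
nothing to identify because `node` is the source. -/
def choosePair : Cmd :=
  .cond (.eqI (.var Var.node) (.var Var.s))
    (.setI Var.lo (.var Var.s) ;; .setI Var.hi (.var Var.n) ;; .setI Var.newN (.var Var.n))
    (.setI Var.newN (.pred (.var Var.n)) ;;
      .cond (.ltI (.var Var.node) (.var Var.s))
        (.setI Var.lo (.var Var.node) ;; .setI Var.hi (.var Var.s))
        (.setI Var.lo (.var Var.s) ;; .setI Var.hi (.var Var.node)))

/-- Tabulate the map `squash lo hi`. -/
def tabulateSquash : Cmd :=
  .tabulate Arr.rename Var.i Var.n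
    (.cond (.eqI (.var Var.i) (.var Var.hi)) (.setI Var.tmp (.var Var.lo))
      (.cond (.ltI (.var Var.hi) (.var Var.i)) (.setI Var.tmp (.pred (.var Var.i)))
        (.setI Var.tmp (.var Var.i))))
    (.var Var.tmp)

def chooseRenaming : Cmd := choosePair ;; tabulateSquash

def clearSlots : Cmd := .tabulate Arr.slot Var.i Var.n .skip (.lit 0)

def findOtherEnd : Cmd :=
  .cond (.eqI (.var Var.fst) (.var Var.lo)) (.setI Var.tmp (.var Var.snd))
    (.cond (.eqI (.var Var.snd) (.var Var.lo)) (.setI Var.tmp (.var Var.fst))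
      (.setI Var.tmp (.var Var.n)))

/-- Add the capacity of arc `i` to the new arc between `lo` and `tmp`. -/
def addToSlot : Cmd :=
  .storeR RArr.cap (.pred (.read Arr.slot (.var Var.tmp)))
    (.add (.read RArr.cap (.pred (.read Arr.slot (.var Var.tmp)))) (.read RArr.cap (.var Var.i)))

def appendArc : Cmd :=
  .storeI Arr.tail (.var Var.len) (.var Var.fst) ;;
    .storeI Arr.head (.var Var.len) (.var Var.snd) ;;
    .storeR RArr.cap (.var Var.len) (.read RArr.cap (.var Var.i)) ;;
    .setI Var.len (.succ (.var Var.len)) ;; .storeI Arr.slot (.var Var.tmp) (.var Var.len)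

/-- Rename the ends of arc `i`, drop it if it is a loop, and otherwise merge it into the new arcs.
All parallel arcs contain `lo`, so that it suffices to remember for each node `x` the new arc
between `lo` and `x`; `slot x` is the successor of its index, and `0` as long as there is none. -/
def mergeArc : Cmd :=
  .setI Var.fst (.read Arr.rename (.read Arr.tail (.var Var.i))) ;;
    .setI Var.snd (.read Arr.rename (.read Arr.head (.var Var.i))) ;;
    .cond (.eqI (.var Var.fst) (.var Var.snd)) .skip
      (findOtherEnd ;;
        .cond (.and (.ltI (.var Var.tmp) (.var Var.n))
            (.not (.eqI (.read Arr.slot (.var Var.tmp)) (.lit 0))))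
          addToSlot appendArc)

def mergeArcs : Cmd :=
  .setI Var.len (.lit 0) ;; .upto Var.i (.lit 0) Var.m mergeArc

/-- Apply the current renaming to the images of the nodes of the input. -/
def composeImage : Cmd :=
  .tabulate Arr.image Var.i Var.inN .skip (.read Arr.rename (.read Arr.image (.var Var.i)))

/-- Replace the stored network by the contracted one, with terminals exchanged. -/
def updateNetwork : Cmd :=
  .setI Var.n (.var Var.newN) ;; .setI Var.m (.var Var.len) ;;
    .setI Var.tmp (.read Arr.rename (.var Var.t)) ;; .setI Var.t (.read Arr.rename (.var Var.s)) ;;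
    .setI Var.s (.var Var.tmp)

/-- Merge `node` into the source and exchange the terminals. -/
def contract : Cmd :=
  chooseRenaming ;; clearSlots ;; mergeArcs ;; composeImage ;; updateNetwork

section Merging

/-- The end of the arc between `a` and `b` opposite to `lo`, and `n` if `lo` is not an end. -/
def otherEnd (lo n a b : ℕ) : ℕ := if a = lo then b else if b = lo then a else n

theorem mk_eq_mk_iff_otherEnd {lo n a b y : ℕ} (hy : y < n) :
    s(a, b) = s(lo, y) ↔ otherEnd lo n a b = y := by
  unfold otherEnd
  split_ifs <;> simp only [Sym2.eq_iff] <;> omega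

theorem mem_mk_iff_otherEnd_lt {lo n a b : ℕ} (ha : a < n) (hb : b < n) :
    lo ∈ s(a, b) ↔ otherEnd lo n a b < n := by
  unfold otherEnd
  split_ifs <;> simp only [Sym2.mem_iff] <;> omega

theorem findOtherEnd_sem (σ : State) :
    findOtherEnd.sem σ =
      { σ with
        ivar := Function.update σ.ivar Var.tmp
          (otherEnd (σ.ivar Var.lo) (σ.ivar Var.n) (σ.ivar Var.fst) (σ.ivar Var.snd)) } := by
  by_cases hfst : σ.ivar Var.fst = σ.ivar Var.lo <;>
    by_cases hsnd : σ.ivar Var.snd = σ.ivar Var.lo <;>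
      simp only [findOtherEnd, Cmd.sem, BExp.Holds, IExp.eval, otherEnd, hfst, hsnd, if_true,
        if_false]

/-- The invariant of `mergeArcs`: of the arcs with ends `T`, `H` and capacities `c`, the first `j`
have been renamed by `ρ` and merged into the first `k` arcs with ends `tl`, `hd` and capacities
`cp`. -/
structure MergeInv (n lo : ℕ) (ρ T H : ℕ → ℕ) (c : ℕ → ℝ) (j k : ℕ) (tl hd slot : ℕ → ℕ)
    (cp : ℕ → ℝ) : Prop where
  merges : Merges (fun l => s(ρ (T l), ρ (H l))) c j (fun i => s(tl i, hd i)) cp k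
  rest : ∀ i, j ≤ i → tl i = T i ∧ hd i = H i ∧ cp i = c i
  slot_eq_iff : ∀ x < n, ∀ i, slot x = i + 1 ↔ i < k ∧ s(tl i, hd i) = s(lo, x)

namespace MergeInv

variable {n lo j k x : ℕ} {ρ T H tl hd slot : ℕ → ℕ} {c cp : ℕ → ℝ}

theorem init (hslot : ∀ x < n, slot x = 0) : MergeInv n lo ρ T H c 0 0 T H slot c where
  merges := .zero
  rest _ _ := ⟨rfl, rfl, rfl⟩
  slot_eq_iff x hx i := by simp [hslot x hx]

theorem skip (h : MergeInv n lo ρ T H c j k tl hd slot cp) (hj : ρ (T j) = ρ (H j)) :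
    MergeInv n lo ρ T H c (j + 1) k tl hd slot cp where
  merges := h.merges.skip hj
  rest i hi := h.rest i (by omega)
  slot_eq_iff := h.slot_eq_iff

theorem merge (h : MergeInv n lo ρ T H c j k tl hd slot cp) (hx : x < n) (hslot : slot x ≠ 0)
    (hj : s(ρ (T j), ρ (H j)) = s(lo, x)) :
    MergeInv n lo ρ T H c (j + 1) k tl hd slot
      (Function.update cp (slot x - 1) (cp (slot x - 1) + c j)) := by
  obtain ⟨hk, hq⟩ := (h.slot_eq_iff x hx (slot x - 1)).1 (by omega)
  refine ⟨h.merges.merge hk (hq.trans hj.symm), fun i hi => ?_, h.slot_eq_iff⟩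
  rw [Function.update_of_ne (by have := h.merges.le; omega)]
  exact h.rest i (by omega)

theorem append (h : MergeInv n lo ρ T H c j k tl hd slot cp) (hne : ρ (T j) ≠ ρ (H j))
    (hnew : ∀ l < j, s(ρ (T l), ρ (H l)) ≠ s(ρ (T j), ρ (H j)))
    (hx : ∀ y < n, s(ρ (T j), ρ (H j)) = s(lo, y) ↔ x = y) :
    MergeInv n lo ρ T H c (j + 1) (k + 1) (Function.update tl k (ρ (T j)))
      (Function.update hd k (ρ (H j))) (Function.update slot x (k + 1))
      (Function.update cp k (c j)) := by
  have hkj := h.merges.le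
  refine ⟨?_, fun i hi => ?_, fun y hy i => ?_⟩
  · convert h.merges.append hne hnew using 1
    ext1 i
    rcases eq_or_ne i k with rfl | hik
    · simp
    · simp [hik]
  · simp only [Function.update_of_ne (show i ≠ k by omega)]
    exact h.rest i (by omega)
  · have hold := h.slot_eq_iff y hy i
    have hnewArc := hx y hy
    have hlt : i ≠ k → (i < k + 1 ↔ i < k) := fun hik => by omega
    rcases eq_or_ne i k with rfl | hik <;> rcases eq_or_ne y x with rfl | hyx
    · simpa using hnewArc
    · simpa [hyx, hnewArc, hyx.symm] using hold
    · suffices h' : ¬ (i < k ∧ s(tl i, hd i) = s(lo, y)) by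
        simpa [hik, hik.symm, hlt hik] using h'
      rintro ⟨hi, hiy⟩
      obtain ⟨⟨l, hl, hli⟩, -⟩ := h.merges.eq_and_not_isDiag hi
      exact hnew l hl (hli.trans (hiy.trans (hnewArc.2 rfl).symm))
    · simpa [hyx, hik, hlt hik] using hold

theorem ne_of_slot_eq_zero (h : MergeInv n lo ρ T H c j k tl hd slot cp) (hx : x < n)
    (hslot : slot x = 0) (hne : ρ (T j) ≠ ρ (H j)) (hj : s(ρ (T j), ρ (H j)) = s(lo, x)) {l : ℕ}
    (hl : l < j) : s(ρ (T l), ρ (H l)) ≠ s(ρ (T j), ρ (H j)) := by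
  intro hlj
  have hd : ¬ s(ρ (T l), ρ (H l)).IsDiag := by rwa [hlj]
  obtain ⟨i, hi, hil⟩ := h.merges.exists_eq hl hd
  have := (h.slot_eq_iff x hx i).2 ⟨hi, hil.trans (hlj.trans hj)⟩
  omega

end MergeInv

end Merging

section Contract

variable {R : MaxFlowRoutine} {I : Network} {σ : State} {X : ℕ}

theorem Computes.tabulate {a x y N : ℕ} {c : Cmd} {e : IExp} {g : ℕ → ℕ} (hX : 1 ≤ X)
    (hc : c.Straight) (hx : x ∉ c.writesIvar) (ha : a ∉ c.writesIarr) (hy : y ∉ c.writesIvar)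
    (hyx : y ≠ x) (hN : σ.ivar y = N) (hNX : N ≤ X)
    (hg : ∀ j < N, ∀ τ, Frame (Cmd.tabulate a x y c e) σ τ → τ.ivar x = j →
      (∀ i, τ.iarr a i = if i < j then g i else σ.iarr a i) → e.eval (c.sem τ) = g j) :
    Computes R X (Cmd.tabulate a x y c e) σ fun τ => ∀ i < N, τ.iarr a i = g i := by
  refine (Computes.upto (j₀ := 0) hX (c := c ;; .storeI a (.var x) e) ⟨hc, trivial⟩
    (fun j τ => ∀ i, τ.iarr a i = if i < j then g i else σ.iarr a i)
    rfl hN (Nat.zero_le N) hNX (by simpa [Cmd.writesIvar] using hx)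
    (by simpa [Cmd.writesIvar] using hy) hyx (by simp) ?_).mono fun τ _ h i hi =>
      (h.2 i).trans (if_pos hi)
  intro j τ hf hj _ hjN hinv i
  obtain ⟨k, -, he⟩ := hc.exec (R := R) τ
  have hval := hg j hjN τ hf hj hinv
  have hxj : (c.sem τ).ivar x = j := (he.frame.ivar x hx).trans hj
  simp only [Cmd.sem, IExp.eval, Function.update_self, hxj, hval, he.frame.iarr a ha]
  rcases eq_or_ne i j with rfl | hij
  · simp
  · rw [Function.update_of_ne hij, hinv i]
    exact if_congr (by omega) rfl rfl

theorem choosePair_computes (hX : 1 ≤ X) (h : Stored workLayout I σ) (hu : σ.ivar Var.node < I.n) :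
    Computes R X choosePair σ fun τ => τ.ivar Var.lo < τ.ivar Var.hi ∧ τ.ivar Var.hi ≤ I.n ∧
      τ.ivar Var.newN = (if τ.ivar Var.hi = I.n then I.n else I.n - 1) ∧
      ∀ x < I.n, x ∈ ({τ.ivar Var.lo, τ.ivar Var.hi} : Set ℕ) ↔
        x ∈ ({σ.ivar Var.node, ↑I.s} : Set ℕ) := by
  refine Cmd.Straight.computes (by simp [choosePair, Cmd.Straight]) hX ?_
  have hn : σ.ivar Var.n = I.n := h.n
  have hs : σ.ivar Var.s = I.s := h.s
  have hsn := I.s.2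
  obtain ⟨u, hnode⟩ : ∃ u, σ.ivar Var.node = u := ⟨_, rfl⟩
  rw [hnode] at hu ⊢
  rcases lt_trichotomy u I.s with hlt | heq | hgt
  · simp [choosePair, Cmd.sem, BExp.Holds, IExp.eval, hn, hs, hnode, hlt, hlt.ne, hsn.le,
      hsn.ne]
  · simp [choosePair, Cmd.sem, BExp.Holds, IExp.eval, hn, hs, hnode, heq]
    omega
  · simp [choosePair, Cmd.sem, BExp.Holds, IExp.eval, hn, hs, hnode, hgt, hgt.not_gt,
      hgt.ne', hu.le, hu.ne, or_comm]

theorem tabulateSquash_computes (hX : 1 ≤ X) (hn : σ.ivar Var.n ≤ X) :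
    Computes R X tabulateSquash σ fun τ => ∀ x < σ.ivar Var.n,
      τ.iarr Arr.rename x = squash (σ.ivar Var.lo) (σ.ivar Var.hi) x := by
  refine Computes.tabulate hX (by simp [Cmd.Straight]) (by decide) (by decide) (by decide)
    (by decide) rfl hn fun j _ τ hf hj _ => ?_
  have hlo := hf.ivar Var.lo (by decide)
  have hhi := hf.ivar Var.hi (by decide)
  simp only [Cmd.sem, BExp.Holds, IExp.eval, hj, hlo, hhi, squash]
  split_ifs <;> simp only [Function.update_self]

theorem chooseRenaming_computes (hX : 1 ≤ X) (h : Stored workLayout I σ) (hn : I.n ≤ X)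
    (hu : σ.ivar Var.node < I.n) :
    Computes R X chooseRenaming σ fun τ => ∃ lo hi, lo < hi ∧ hi ≤ I.n ∧ τ.ivar Var.lo = lo ∧
      τ.ivar Var.newN = (if hi = I.n then I.n else I.n - 1) ∧
      (∀ x < I.n, x ∈ ({lo, hi} : Set ℕ) ↔ x ∈ ({σ.ivar Var.node, ↑I.s} : Set ℕ)) ∧
      ∀ x < I.n, τ.iarr Arr.rename x = squash lo hi x := by
  refine (choosePair_computes hX h hu).seq fun τ f ⟨hlohi, hhi, hnew, hpair⟩ => ?_
  have hτn : τ.ivar Var.n = I.n := (h.frame f (by decide) (by decide) (by decide)).n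
  refine (tabulateSquash_computes hX (hτn.trans_le hn)).mono fun υ f' hren => ?_
  exact ⟨_, _, hlohi, hhi, f'.ivar Var.lo (by decide), (f'.ivar Var.newN (by decide)).trans hnew,
    hpair, hτn ▸ hren⟩

theorem clearSlots_computes (hX : 1 ≤ X) (hn : σ.ivar Var.n ≤ X) :
    Computes R X clearSlots σ fun τ => ∀ x < σ.ivar Var.n, τ.iarr Arr.slot x = 0 :=
  Computes.tabulate hX trivial (by decide) (by decide) (by decide) (by decide) rfl hn
    fun _ _ _ _ _ _ => rfl

theorem composeImage_computes (hX : 1 ≤ X) (hn : σ.ivar Var.inN ≤ X) :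
    Computes R X composeImage σ fun τ => ∀ x < σ.ivar Var.inN,
      τ.iarr Arr.image x = σ.iarr Arr.rename (σ.iarr Arr.image x) :=
  Computes.tabulate hX trivial (by decide) (by decide) (by decide) (by decide) rfl hn
    fun j _ τ hf hj h => by
      simp only [Cmd.sem, IExp.eval, hj, h j, lt_irrefl, if_false, hf.iarr Arr.rename (by decide)]

theorem Stored.squash_ne_squash {L : Layout} (h : Stored L I σ) {lo hi l j : ℕ} (hlohi : lo < hi)
    (hl : l < j) (hj : j < I.m)
    (hlo : lo ∉ s(squash lo hi (σ.iarr L.tail j), squash lo hi (σ.iarr L.head j))) :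
    s(squash lo hi (σ.iarr L.tail l), squash lo hi (σ.iarr L.head l)) ≠
      s(squash lo hi (σ.iarr L.tail j), squash lo hi (σ.iarr L.head j)) := by
  have hinj : ∀ x y, squash lo hi y ≠ lo → squash lo hi x = squash lo hi y → x = y := by
    intro x y hy hxy
    rcases (squash_eq_squash_iff hlohi).1 hxy with hxy | ⟨-, hy'⟩
    · exact hxy
    · exact absurd (((squash_eq_squash_iff hlohi).2 (.inr ⟨hy', by simp⟩)).trans
        (squash_lo hlohi)) hy
  simp only [Sym2.mem_iff, not_or] at hlo
  intro heq
  refine hl.ne (h.simple (hl.trans hj) hj ?_)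
  rcases Sym2.eq_iff.1 heq with ⟨h₁, h₂⟩ | ⟨h₁, h₂⟩
  · rw [hinj _ _ (Ne.symm hlo.1) h₁, hinj _ _ (Ne.symm hlo.2) h₂]
  · rw [hinj _ _ (Ne.symm hlo.2) h₁, hinj _ _ (Ne.symm hlo.1) h₂, Sym2.eq_swap]

/-- In the memory `τ`, the first `j` arcs of `σ` have been merged. -/
def MergedUpTo (n lo : ℕ) (ρ : ℕ → ℕ) (σ : State) (j : ℕ) (τ : State) : Prop :=
  MergeInv n lo ρ (σ.iarr Arr.tail) (σ.iarr Arr.head) (σ.rarr RArr.cap) j (τ.ivar Var.len)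
    (τ.iarr Arr.tail) (τ.iarr Arr.head) (τ.iarr Arr.slot) (τ.rarr RArr.cap)

theorem MergedUpTo.mergeArc_sem {τ : State} {lo hi j : ℕ} (h : Stored workLayout I σ)
    (hlohi : lo < hi) (hj : j < I.m)
    (hρ : ∀ x < I.n, τ.iarr Arr.rename x = squash lo hi x)
    (hlo : τ.ivar Var.lo = lo) (hn : τ.ivar Var.n = I.n) (hi' : τ.ivar Var.i = j)
    (hτ : MergedUpTo I.n lo (squash lo hi) σ j τ) :
    MergedUpTo I.n lo (squash lo hi) σ (j + 1) (mergeArc.sem τ) := by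
  obtain ⟨hT, hH, hC⟩ := hτ.rest j le_rfl
  have hA : τ.iarr Arr.rename (σ.iarr Arr.tail j) = squash lo hi _ := hρ _ (h.tail_lt hj)
  have hB : τ.iarr Arr.rename (σ.iarr Arr.head j) = squash lo hi _ := hρ _ (h.head_lt hj)
  have hAn := squash_lt hlohi (h.tail_lt hj)
  have hBn := squash_lt hlohi (h.head_lt hj)
  have hfresh := fun l (hl : l < j) => h.squash_ne_squash hlohi hl hj
  change squash lo hi (σ.iarr Arr.tail j) < I.n at hAn
  change squash lo hi (σ.iarr Arr.head j) < I.n at hBn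
  unfold MergedUpTo at hτ ⊢
  set a := squash lo hi (σ.iarr Arr.tail j)
  set b := squash lo hi (σ.iarr Arr.head j)
  obtain ⟨x, hx⟩ : ∃ x, otherEnd lo I.n a b = x := ⟨_, rfl⟩
  by_cases hab : a = b
  · simpa [mergeArc, Cmd.sem, BExp.Holds, IExp.eval, hi', hT, hH, hA, hB, hab] using hτ.skip hab
  by_cases hp : x < I.n ∧ τ.iarr Arr.slot x ≠ 0
  · have := hτ.merge hp.1 hp.2 ((mk_eq_mk_iff_otherEnd hp.1).2 hx)
    simpa [mergeArc, Cmd.sem, findOtherEnd_sem, addToSlot, BExp.Holds, IExp.eval, RExp.eval, hi',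
      hT, hH, hC, hA, hB, hab, hlo, hn, hx, hp] using this
  · have := hτ.append (x := x) hab (fun l hl => ?_) fun y hy => by
      rw [mk_eq_mk_iff_otherEnd hy, hx]
    · simpa [mergeArc, Cmd.sem, findOtherEnd_sem, appendArc, BExp.Holds, IExp.eval, RExp.eval, hi',
        hT, hH, hC, hA, hB, hab, hlo, hn, hx, hp] using this
    · by_cases hxn : x < I.n
      · exact hτ.ne_of_slot_eq_zero hxn (by tauto) hab ((mk_eq_mk_iff_otherEnd hxn).2 hx) hl
      · exact hfresh l hl ((mem_mk_iff_otherEnd_lt hAn hBn).not.2 (hx ▸ hxn))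

theorem mergeArcs_computes (hX : 1 ≤ X) (h : Stored workLayout I σ) (hm : I.m ≤ X) {lo hi : ℕ}
    (hlo : σ.ivar Var.lo = lo) (hlohi : lo < hi)
    (hρ : ∀ x < I.n, σ.iarr Arr.rename x = squash lo hi x)
    (hslot : ∀ x < I.n, σ.iarr Arr.slot x = 0) :
    Computes R X mergeArcs σ (MergedUpTo I.n lo (squash lo hi) σ I.m) := by
  refine Computes.seq (Cmd.Straight.computes trivial hX rfl)
    (P₁ := fun τ => τ = (Cmd.setI Var.len (.lit 0)).sem σ) ?_
  rintro _ - rfl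
  refine Computes.mono (Computes.upto (j₀ := 0) hX
    (by simp [Cmd.Straight, mergeArc, findOtherEnd, addToSlot, appendArc])
    (MergedUpTo I.n lo (squash lo hi) σ) rfl h.m (Nat.zero_le _) hm (by decide) (by decide)
    (by decide) (by simpa [MergedUpTo, Cmd.sem, IExp.eval] using MergeInv.init hslot) ?_)
    fun τ _ h => h.2
  intro j τ hf hj _ hjm hτ
  have hren : τ.iarr Arr.rename = σ.iarr Arr.rename := hf.iarr Arr.rename (by decide)
  exact MergedUpTo.mergeArc_sem h hlohi hjm (hren ▸ hρ)
    ((hf.ivar Var.lo (by decide)).trans hlo) ((hf.ivar Var.n (by decide)).trans h.n) hj hτ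

theorem Stored.exists_contracts {τ : State} {lo hi u : ℕ} (h : Stored workLayout I σ)
    (hlohi : lo < hi) (hhi : hi ≤ I.n) (hut : u ≠ I.t)
    (hpair : ∀ x < I.n, x ∈ ({lo, hi} : Set ℕ) ↔ x ∈ ({u, ↑I.s} : Set ℕ))
    (hmerges : Merges
      (fun l => s(squash lo hi (σ.iarr Arr.tail l), squash lo hi (σ.iarr Arr.head l)))
      (σ.rarr RArr.cap) I.m (fun i => s(τ.iarr Arr.tail i, τ.iarr Arr.head i)) (τ.rarr RArr.cap)
      (τ.ivar Var.m))
    (hn : τ.ivar Var.n = if hi = I.n then I.n else I.n - 1)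
    (hs : τ.ivar Var.s = squash lo hi I.t) (ht : τ.ivar Var.t = squash lo hi I.s) :
    ∃ J, Stored workLayout J τ ∧ Contracts I J (squash lo hi) u := by
  have himage : squash lo hi '' Set.Iio I.n = Set.Iio (τ.ivar Var.n) := by
    rw [hn, image_squash hlohi hhi]
  have heq : ∀ x < I.n, ∀ y < I.n, squash lo hi x = squash lo hi y ↔
      x = y ∨ x ∈ ({u, ↑I.s} : Set ℕ) ∧ y ∈ ({u, ↑I.s} : Set ℕ) := fun x hx y hy => by
    rw [squash_eq_squash_iff hlohi, hpair x hx, hpair y hy]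
  have hst : squash lo hi I.s ≠ squash lo hi I.t := by
    have hts : (I.t : ℕ) ≠ I.s := fun hts => I.s_ne_t (Fin.ext hts.symm)
    simp [heq _ I.s.2 _ I.t.2, hts, hts.symm, hut.symm]
  obtain ⟨J, hJ⟩ := h.exists_of_merges himage hmerges hs ht hst
  have hJm : τ.ivar Var.m = J.m := hJ.m
  rw [hJm] at hmerges
  exact ⟨J, hJ, by rw [himage]; exact congrArg _ hJ.n, heq, hmerges.le,
    h.cutCap_of_merges hJ hmerges, hJ.s.symm.trans hs, hJ.t.symm.trans ht⟩

theorem contract_computes (hX : 1 ≤ X) (h : Stored workLayout I σ) (hn : I.n ≤ X) (hm : I.m ≤ X)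
    (hN : σ.ivar Var.inN ≤ X) (hu : σ.ivar Var.node < I.n) (hut : σ.ivar Var.node ≠ I.t)
    (himage : ∀ x < σ.ivar Var.inN, σ.iarr Arr.image x < I.n) :
    Computes R X contract σ fun τ => ∃ J ρ, Stored workLayout J τ ∧
      Contracts I J ρ (σ.ivar Var.node) ∧
      ∀ x < σ.ivar Var.inN, τ.iarr Arr.image x = ρ (σ.iarr Arr.image x) := by
  refine (chooseRenaming_computes hX h hn hu).seq fun τ₁ f₁
    ⟨lo, hi, hlohi, hhi, hlo, hnew, hpair, hren⟩ => ?_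
  have s₁ := h.frame f₁ (by decide) (by decide) (by decide)
  have n₁ : τ₁.ivar Var.n = I.n := s₁.n
  refine (clearSlots_computes hX (n₁.trans_le hn)).seq fun τ₂ f₂ hslot => ?_
  have s₂ := s₁.frame f₂ (by decide) (by decide) (by decide)
  have ren₂ : τ₂.iarr Arr.rename = τ₁.iarr Arr.rename := f₂.iarr _ (by decide)
  refine (mergeArcs_computes hX s₂ hm ((f₂.ivar Var.lo (by decide)).trans hlo) hlohi
    (ren₂ ▸ hren) (n₁ ▸ hslot)).seq fun τ₃ f₃ hmerged => ?_
  have f₁₃ : Frame (chooseRenaming ;; clearSlots ;; mergeArcs) σ τ₃ :=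
    f₁.seq_left.trans (f₂.seq_left.trans f₃.seq_right).seq_right
  have ren₃ : τ₃.iarr Arr.rename = τ₁.iarr Arr.rename := (f₃.iarr _ (by decide)).trans ren₂
  have inN₃ : τ₃.ivar Var.inN = σ.ivar Var.inN := f₁₃.ivar _ (by decide)
  have image₃ : τ₃.iarr Arr.image = σ.iarr Arr.image := f₁₃.iarr _ (by decide)
  refine (composeImage_computes hX (inN₃.trans_le hN)).seq fun τ₄ f₄ himage₄ => ?_
  have f₁₄ := f₂.seq_left.trans (f₃.seq_left.trans f₄.seq_right).seq_right
  have ren₄ : τ₄.iarr Arr.rename = τ₁.iarr Arr.rename := (f₄.iarr _ (by decide)).trans ren₃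
  have s₄ : τ₄.ivar Var.s = I.s := (f₁₄.ivar Var.s (by decide)).trans s₁.s
  have t₄ : τ₄.ivar Var.t = I.t := (f₁₄.ivar Var.t (by decide)).trans s₁.t
  have newN₄ : τ₄.ivar Var.newN = _ := (f₁₄.ivar Var.newN (by decide)).trans hnew
  have len₄ : τ₄.ivar Var.len = τ₃.ivar Var.len := f₄.ivar _ (by decide)
  have arcs₄ : Merges
      (fun l => s(squash lo hi (τ₂.iarr Arr.tail l), squash lo hi (τ₂.iarr Arr.head l)))
      (τ₂.rarr RArr.cap) I.m (fun i => s(τ₄.iarr Arr.tail i, τ₄.iarr Arr.head i))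
      (τ₄.rarr RArr.cap) (τ₄.ivar Var.len) := by
    rw [f₄.iarr Arr.tail (by decide), f₄.iarr Arr.head (by decide), f₄.rarr RArr.cap (by decide),
      len₄]
    exact hmerged.merges
  refine Cmd.Straight.computes (by simp [updateNetwork, Cmd.Straight]) hX ?_
  obtain ⟨J, hJ, hcontr⟩ := s₂.exists_contracts (τ := updateNetwork.sem τ₄) hlohi hhi hut hpair
    (by simpa [updateNetwork, Cmd.sem, IExp.eval] using arcs₄)
    (by simpa [updateNetwork, Cmd.sem, IExp.eval] using newN₄)
    (by simpa [updateNetwork, Cmd.sem, IExp.eval, t₄, ren₄] using hren _ I.t.2)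
    (by simpa [updateNetwork, Cmd.sem, IExp.eval, s₄, ren₄] using hren _ I.s.2)
  refine ⟨J, squash lo hi, hJ, hcontr, fun x hx => ?_⟩
  exact (himage₄ x (inN₃ ▸ hx)).trans (by rw [ren₃, image₃, hren _ (himage x hx)])

end Contract

/-! ### Depth-first search in the residual graph -/

theorem sum_update_add {ι β M : Type*} [DecidableEq ι] [AddCommMonoid M] {s : Finset ι} {i : ι}
    (hi : i ∈ s) (h : ι → β) (b : β) (g : β → M) :
    ∑ j ∈ s, g (Function.update h i b j) + g (h i) = ∑ j ∈ s, g (h j) + g b := by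
  have hupdate : ∀ j, g (Function.update h i b j) = Function.update (g ∘ h) i (g b) j :=
    Function.apply_update (fun _ => g) h i b
  simp only [hupdate, sum_update_of_mem hi, Function.comp_apply,
    sum_eq_add_sum_sdiff_singleton_of_mem hi fun j => g (h j)]
  abel

/-- The linked list that starts at cell `d`, where `0` is the null pointer, has the entries `l`. -/
inductive IsLinkedList (next target : ℕ → ℕ) : ℕ → List ℕ → Prop
  | nil : IsLinkedList next target 0 []
  | cons {d : ℕ} {l : List ℕ} (hlt : next d < d) (h : IsLinkedList next target (next d) l) :
      IsLinkedList next target d (target d :: l)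

namespace IsLinkedList

variable {next target next' target' : ℕ → ℕ} {d : ℕ} {l : List ℕ}

theorem congr (h : IsLinkedList next target d l)
    (heq : ∀ i ≤ d, next' i = next i ∧ target' i = target i) :
    IsLinkedList next' target' d l := by
  induction h with
  | nil => exact .nil
  | @cons d l hlt _ ih =>
    obtain ⟨hnext, htarget⟩ := heq d le_rfl
    rw [← htarget]
    refine .cons (by rwa [hnext]) ?_
    rw [hnext]
    exact ih fun i hi => heq i (hi.trans hlt.le)

theorem eq_nil (h : IsLinkedList next target d l) (hd : d = 0) : l = [] := by
  cases h with
  | nil => rfl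
  | cons hlt => omega

theorem exists_eq_cons (h : IsLinkedList next target d l) (hd : d ≠ 0) :
    ∃ l', l = target d :: l' ∧ IsLinkedList next target (next d) l' := by
  cases h with
  | nil => exact absurd rfl hd
  | cons _ h => exact ⟨_, rfl, h⟩

end IsLinkedList

/-- Linked lists, starting at the cells `first x` for `x < n`, that have the entries `A x` and
together use the cells `1, …, len`. -/
structure AdjLists (n len : ℕ) (first next target : ℕ → ℕ) (A : ℕ → List ℕ) : Prop where
  list : ∀ x < n, IsLinkedList next target (first x) (A x)
  le : ∀ x < n, first x ≤ len
  sum_length : ∑ x ∈ range n, (A x).length = len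

theorem AdjLists.insert {n len x : ℕ} {first next target : ℕ → ℕ} {A : ℕ → List ℕ}
    (h : AdjLists n len first next target A) (hx : x < n) (y : ℕ) :
    AdjLists n (len + 1) (Function.update first x (len + 1))
      (Function.update next (len + 1) (first x)) (Function.update target (len + 1) y)
      (Function.update A x (y :: A x)) := by
  set next' := Function.update next (len + 1) (first x)
  set target' := Function.update target (len + 1) y
  have hold : ∀ z < n, IsLinkedList next' target' (first z) (A z) := fun z hz => by
    refine (h.list z hz).congr fun i hi => ?_
    have hilen : i ≠ len + 1 := by have := h.le z hz; omega
    exact ⟨Function.update_of_ne hilen _ _, Function.update_of_ne hilen _ _⟩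
  refine ⟨fun z hz => ?_, fun z hz => ?_, ?_⟩
  · rcases eq_or_ne z x with rfl | hzx
    · have hnext : next' (len + 1) = first z := Function.update_self _ _ _
      have htarget : target' (len + 1) = y := Function.update_self _ _ _
      rw [Function.update_self, Function.update_self, ← htarget]
      refine .cons ?_ ?_ <;> rw [hnext]
      exacts [Nat.lt_succ_of_le (h.le z hz), hold z hz]
    · simpa [hzx] using hold z hz
  · rcases eq_or_ne z x with rfl | hzx
    · simp
    · simpa [hzx] using (h.le z hz).trans (Nat.le_succ _)
  · have hsum := sum_update_add (mem_range.2 hx) A (y :: A x) List.length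
    rw [h.sum_length, List.length_cons] at hsum
    omega

/-- The invariant of the depth-first search from `s` in the graph `Rel` on `{0, …, n - 1}`: the
linked lists hold the arcs `A` that are still to be followed. -/
structure SearchInv (n s : ℕ) (Rel : ℕ → ℕ → Prop) (first next target visited stack : ℕ → ℕ)
    (sp : ℕ) (A : ℕ → List ℕ) : Prop where
  list : ∀ x < n, IsLinkedList next target (first x) (A x)
  rel : ∀ x < n, ∀ y ∈ A x, Rel x y
  start : visited s ≠ 0
  reach : ∀ x < n, visited x ≠ 0 → ReflTransGen Rel s x
  stacked : ∀ i < sp, stack i < n ∧ visited (stack i) ≠ 0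
  done : ∀ x < n, visited x ≠ 0 → (∃ i < sp, stack i = x) ∨ A x = []
  closed : ∀ x < n, ∀ y, Rel x y → y ∈ A x ∨ visited y ≠ 0

/-- A bound on the number of iterations that a search still takes. Every iteration pops a node,
discards an arc, or discards an arc and pushes a node that was not visited before. -/
def searchFuel (n : ℕ) (visited : ℕ → ℕ) (sp : ℕ) (A : ℕ → List ℕ) : ℕ :=
  ∑ x ∈ range n, (A x).length + ∑ x ∈ range n, (if visited x = 0 then 1 else 0) + sp

theorem AdjLists.searchFuel_le {n len : ℕ} {first next target : ℕ → ℕ} {A : ℕ → List ℕ}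
    (h : AdjLists n len first next target A) (visited : ℕ → ℕ) :
    searchFuel n visited 0 A ≤ len + n := by
  rw [searchFuel, h.sum_length, sum_boole, add_zero]
  exact Nat.add_le_add_left ((card_filter_le _ _).trans_eq (card_range n)) _

theorem searchFuel_discard {n sp x y : ℕ} {visited : ℕ → ℕ} {A : ℕ → List ℕ} {l : List ℕ}
    (hx : x < n) (hAx : A x = y :: l) :
    searchFuel n visited sp (Function.update A x l) + 1 = searchFuel n visited sp A := by
  have := sum_update_add (mem_range.2 hx) A l List.length
  rw [hAx, List.length_cons] at this
  unfold searchFuel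
  omega

theorem searchFuel_push {n sp y : ℕ} {visited : ℕ → ℕ} {A : ℕ → List ℕ} (hy : y < n)
    (hvisited : visited y = 0) :
    searchFuel n (Function.update visited y 1) (sp + 1) A = searchFuel n visited sp A := by
  have := sum_update_add (mem_range.2 hy) visited 1 fun v => if v = 0 then 1 else 0
  simp only [hvisited, if_true, one_ne_zero, if_false] at this
  unfold searchFuel
  omega

namespace SearchInv

variable {n s sp x y : ℕ} {Rel : ℕ → ℕ → Prop} {first next target visited stack : ℕ → ℕ}
  {A : ℕ → List ℕ}

theorem init (hlist : ∀ x < n, IsLinkedList next target (first x) (A x))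
    (hrel : ∀ x < n, ∀ y, y ∈ A x ↔ Rel x y) (hs : s < n) (hvisited : ∀ x < n, visited x = 0)
    (hstack : stack 0 = s) :
    SearchInv n s Rel first next target (Function.update visited s 1) stack 1 A := by
  have hnew : ∀ x < n, Function.update visited s 1 x ≠ 0 → x = s := fun x hx hv => by
    by_contra hxs
    exact hv (by simpa [hxs] using hvisited x hx)
  refine ⟨hlist, fun x hx y => (hrel x hx y).1, by simp, fun x hx hv => hnew x hx hv ▸ .refl,
    fun i hi => ?_, fun x hx hv => .inl ⟨0, one_pos, hstack.trans (hnew x hx hv).symm⟩,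
    fun x hx y => .inl ∘ (hrel x hx y).2⟩
  obtain rfl : i = 0 := by omega
  simpa [hstack] using hs

theorem pop (h : SearchInv n s Rel first next target visited stack sp A) (hsp : 0 < sp)
    (hfirst : first (stack (sp - 1)) = 0) :
    SearchInv n s Rel first next target visited stack (sp - 1) A := by
  refine { h with stacked := fun i hi => h.stacked i (by omega), done := fun x hx hv => ?_ }
  rcases h.done x hx hv with ⟨i, hi, rfl⟩ | hnil
  · rcases lt_or_ge i (sp - 1) with hlt | hge
    · exact .inl ⟨i, hlt, rfl⟩
    · obtain rfl : i = sp - 1 := by omega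
      exact .inr ((h.list _ hx).eq_nil hfirst)
  · exact .inr hnil

theorem discard {l : List ℕ} (h : SearchInv n s Rel first next target visited stack sp A)
    (hstack : ∃ i < sp, stack i = x) (hAx : A x = target (first x) :: l)
    (hl : IsLinkedList next target (next (first x)) l) (hvisited : visited (target (first x)) ≠ 0) :
    SearchInv n s Rel (Function.update first x (next (first x))) next target visited stack sp
      (Function.update A x l) := by
  refine { h with
    list := fun z hz => ?_, rel := fun z hz y hy => ?_, done := fun z hz hv => ?_,
    closed := fun z hz y hzy => ?_ } <;> rcases eq_or_ne z x with rfl | hzx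
  · simpa using hl
  · simpa [hzx] using h.list z hz
  · exact h.rel z hz y (by simp_all)
  · exact h.rel z hz y (by simpa [hzx] using hy)
  · exact .inl hstack
  · simpa [hzx] using h.done z hz hv
  · refine (h.closed z hz y hzy).elim (fun hy => ?_) .inr
    rcases List.mem_cons.1 (hAx ▸ hy) with rfl | hyl
    exacts [.inr hvisited, .inl (by simpa using hyl)]
  · simpa [hzx] using h.closed z hz y hzy

theorem push (h : SearchInv n s Rel first next target visited stack sp A) (hx : x < n)
    (hvisited : visited x ≠ 0) (hy : y < n) (hxy : Rel x y) :
    SearchInv n s Rel first next target (Function.update visited y 1)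
      (Function.update stack sp y) (sp + 1) A := by
  have hmono : ∀ z, visited z ≠ 0 → Function.update visited y 1 z ≠ 0 := fun z hz => by
    rcases eq_or_ne z y with rfl | hzy <;> simp_all
  refine { h with
    start := hmono _ h.start
    reach := fun z hz hv => ?_
    stacked := fun i hi => ?_
    done := fun z hz hv => ?_
    closed := fun z hz w hzw => (h.closed z hz w hzw).imp_right (hmono w) }
  · rcases eq_or_ne z y with rfl | hzy
    · exact (h.reach x hx hvisited).tail hxy
    · exact h.reach z hz (by simpa [hzy] using hv)
  · rcases eq_or_ne i sp with rfl | hisp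
    · simpa using hy
    · rw [Function.update_of_ne hisp]
      exact (h.stacked i (by omega)).imp_right (hmono _)
  · rcases eq_or_ne z y with rfl | hzy
    · exact .inl ⟨sp, Nat.lt_succ_self sp, by simp⟩
    · refine (h.done z hz (by simpa [hzy] using hv)).imp_left ?_
      rintro ⟨i, hi, hiz⟩
      exact ⟨i, by omega, by rw [Function.update_of_ne hi.ne, hiz]⟩

end SearchInv

/-- Compute the value of the flow. -/
def computeFlowValue : Cmd :=
  .setR RVar.cutCap .zero ;;
    .upto Var.i (.lit 0) Var.m
      (.cond (.eqI (.read Arr.tail (.var Var.i)) (.var Var.s))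
        (.setR RVar.cutCap (.add (.var RVar.cutCap)
          (.sub (.read RArr.flow (.var Var.i)) (.read RArr.backflow (.var Var.i)))))
        (.cond (.eqI (.read Arr.head (.var Var.i)) (.var Var.s))
          (.setR RVar.cutCap (.sub (.var RVar.cutCap)
            (.sub (.read RArr.flow (.var Var.i)) (.read RArr.backflow (.var Var.i)))))
          .skip))

def clearFirst : Cmd := .tabulate Arr.first Var.i Var.n .skip (.lit 0)

def clearVisited : Cmd := .tabulate Arr.visited Var.i Var.n .skip (.lit 0)

/-- If `b` holds, insert the node `y` into the adjacency list of the node `x`. -/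
def insertIf (b : BExp) (x y : ℕ) : Cmd :=
  .cond b
    (.setI Var.len (.succ (.var Var.len)) ;; .storeI Arr.target (.var Var.len) (.var y) ;;
      .storeI Arr.next (.var Var.len) (.read Arr.first (.var x)) ;;
      .storeI Arr.first (.var x) (.var Var.len))
    .skip

/-- The net flow `a[i] - b[i]` on arc `i` is smaller than its capacity. -/
def residualTest (a b : ℕ) : BExp :=
  .ltR (.sub (.read a (.var Var.i)) (.read b (.var Var.i))) (.read RArr.cap (.var Var.i))

/-- Insert the residual arcs that belong to arc `i`. -/
def insertResidual : Cmd :=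
  .setI Var.fst (.read Arr.tail (.var Var.i)) ;; .setI Var.snd (.read Arr.head (.var Var.i)) ;;
    insertIf (residualTest RArr.flow RArr.backflow) Var.fst Var.snd ;;
    insertIf (residualTest RArr.backflow RArr.flow) Var.snd Var.fst

def buildResidual : Cmd :=
  .setI Var.len (.lit 0) ;; .upto Var.i (.lit 0) Var.m insertResidual

def startSearch : Cmd :=
  .storeI Arr.visited (.var Var.s) (.lit 1) ;; .storeI Arr.stack (.lit 0) (.var Var.s) ;;
    .setI Var.sp (.lit 1)

def searchStep : Cmd :=
  .setI Var.top (.read Arr.stack (.pred (.var Var.sp))) ;;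
    .setI Var.cell (.read Arr.first (.var Var.top)) ;;
    .cond (.eqI (.var Var.cell) (.lit 0)) (.setI Var.sp (.pred (.var Var.sp)))
      (.storeI Arr.first (.var Var.top) (.read Arr.next (.var Var.cell)) ;;
        .setI Var.nbr (.read Arr.target (.var Var.cell)) ;;
        .cond (.eqI (.read Arr.visited (.var Var.nbr)) (.lit 0))
          (.storeI Arr.visited (.var Var.nbr) (.lit 1) ;;
            .storeI Arr.stack (.var Var.sp) (.var Var.nbr) ;; .setI Var.sp (.succ (.var Var.sp)))
          .skip)

def search : Cmd := startSearch ;; .loop (.ltI (.lit 0) (.var Var.sp)) searchStep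

/-- Compute a minimum cut: the nodes that are reachable in the residual graph of a maximum flow. -/
def computeMinCut : Cmd :=
  .maxflow workLayout RArr.flow RArr.backflow ;; computeFlowValue ;; clearFirst ;; clearVisited ;;
    buildResidual ;; search

/-- The flow `f` is stored in the arrays `flow` and `backflow`. -/
structure FlowStored (I : Network) (f : I.DArc → ℝ) (σ : State) : Prop where
  flow : ∀ i : Fin I.m, σ.rarr RArr.flow i = f (i, false)
  backflow : ∀ i : Fin I.m, σ.rarr RArr.backflow i = f (i, true)

section Search

variable {R : MaxFlowRoutine} {X n s : ℕ} {σ τ : State} {I : Network} {f : I.DArc → ℝ}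
  {Rel : ℕ → ℕ → Prop} {A : ℕ → List ℕ}

theorem FlowStored.frame {c : Cmd} (h : FlowStored I f σ) (hf : Frame c σ τ)
    (hflow : RArr.flow ∉ c.writesRarr) (hback : RArr.backflow ∉ c.writesRarr) :
    FlowStored I f τ :=
  ⟨fun i => by rw [hf.rarr _ hflow, h.flow], fun i => by rw [hf.rarr _ hback, h.backflow]⟩

theorem computeFlowValue_computes (hX : 1 ≤ X) (h : Stored workLayout I σ) (hm : I.m ≤ X)
    (hflow : FlowStored I f σ) :
    Computes R X computeFlowValue σ fun τ => τ.rvar RVar.cutCap = I.value univ f := by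
  have hsum : I.value univ f = ∑ i ∈ range I.m,
      (σ.rarr RArr.flow i - σ.rarr RArr.backflow i) *
        ((if σ.iarr Arr.tail i = I.s then 1 else 0) -
          (if σ.iarr Arr.head i = I.s then 1 else 0)) := by
    rw [Network.value, ← Network.boundary_net, Network.boundary_apply, sum_range]
    refine sum_congr rfl fun i _ => ?_
    rw [hflow.flow, hflow.backflow, show σ.iarr Arr.tail i = I.tail i from h.tail i,
      show σ.iarr Arr.head i = I.head i from h.head i]
    simp [Network.net, Fin.ext_iff]
  refine Computes.seq (Cmd.Straight.computes (c := .setR RVar.cutCap .zero)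
    (P := fun τ => τ.rvar RVar.cutCap = 0) trivial hX (by simp [Cmd.sem, RExp.eval]))
    fun τ₁ f₁ h₁ => ?_
  refine (Computes.upto (j₀ := 0) hX (by simp [Cmd.Straight])
    (fun j τ => τ.rvar RVar.cutCap = ∑ i ∈ range j,
      (σ.rarr RArr.flow i - σ.rarr RArr.backflow i) *
        ((if σ.iarr Arr.tail i = I.s then 1 else 0) -
          (if σ.iarr Arr.head i = I.s then 1 else 0)))
    rfl (h.frame f₁ (by decide) (by decide) (by decide)).m (Nat.zero_le _) hm (by decide)
    (by decide) (by decide) (by simpa using h₁) ?_).mono fun τ _ hτ => hτ.2.trans hsum.symm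
  intro j τ hf hj _ hjm hinv
  have g := f₁.seq_left.trans hf.seq_right
  have tail := g.iarr Arr.tail (by decide)
  have head := g.iarr Arr.head (by decide)
  have flow := g.rarr RArr.flow (by decide)
  have back := g.rarr RArr.backflow (by decide)
  have source : τ.ivar Var.s = I.s := (g.ivar Var.s (by decide)).trans h.s
  have hne : σ.iarr Arr.tail j ≠ σ.iarr Arr.head j := h.tail_ne_head hjm
  rw [sum_range_succ, ← hinv]
  by_cases ht : σ.iarr Arr.tail j = I.s
  · simp [Cmd.sem, BExp.Holds, IExp.eval, RExp.eval, hj, tail, flow, back, source, ht,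
      (ht ▸ hne).symm]
  by_cases hh : σ.iarr Arr.head j = I.s
  · simp [Cmd.sem, BExp.Holds, IExp.eval, RExp.eval, hj, tail, head, flow, back, source, ht, hh]
    ring
  · simp [Cmd.sem, BExp.Holds, IExp.eval, hj, tail, head, source, ht, hh]

/-- The adjacency lists in memory hold `A`. -/
def HoldsLists (n : ℕ) (A : ℕ → List ℕ) (σ : State) : Prop :=
  AdjLists n (σ.ivar Var.len) (σ.iarr Arr.first) (σ.iarr Arr.next) (σ.iarr Arr.target) A

theorem HoldsLists.insertIf_sem {x y : ℕ} (b : BExp) (h : HoldsLists n A σ) (hx : x ≠ Var.len)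
    (hy : y ≠ Var.len) (hxn : σ.ivar x < n) :
    ∃ A', HoldsLists n A' ((insertIf b x y).sem σ) ∧
      (∀ z w, w ∈ A' z ↔ w ∈ A z ∨ z = σ.ivar x ∧ w = σ.ivar y ∧ b.Holds σ) ∧
      ((insertIf b x y).sem σ).ivar Var.len ≤ σ.ivar Var.len + 1 := by
  by_cases hb : b.Holds σ
  · refine ⟨Function.update A (σ.ivar x) (σ.ivar y :: A (σ.ivar x)), ?_, fun z w => ?_, ?_⟩
    · rw [Var.len] at hx hy
      simpa [HoldsLists, insertIf, Cmd.sem, IExp.eval, hx, hy, hb] using h.insert hxn (σ.ivar y)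
    · rcases eq_or_ne z (σ.ivar x) with rfl | hz
      · simp [hb, or_comm]
      · simp [hz]
    · simp [insertIf, Cmd.sem, IExp.eval, hb]
  · exact ⟨A, by simpa [insertIf, Cmd.sem, hb] using h, by simp [hb],
      by simp [insertIf, Cmd.sem, hb]⟩

theorem HoldsLists.insertResidual_sem {j : Fin I.m} (hA : HoldsLists I.n A σ)
    (h : Stored workLayout I σ) (hflow : FlowStored I f σ) (hj : σ.ivar Var.i = j) :
    ∃ A', HoldsLists I.n A' (insertResidual.sem σ) ∧
      (∀ z w, w ∈ A' z ↔ w ∈ A z ∨ I.ResidualAt univ f j z w) ∧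
      (insertResidual.sem σ).ivar Var.len ≤ σ.ivar Var.len + 2 := by
  have tail : σ.iarr Arr.tail j = I.tail j := h.tail j
  have head : σ.iarr Arr.head j = I.head j := h.head j
  have cap : σ.rarr RArr.cap j = I.cap j := h.cap j
  have flow := hflow.flow j
  have back := hflow.backflow j
  set σ₁ := (Cmd.setI Var.fst (.read Arr.tail (.var Var.i)) ;;
    .setI Var.snd (.read Arr.head (.var Var.i))).sem σ with hσ₁
  have hA₁ : HoldsLists I.n A σ₁ := by simpa [hσ₁, HoldsLists, Cmd.sem] using hA
  have len₁ : σ₁.ivar Var.len = σ.ivar Var.len := by simp [hσ₁, Cmd.sem]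
  have i₁ : σ₁.ivar Var.i = j := by simp [hσ₁, Cmd.sem, hj]
  have fst₁ : σ₁.ivar Var.fst = I.tail j := by simp [hσ₁, Cmd.sem, IExp.eval, hj, tail]
  have snd₁ : σ₁.ivar Var.snd = I.head j := by simp [hσ₁, Cmd.sem, IExp.eval, hj, head]
  have rarr₁ : σ₁.rarr = σ.rarr := by simp [hσ₁, Cmd.sem]
  obtain ⟨A₂, hA₂, mem₂, len₂⟩ := hA₁.insertIf_sem (x := Var.fst) (y := Var.snd)
    (residualTest RArr.flow RArr.backflow) (by decide) (by decide) (fst₁.trans_lt (I.tail j).2)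
  set σ₂ := (insertIf (residualTest RArr.flow RArr.backflow) Var.fst Var.snd).sem σ₁ with hσ₂
  have ivar₂ : ∀ x, x ≠ Var.len → σ₂.ivar x = σ₁.ivar x := fun x hx => by
    simp only [hσ₂, insertIf, Cmd.sem]
    split_ifs <;> simp [hx]
  have rarr₂ : σ₂.rarr = σ₁.rarr := by
    simp only [hσ₂, insertIf, Cmd.sem]
    split_ifs <;> rfl
  have fst₂ := (ivar₂ Var.fst (by decide)).trans fst₁
  have snd₂ := (ivar₂ Var.snd (by decide)).trans snd₁
  have i₂ := (ivar₂ Var.i (by decide)).trans i₁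
  obtain ⟨A₃, hA₃, mem₃, len₃⟩ := hA₂.insertIf_sem (x := Var.snd) (y := Var.fst)
    (residualTest RArr.backflow RArr.flow) (by decide) (by decide) (snd₂.trans_lt (I.head j).2)
  refine ⟨A₃, hA₃, fun z w => ?_, len₃.trans (by omega)⟩
  rw [mem₃, mem₂, or_assoc]
  simp only [residualTest, BExp.Holds, RExp.eval, IExp.eval, fst₂, snd₂, i₂, rarr₂, fst₁, snd₁,
    i₁, rarr₁, flow, back, cap, Network.ResidualAt, Network.net, mem_univ, if_true]
  rw [neg_lt, neg_sub]

theorem clearFirst_computes (hX : 1 ≤ X) (hn : σ.ivar Var.n ≤ X) :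
    Computes R X clearFirst σ fun τ => ∀ x < σ.ivar Var.n, τ.iarr Arr.first x = 0 :=
  Computes.tabulate hX trivial (by decide) (by decide) (by decide) (by decide) rfl hn
    fun _ _ _ _ _ _ => rfl

theorem clearVisited_computes (hX : 1 ≤ X) (hn : σ.ivar Var.n ≤ X) :
    Computes R X clearVisited σ fun τ => ∀ x < σ.ivar Var.n, τ.iarr Arr.visited x = 0 :=
  Computes.tabulate hX trivial (by decide) (by decide) (by decide) (by decide) rfl hn
    fun _ _ _ _ _ _ => rfl

theorem buildResidual_computes (hX : 1 ≤ X) (h : Stored workLayout I σ) (hm : I.m ≤ X)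
    (hflow : FlowStored I f σ) (hfirst : ∀ x < I.n, σ.iarr Arr.first x = 0) :
    Computes R X buildResidual σ fun τ => ∃ A, HoldsLists I.n A τ ∧
      (∀ x y, y ∈ A x ↔ I.Residual univ f x y) ∧ τ.ivar Var.len ≤ 2 * I.m := by
  refine Computes.seq (Cmd.Straight.computes (c := .setI Var.len (.lit 0))
    (P := fun τ => τ.ivar Var.len = 0) trivial hX (by simp [Cmd.sem, IExp.eval]))
    fun τ₁ f₁ len₁ => ?_
  have s₁ := h.frame f₁ (by decide) (by decide) (by decide)
  have first₁ : τ₁.iarr Arr.first = σ.iarr Arr.first := f₁.iarr _ (by decide)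
  refine (Computes.upto (j₀ := 0) hX (by simp [Cmd.Straight, insertResidual, insertIf])
    (fun j τ => ∃ A, HoldsLists I.n A τ ∧
      (∀ x y, y ∈ A x ↔ ∃ i : Fin I.m, i < j ∧ I.ResidualAt univ f i x y) ∧
      τ.ivar Var.len ≤ 2 * j)
    rfl s₁.m (Nat.zero_le _) hm (by decide) (by decide) (by decide)
    ⟨fun _ => [], ⟨fun x hx => ?_, fun x hx => ?_, ?_⟩, by simp, ?_⟩ ?_).mono ?_
  · simpa [first₁, hfirst x hx] using IsLinkedList.nil
  · simp [first₁, hfirst x hx]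
  · simpa using len₁.symm
  · simpa using len₁.le
  · rintro j τ hf hj - hjm ⟨A, hA, hmem, hlen⟩
    have fj := f₁.seq_left.trans hf.seq_right
    obtain ⟨A', hA', hmem', hlen'⟩ := hA.insertResidual_sem (j := ⟨j, hjm⟩)
      (h.frame fj (by decide) (by decide) (by decide))
      (hflow.frame fj (by decide) (by decide)) hj
    refine ⟨A', by simpa [HoldsLists, Cmd.sem] using hA', fun x y => ?_,
      by simpa [Cmd.sem] using hlen'.trans (by omega)⟩
    rw [hmem', hmem]
    constructor
    · rintro (⟨i, hi, hxy⟩ | hxy)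
      exacts [⟨i, by omega, hxy⟩, ⟨_, Nat.lt_succ_self j, hxy⟩]
    · rintro ⟨i, hi, hxy⟩
      rcases (Nat.lt_succ_iff.1 hi).eq_or_lt with rfl | hij
      exacts [.inr hxy, .inl ⟨i, hij, hxy⟩]
  · rintro τ - ⟨-, A, hA, hmem, hlen⟩
    exact ⟨A, hA, fun x y => by simp [hmem, Network.Residual], hlen⟩

/-- The invariant `SearchInv` for the arrays in memory. -/
def Searching (n s : ℕ) (Rel : ℕ → ℕ → Prop) (A : ℕ → List ℕ) (σ : State) : Prop :=
  SearchInv n s Rel (σ.iarr Arr.first) (σ.iarr Arr.next) (σ.iarr Arr.target) (σ.iarr Arr.visited)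
    (σ.iarr Arr.stack) (σ.ivar Var.sp) A

theorem Searching.searchStep_sem (hrel : ∀ x y, Rel x y → y < n) (h : Searching n s Rel A σ)
    (hsp : 0 < σ.ivar Var.sp) :
    ∃ A', Searching n s Rel A' (searchStep.sem σ) ∧
      searchFuel n ((searchStep.sem σ).iarr Arr.visited) ((searchStep.sem σ).ivar Var.sp) A' <
        searchFuel n (σ.iarr Arr.visited) (σ.ivar Var.sp) A := by
  unfold Searching at h ⊢
  obtain ⟨x, hx⟩ : ∃ x, σ.iarr Arr.stack (σ.ivar Var.sp - 1) = x := ⟨_, rfl⟩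
  obtain ⟨hxn, hxv⟩ := h.stacked (σ.ivar Var.sp - 1) (by omega)
  rw [hx] at hxn hxv
  by_cases hcell : σ.iarr Arr.first x = 0
  · refine ⟨A, ?_⟩
    simpa [searchStep, Cmd.sem, BExp.Holds, IExp.eval, hx, hcell, searchFuel, hsp]
      using h.pop hsp (by rw [hx, hcell])
  obtain ⟨l, hAx, hl⟩ := (h.list x hxn).exists_eq_cons hcell
  obtain ⟨y, hy⟩ : ∃ y, σ.iarr Arr.target (σ.iarr Arr.first x) = y := ⟨_, rfl⟩
  rw [hy] at hAx
  have hxy : Rel x y := h.rel x hxn y (by simp [hAx])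
  have hfuel := searchFuel_discard (visited := σ.iarr Arr.visited) (sp := σ.ivar Var.sp) hxn hAx
  by_cases hyv : σ.iarr Arr.visited y = 0
  · refine ⟨Function.update A x l, ?_⟩
    have hfuel' := searchFuel_push (sp := σ.ivar Var.sp) (A := Function.update A x l)
      (hrel x y hxy) hyv
    have := (h.push hxn hxv (hrel x y hxy) hxy).discard (x := x)
      ⟨σ.ivar Var.sp - 1, by omega, by rw [Function.update_of_ne (by omega), hx]⟩
      (by rw [hAx, hy]) hl (by simp [hy])
    simpa [searchStep, Cmd.sem, BExp.Holds, IExp.eval, hx, hcell, hy, hyv, ← hfuel, hfuel']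
      using this
  · refine ⟨Function.update A x l, ?_⟩
    have := h.discard ⟨_, by omega, hx⟩ (by rw [hAx, hy]) hl (by rwa [hy])
    simpa [searchStep, Cmd.sem, BExp.Holds, IExp.eval, hx, hcell, hy, hyv, ← hfuel] using this

theorem search_computes (hX : 1 ≤ X) (hA : HoldsLists n A σ)
    (hmem : ∀ x < n, ∀ y, y ∈ A x ↔ Rel x y) (hrel : ∀ x y, Rel x y → y < n)
    (hs : σ.ivar Var.s = s) (hsn : s < n) (hvisited : ∀ x < n, σ.iarr Arr.visited x = 0)
    (hfuel : σ.ivar Var.len + n ≤ X) :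
    Computes R X search σ fun τ => τ.iarr Arr.visited s ≠ 0 ∧
      (∀ x < n, τ.iarr Arr.visited x ≠ 0 → ReflTransGen Rel s x) ∧
      ∀ x < n, τ.iarr Arr.visited x ≠ 0 → ∀ y, Rel x y → τ.iarr Arr.visited y ≠ 0 := by
  have hstart : Searching n s Rel A (startSearch.sem σ) := by
    simpa [Searching, startSearch, Cmd.sem, IExp.eval, hs] using
      SearchInv.init (stack := Function.update (σ.iarr Arr.stack) 0 s) hA.list hmem hsn hvisited
        (by simp)
  refine Computes.seq (P₁ := fun τ => τ = startSearch.sem σ)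
    (Cmd.Straight.computes (by simp [startSearch, Cmd.Straight]) hX rfl) ?_
  rintro _ - rfl
  refine (Computes.loop hX (by simp [searchStep, Cmd.Straight])
    (fun f τ => ∃ A', Searching n s Rel A' τ ∧
      f = searchFuel n (τ.iarr Arr.visited) (τ.ivar Var.sp) A') ?_ ⟨A, hstart, rfl⟩ ?_).mono ?_
  · refine hfuel.trans' (le_trans (Eq.le ?_) (hA.searchFuel_le (σ.iarr Arr.visited)))
    simpa [startSearch, Cmd.sem, IExp.eval, hs] using searchFuel_push hsn (hvisited s hsn)
  · rintro _ τ - ⟨A', hτ, rfl⟩ hsp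
    obtain ⟨A'', hτ', hlt⟩ := hτ.searchStep_sem hrel hsp
    exact ⟨_, hlt, A'', hτ', rfl⟩
  · rintro τ - ⟨hsp, _, A', hτ, rfl⟩
    have hempty : τ.ivar Var.sp = 0 := by simpa [BExp.Holds, IExp.eval] using hsp
    refine ⟨hτ.start, hτ.reach, fun x hx hv y hxy => (hτ.closed x hx y hxy).resolve_left ?_⟩
    rcases hτ.done x hx hv with ⟨i, hi, -⟩ | hnil
    · omega
    · simp [hnil]

theorem computeMinCut_runs (hX : 1 ≤ X) (h : Stored workLayout I σ) (hIX : 2 * I.m + I.n ≤ X) :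
    Runs R X computeMinCut σ fun τ l => l = [I] ∧
      I.IsCut (fun x => decide (x < I.n ∧ τ.iarr Arr.visited x ≠ 0)) ∧
      IsMinOn (I.cutCap univ) {D | I.IsCut D}
        (fun x => decide (x < I.n ∧ τ.iarr Arr.visited x ≠ 0)) ∧
      I.cutCap univ (fun x => decide (x < I.n ∧ τ.iarr Arr.visited x ≠ 0)) =
        τ.rvar RVar.cutCap := by
  have hcall : Runs R X (.maxflow workLayout RArr.flow RArr.backflow) σ fun τ l =>
      l = [I] ∧ FlowStored I (R.flow I) τ :=
    ⟨_, _, _, .maxflow I h, by simpa [Cmd.rate] using hX, rfl,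
      fun i => by simp [State.writeFlow, overwrite], fun i => by simp [State.writeFlow, overwrite]⟩
  refine hcall.seq_computes ?_
  rintro τ₁ _ f₁ ⟨rfl, flow₁⟩
  have s₁ := h.frame f₁ (by decide) (by decide) (by decide)
  refine (computeFlowValue_computes hX s₁ (by omega) flow₁).seq fun τ₂ f₂ hvalue => ?_
  have s₂ := s₁.frame f₂ (by decide) (by decide) (by decide)
  have n₂ : τ₂.ivar Var.n = I.n := s₂.n
  refine (clearFirst_computes hX (by omega)).seq fun τ₃ f₃ hfirst => ?_
  have s₃ := s₂.frame f₃ (by decide) (by decide) (by decide)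
  have n₃ : τ₃.ivar Var.n = I.n := s₃.n
  refine (clearVisited_computes hX (by omega)).seq fun τ₄ f₄ hvisited => ?_
  have s₄ := s₃.frame f₄ (by decide) (by decide) (by decide)
  have first₄ : τ₄.iarr Arr.first = τ₃.iarr Arr.first := f₄.iarr _ (by decide)
  have f₂₄ := f₂.seq_left.trans (f₃.seq_left.trans f₄.seq_right).seq_right
  refine (buildResidual_computes hX s₄ (by omega) (flow₁.frame f₂₄ (by decide) (by decide))
    (first₄ ▸ n₂ ▸ hfirst)).seq fun τ₅ f₅ ⟨A, hA, hmem, hlen⟩ => ?_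
  have s₅ := s₄.frame f₅ (by decide) (by decide) (by decide)
  have visited₅ : τ₅.iarr Arr.visited = τ₄.iarr Arr.visited := f₅.iarr _ (by decide)
  refine (search_computes hX hA (fun x _ => hmem x) (fun x y => Network.Residual.lt) s₅.s I.s.2
    (visited₅ ▸ n₃ ▸ hvisited) (by linarith [hlen])).mono fun τ₆ f₆ ⟨hs, hreach, hclosed⟩ => ?_
  have f₃₆ :=
    f₃.seq_left.trans (f₄.seq_left.trans (f₅.seq_left.trans f₆.seq_right).seq_right).seq_right
  have value₆ : τ₆.rvar RVar.cutCap = τ₂.rvar RVar.cutCap := f₃₆.rvar _ (by decide)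
  rw [value₆, hvalue]
  obtain ⟨hf, hmax⟩ := R.correct I
  obtain ⟨hcut, hcap⟩ := Network.isCut_and_cutCap_eq_value
    (D := fun x => decide (x < I.n ∧ τ₆.iarr Arr.visited x ≠ 0)) hf hmax (by simpa using hs)
    (fun x y hxy hx => by
      rw [decide_eq_true_iff] at hx ⊢
      exact ⟨hxy.lt, hclosed x hx.1 hx.2 y hxy⟩)
    fun x hx => by
      rw [decide_eq_true_iff] at hx
      exact hreach x hx.1 hx.2
  exact ⟨rfl, hcut, fun D hD => hcap.trans_le (hf.value_le_cutCap hD), hcap⟩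

end Search

/-! ### Cuts between two pairs of nodes -/

section CutsBetween

variable {I J K : Network} {ρ ρ' : ℕ → ℕ} {a b : ℕ} {D D' E : ℕ → Bool}
  {r : ℝ}

theorem Network.cutCap_congr (A : Finset (Fin I.m)) (h : Set.EqOn D D' (Set.Iio I.n)) :
    I.cutCap A D = I.cutCap A D' := by
  simp only [Network.cutCap, h (I.tail _).2, h (I.head _).2]

/-- The cuts with `a` on the side of `s` and `b` on the side of `t`. -/
def Network.cutsBetween (I : Network) (a b : ℕ) : Set (ℕ → Bool) :=
  {D | I.IsCut D ∧ D a = true ∧ D b = false}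

/-- `D` is a minimum cut among those with `a` on the side of `s` and `b` on the side of `t`, and
`r` is its capacity. -/
structure IsMinCutBetween (I : Network) (a b : ℕ) (D : ℕ → Bool) (r : ℝ) : Prop where
  mem : D ∈ I.cutsBetween a b
  cap_eq : I.cutCap univ D = r
  le : ∀ D' ∈ I.cutsBetween a b, r ≤ I.cutCap univ D'

theorem IsMinCutBetween.congr (h : IsMinCutBetween I a b D r) (ha : a < I.n) (hb : b < I.n)
    (hD : Set.EqOn D' D (Set.Iio I.n)) : IsMinCutBetween I a b D' r := by
  obtain ⟨⟨hs, ht⟩, hDa, hDb⟩ := h.mem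
  exact ⟨⟨⟨(hD I.s.2).trans hs, (hD I.t.2).trans ht⟩, (hD ha).trans hDa, (hD hb).trans hDb⟩,
    (Network.cutCap_congr univ hD).trans h.cap_eq, h.le⟩

/-- After the first contraction the terminals are exchanged, so that the second contraction merges
`b` into `t`. -/
theorem Contracts.isMinCutBetween (h : Contracts I J ρ a) (h' : Contracts J K ρ' (ρ b))
    (ha : a < I.n) (hb : b < I.n) (hE : K.IsCut E)
    (hmin : IsMinOn (K.cutCap univ) {D | K.IsCut D} E) :
    IsMinCutBetween I a b (E ∘ ρ' ∘ ρ) (K.cutCap univ E) := by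
  have hs : (K.s : ℕ) = ρ' (ρ I.s) := by rw [h'.s_eq, h.t_eq]
  have ht : (K.t : ℕ) = ρ' (ρ I.t) := by rw [h'.t_eq, h.s_eq]
  have hcap : ∀ E, K.cutCap univ E = I.cutCap univ (E ∘ ρ' ∘ ρ) := fun E => by
    rw [h'.cut, h.cut, Function.comp_assoc]
  have hEs : E (ρ' (ρ I.s)) = true := hs ▸ hE.1
  have hEt : E (ρ' (ρ I.t)) = false := ht ▸ hE.2
  have hEa : E (ρ' (ρ a)) = true := by rw [h.map_node ha, hEs]
  have hEb : E (ρ' (ρ b)) = false := by rw [h'.map_node (h.lt hb), h.s_eq, hEt]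
  refine ⟨⟨⟨hEs, hEt⟩, hEa, hEb⟩, (hcap E).symm, fun D ⟨⟨hDs, hDt⟩, hDa, hDb⟩ => ?_⟩
  obtain ⟨D₁, hD₁⟩ := h.exists_comp_eq (hDa.trans hDs.symm)
  obtain ⟨D₂, hD₂⟩ := h'.exists_comp_eq (D := D₁) (by
    rw [h.s_eq]; exact (hD₁ hb).trans ((hDb.trans hDt.symm).trans (hD₁ I.t.2).symm))
  have hD₁₂ : Set.EqOn (D₂ ∘ ρ' ∘ ρ) D (Set.Iio I.n) := fun x hx =>
    (hD₂ (h.lt hx)).trans (hD₁ hx)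
  have hcut : K.IsCut D₂ := ⟨hs ▸ (hD₁₂ I.s.2).trans hDs, ht ▸ (hD₁₂ I.t.2).trans hDt⟩
  calc K.cutCap univ E ≤ K.cutCap univ D₂ := hmin hcut
    _ = I.cutCap univ (D₂ ∘ ρ' ∘ ρ) := hcap D₂
    _ = I.cutCap univ D := Network.cutCap_congr univ hD₁₂

theorem Contracts.ne_t (h : Contracts I J ρ a) (hb : b < I.n) (hab : a ≠ b) (hbs : b ≠ I.s) :
    ρ b ≠ J.t := by
  rw [h.t_eq, Ne, h.eq_iff b hb _ I.s.2]
  simp [hbs, hab.symm]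

/-- The capacity of a cut as an extended real, for use as a weight in `sepVal`. -/
noncomputable def Network.cutWeight (I : Network) (D : ℕ → Bool) : EReal := I.cutCap univ D

theorem IsMinCutBetween.isMinSep (h : IsMinCutBetween I a b D r)
    (h' : ∀ D' ∈ I.cutsBetween b a, r ≤ I.cutCap univ D') :
    IsMinSep {D | I.IsCut D} I.cutWeight a b D := by
  refine ⟨h.mem.1, by simp [h.mem.2], le_sepVal fun D' hD' hne => EReal.coe_le_coe ?_⟩
  rw [h.cap_eq]
  cases ha : D' a <;> cases hb : D' b
  · exact absurd (ha.trans hb.symm) hne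
  · exact h' D' ⟨hD', hb, ha⟩
  · exact h.le D' ⟨hD', ha, hb⟩
  · exact absurd (ha.trans hb.symm) hne

end CutsBetween

def copyParameters : Cmd :=
  .setI Var.n (.var Var.inN) ;; .setI Var.m (.var Var.inM) ;; .setI Var.s (.var Var.inS) ;;
    .setI Var.t (.var Var.inT)

def copyArcs : Cmd :=
  .upto Var.i (.lit 0) Var.m
    (.storeI Arr.tail (.var Var.i) (.read Arr.inTail (.var Var.i)) ;;
      .storeI Arr.head (.var Var.i) (.read Arr.inHead (.var Var.i)) ;;
      .storeR RArr.cap (.var Var.i) (.read RArr.inCap (.var Var.i)))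

def resetImage : Cmd := .tabulate Arr.image Var.i Var.inN .skip (.var Var.i)

/-- Copy the input network to `workLayout`. -/
def copyInput : Cmd := copyParameters ;; copyArcs ;; resetImage

/-- Merge `src` into `s` and `snk` into `t`. -/
def mergeEnds : Cmd :=
  .setI Var.node (.var Var.src) ;; contract ;;
    .setI Var.node (.read Arr.image (.var Var.snk)) ;; contract

/-- Pull the marks of the nodes of the contracted network back to the input. -/
def readSide : Cmd :=
  .tabulate Arr.side Var.i Var.inN .skip (.read Arr.visited (.read Arr.image (.var Var.i)))

/-- Find a minimum cut with `src` on the side of `s` and `snk` on the side of `t`. -/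
def cutBetween : Cmd := copyInput ;; mergeEnds ;; computeMinCut ;; readSide

/-- The cut marked by the nonzero entries of an array. -/
def marked (a : ℕ → ℕ) (x : ℕ) : Bool := decide (a x ≠ 0)

section CutBetween

variable {R : MaxFlowRoutine} {X : ℕ} {σ : State} {I : Network}

theorem copyArcs_computes (hX : 1 ≤ X) (hm : σ.ivar Var.m ≤ X) :
    Computes R X copyArcs σ fun τ => ∀ i < σ.ivar Var.m,
      τ.iarr Arr.tail i = σ.iarr Arr.inTail i ∧ τ.iarr Arr.head i = σ.iarr Arr.inHead i ∧
        τ.rarr RArr.cap i = σ.rarr RArr.inCap i := by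
  refine (Computes.upto (j₀ := 0) hX (by simp [Cmd.Straight]) (fun j τ => ∀ i < j,
    τ.iarr Arr.tail i = σ.iarr Arr.inTail i ∧ τ.iarr Arr.head i = σ.iarr Arr.inHead i ∧
      τ.rarr RArr.cap i = σ.rarr RArr.inCap i) rfl rfl (Nat.zero_le _) hm (by decide) (by decide)
    (by decide) (by simp) ?_).mono fun τ _ h => h.2
  intro j τ hf hj _ _ hinv i hi
  have inTail : τ.iarr Arr.inTail = σ.iarr Arr.inTail := hf.iarr _ (by decide)
  have inHead : τ.iarr Arr.inHead = σ.iarr Arr.inHead := hf.iarr _ (by decide)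
  have inCap : τ.rarr RArr.inCap = σ.rarr RArr.inCap := hf.rarr _ (by decide)
  rcases (Nat.lt_succ_iff.1 hi).eq_or_lt with rfl | hij
  · simp [Cmd.sem, IExp.eval, RExp.eval, hj, inTail, inHead, inCap]
  · simpa [Cmd.sem, IExp.eval, RExp.eval, hj, hij.ne] using hinv i hij

theorem resetImage_computes (hX : 1 ≤ X) (hn : σ.ivar Var.inN ≤ X) :
    Computes R X resetImage σ fun τ => ∀ x < σ.ivar Var.inN, τ.iarr Arr.image x = x :=
  Computes.tabulate hX trivial (by decide) (by decide) (by decide) (by decide) rfl hn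
    fun _ _ _ _ hj _ => hj

theorem copyInput_computes (hX : 1 ≤ X) (h : Stored inputLayout I σ) (hn : I.n ≤ X)
    (hm : I.m ≤ X) :
    Computes R X copyInput σ fun τ =>
      Stored workLayout I τ ∧ ∀ x < I.n, τ.iarr Arr.image x = x := by
  refine Computes.seq (P₁ := fun τ => τ.ivar Var.n = I.n ∧ τ.ivar Var.m = I.m ∧
    τ.ivar Var.s = I.s ∧ τ.ivar Var.t = I.t) (Cmd.Straight.computes
      (by simp [copyParameters, Cmd.Straight]) hX ⟨h.n, h.m, h.s, h.t⟩)
    fun τ₁ f₁ ⟨n₁, m₁, s₁, t₁⟩ => ?_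
  have in₁ := h.frame f₁ (by decide) (by decide) (by decide)
  refine (copyArcs_computes hX (by omega)).seq fun τ₂ f₂ harcs => ?_
  rw [m₁] at harcs
  have in₂ := in₁.frame f₂ (by decide) (by decide) (by decide)
  have inN₂ : τ₂.ivar Var.inN = I.n := in₂.n
  refine (resetImage_computes hX (by omega)).mono fun τ₃ f₃ himage => ⟨?_, inN₂ ▸ himage⟩
  have work₂ : Stored workLayout I τ₂ :=
    ⟨(f₂.ivar Var.n (by decide)).trans n₁, (f₂.ivar Var.m (by decide)).trans m₁,
      (f₂.ivar Var.s (by decide)).trans s₁, (f₂.ivar Var.t (by decide)).trans t₁,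
      fun i => (harcs i i.2).1.trans (in₁.tail i), fun i => (harcs i i.2).2.1.trans (in₁.head i),
      fun i => (harcs i i.2).2.2.trans (in₁.cap i)⟩
  exact work₂.frame f₃ (by decide) (by decide) (by decide)

theorem mergeEnds_computes (hX : 1 ≤ X) (hin : Stored inputLayout I σ)
    (hwork : Stored workLayout I σ) (himage : ∀ x < I.n, σ.iarr Arr.image x = x) (hn : I.n ≤ X)
    (hm : I.m ≤ X) (ha : σ.ivar Var.src < I.n) (hb : σ.ivar Var.snk < I.n)
    (hab : σ.ivar Var.src ≠ σ.ivar Var.snk) (hat : σ.ivar Var.src ≠ I.t)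
    (hbs : σ.ivar Var.snk ≠ I.s) :
    Computes R X mergeEnds σ fun τ => ∃ J ρ K ρ', Stored workLayout K τ ∧
      Contracts I J ρ (σ.ivar Var.src) ∧ Contracts J K ρ' (ρ (σ.ivar Var.snk)) ∧
      ∀ x < I.n, τ.iarr Arr.image x = ρ' (ρ x) := by
  refine Computes.seq (P₁ := fun τ => τ.ivar Var.node = σ.ivar Var.src)
    (Cmd.Straight.computes trivial hX (by simp [Cmd.sem, IExp.eval])) fun τ₁ f₁ node₁ => ?_
  have work₁ := hwork.frame f₁ (by decide) (by decide) (by decide)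
  have inN₁ : τ₁.ivar Var.inN = I.n := (f₁.ivar Var.inN (by decide)).trans hin.n
  have image₁ : τ₁.iarr Arr.image = σ.iarr Arr.image := f₁.iarr _ (by decide)
  refine (contract_computes hX work₁ hn hm (by omega) (node₁ ▸ ha) (node₁ ▸ hat) fun x hx => by
    rw [image₁, himage x (inN₁ ▸ hx)]; exact inN₁ ▸ hx).seq
    fun τ₂ f₂ ⟨J, ρ, work₂, hρ, image₂⟩ => ?_
  rw [node₁] at hρ
  replace image₂ : ∀ x < I.n, τ₂.iarr Arr.image x = ρ x := fun x hx => by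
    rw [image₂ x (inN₁ ▸ hx), image₁, himage x hx]
  have snk₂ : τ₂.ivar Var.snk = σ.ivar Var.snk :=
    (f₂.ivar _ (by decide)).trans (f₁.ivar _ (by decide))
  refine Computes.seq (P₁ := fun τ => τ.ivar Var.node = ρ (σ.ivar Var.snk))
    (Cmd.Straight.computes trivial hX (by simp [Cmd.sem, IExp.eval, snk₂, image₂ _ hb]))
    fun τ₃ f₃ node₃ => ?_
  have work₃ := work₂.frame f₃ (by decide) (by decide) (by decide)
  have inN₃ : τ₃.ivar Var.inN = I.n :=
    (f₃.ivar _ (by decide)).trans ((f₂.ivar _ (by decide)).trans inN₁)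
  have image₃ : τ₃.iarr Arr.image = τ₂.iarr Arr.image := f₃.iarr _ (by decide)
  refine (contract_computes hX work₃ (hρ.n_le.trans hn) (hρ.m_le.trans hm) (by omega)
    (node₃ ▸ hρ.lt hb) (node₃ ▸ hρ.ne_t hb hab hbs) fun x hx => by
      rw [image₃, image₂ x (inN₃ ▸ hx)]; exact hρ.lt (inN₃ ▸ hx)).mono
    fun τ₄ _ ⟨K, ρ', work₄, hρ', image₄⟩ => ?_
  exact ⟨J, ρ, K, ρ', work₄, hρ, node₃ ▸ hρ', fun x hx => by
    rw [image₄ x (inN₃ ▸ hx), image₃, image₂ x hx]⟩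

theorem readSide_computes (hX : 1 ≤ X) (hn : σ.ivar Var.inN ≤ X) :
    Computes R X readSide σ fun τ => ∀ x < σ.ivar Var.inN,
      τ.iarr Arr.side x = σ.iarr Arr.visited (σ.iarr Arr.image x) :=
  Computes.tabulate hX trivial (by decide) (by decide) (by decide) (by decide) rfl hn
    fun j _ τ hf hj _ => by
      simp only [Cmd.sem, IExp.eval, hj, hf.iarr Arr.image (by decide),
        hf.iarr Arr.visited (by decide)]

theorem cutBetween_runs (hX : 1 ≤ X) (h : Stored inputLayout I σ) (hIX : 2 * I.m + I.n ≤ X)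
    (ha : σ.ivar Var.src < I.n) (hb : σ.ivar Var.snk < I.n)
    (hab : σ.ivar Var.src ≠ σ.ivar Var.snk) (hat : σ.ivar Var.src ≠ I.t)
    (hbs : σ.ivar Var.snk ≠ I.s) :
    Runs R X cutBetween σ fun τ l => (∃ J, l = [J] ∧ J.n ≤ I.n ∧ J.m ≤ I.m) ∧
      IsMinCutBetween I (σ.ivar Var.src) (σ.ivar Var.snk) (marked (τ.iarr Arr.side))
        (τ.rvar RVar.cutCap) := by
  refine (copyInput_computes hX h (by omega) (by omega)).runs_seq fun τ₁ f₁ ⟨work₁, image₁⟩ => ?_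
  have in₁ := h.frame f₁ (by decide) (by decide) (by decide)
  have src₁ : τ₁.ivar Var.src = σ.ivar Var.src := f₁.ivar _ (by decide)
  have snk₁ : τ₁.ivar Var.snk = σ.ivar Var.snk := f₁.ivar _ (by decide)
  rw [← src₁] at ha hab hat ⊢
  rw [← snk₁] at hb hab hbs ⊢
  refine (mergeEnds_computes hX in₁ work₁ image₁ (by omega) (by omega) ha hb hab hat hbs).runs_seq
    fun τ₂ f₂ ⟨J, ρ, K, ρ', work₂, hρ, hρ', image₂⟩ => ?_
  have in₂ := in₁.frame f₂ (by decide) (by decide) (by decide)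
  have hKn := hρ'.n_le.trans hρ.n_le
  have hKm := hρ'.m_le.trans hρ.m_le
  refine (computeMinCut_runs hX work₂ (by omega)).seq_computes
    fun τ₃ l f₃ ⟨hl, hcut, hmin, hcap⟩ => ?_
  have in₃ := in₂.frame f₃ (by decide) (by decide) (by decide)
  have inN₃ : τ₃.ivar Var.inN = I.n := in₃.n
  have image₃ : τ₃.iarr Arr.image = τ₂.iarr Arr.image := f₃.iarr _ (by decide)
  refine (readSide_computes hX (by omega)).mono fun τ₄ f₄ hside => ?_
  have cap₄ : τ₄.rvar RVar.cutCap = τ₃.rvar RVar.cutCap := f₄.rvar _ (by decide)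
  have hmarked : Set.EqOn (marked (τ₄.iarr Arr.side))
      ((fun x => decide (x < K.n ∧ τ₃.iarr Arr.visited x ≠ 0)) ∘ ρ' ∘ ρ) (Set.Iio I.n) :=
    fun x hx => by
      simp only [marked, Function.comp_apply, hside x (inN₃ ▸ hx), image₃, image₂ x hx,
        hρ'.lt (hρ.lt hx), true_and]
  rw [cap₄, ← hcap]
  exact ⟨⟨K, hl, hKn, hKm⟩, (hρ.isMinCutBetween hρ' ha hb hcut hmin).congr ha hb hmarked⟩

end CutBetween

def saveCut : Cmd :=
  .setR RVar.bestCap (.var RVar.cutCap) ;;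
    .tabulate Arr.bestSide Var.i Var.inN .skip (.read Arr.side (.var Var.i))

/-- There are cuts with node `x` on the side of `s` and node `y` on the side of `t`. -/
def canSeparate (x y : ℕ) : BExp :=
  .and (.not (.eqI (.var x) (.var Var.inT))) (.not (.eqI (.var y) (.var Var.inS)))

def chooseEnds : Cmd :=
  .cond (canSeparate Var.k Var.parent)
    (.setI Var.src (.var Var.k) ;; .setI Var.snk (.var Var.parent))
    (.setI Var.src (.var Var.parent) ;; .setI Var.snk (.var Var.k))

def swapEnds : Cmd :=
  .setI Var.swap (.var Var.src) ;; .setI Var.src (.var Var.snk) ;; .setI Var.snk (.var Var.swap)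

def keepBetter : Cmd := .cond (.ltR (.var RVar.cutCap) (.var RVar.bestCap)) saveCut .skip

def tryReverse : Cmd :=
  .cond (canSeparate Var.snk Var.src) (swapEnds ;; cutBetween ;; keepBetter) .skip

/-- Find a minimum cut that separates the nodes `k` and `parent`. -/
def separate : Cmd := chooseEnds ;; cutBetween ;; saveCut ;; tryReverse

section Separate

variable {R : MaxFlowRoutine} {X : ℕ} {σ : State} {I : Network} {a b : ℕ}

/-- In the memory `τ`, `bestSide` marks a minimum cut that separates `a` from `b`, and `bestCap` is
its capacity. -/
def HasBestCut (I : Network) (a b : ℕ) (τ : State) : Prop :=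
  IsMinSep {D | I.IsCut D} I.cutWeight a b (marked (τ.iarr Arr.bestSide)) ∧
    I.cutCap univ (marked (τ.iarr Arr.bestSide)) = τ.rvar RVar.bestCap

/-- At most `k` calls of the routine, none of them on an instance larger than `I`. -/
def FewCalls (I : Network) (k : ℕ) (l : List Network) : Prop :=
  l.length ≤ k ∧ ∀ J ∈ l, J.n ≤ I.n ∧ J.m ≤ I.m

theorem HasBestCut.symm {τ : State} (h : HasBestCut I a b τ) : HasBestCut I b a τ :=
  ⟨h.1.symm, h.2⟩

theorem FewCalls.nil (I : Network) (k : ℕ) : FewCalls I k [] := by simp [FewCalls]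

theorem FewCalls.append {k k' : ℕ} {l l' : List Network} (h : FewCalls I k l)
    (h' : FewCalls I k' l') : FewCalls I (k + k') (l ++ l') :=
  ⟨by simpa using add_le_add h.1 h'.1, fun J hJ => (List.mem_append.1 hJ).elim (h.2 J) (h'.2 J)⟩

theorem FewCalls.sum_time_le {k : ℕ} {l : List Network} (h : FewCalls I k l) {MF : ℕ → ℕ → ℕ}
    (hMF : R.RunsIn MF) : (l.map R.time).sum ≤ k * MF I.n I.m := by
  have htime : ∀ x ∈ l.map R.time, x ≤ MF I.n I.m :=
    List.forall_mem_map.2 fun J hJ => hMF _ _ J (h.2 J hJ).1 (h.2 J hJ).2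
  calc
    (l.map R.time).sum ≤ (l.map R.time).length • MF I.n I.m := List.sum_le_card_nsmul _ _ htime
    _ ≤ k * MF I.n I.m := by rw [List.length_map, smul_eq_mul]; gcongr; exact h.1

theorem chooseEnds_computes (hX : 1 ≤ X) (h : Stored inputLayout I σ)
    (hne : σ.ivar Var.k ≠ σ.ivar Var.parent) :
    Computes R X chooseEnds σ fun τ => τ.ivar Var.src ≠ I.t ∧ τ.ivar Var.snk ≠ I.s ∧
      (τ.ivar Var.src = σ.ivar Var.k ∧ τ.ivar Var.snk = σ.ivar Var.parent ∨
        τ.ivar Var.src = σ.ivar Var.parent ∧ τ.ivar Var.snk = σ.ivar Var.k) := by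
  have hs : σ.ivar Var.inS = I.s := h.s
  have ht : σ.ivar Var.inT = I.t := h.t
  have hst : (I.s : ℕ) ≠ I.t := fun hst => I.s_ne_t (Fin.ext hst)
  refine Cmd.Straight.computes (by simp [chooseEnds, Cmd.Straight]) hX ?_
  obtain ⟨k, hk⟩ : ∃ k, σ.ivar Var.k = k := ⟨_, rfl⟩
  obtain ⟨p, hp⟩ : ∃ p, σ.ivar Var.parent = p := ⟨_, rfl⟩
  rw [hk, hp] at hne ⊢
  by_cases hc : (canSeparate Var.k Var.parent).Holds σ
  · simp only [chooseEnds, Cmd.sem, if_pos hc]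
    simp only [canSeparate, BExp.Holds, IExp.eval, hk, hp, hs, ht] at hc
    simp [IExp.eval, hk, hp]
    omega
  · simp only [chooseEnds, Cmd.sem, if_neg hc]
    simp only [canSeparate, BExp.Holds, IExp.eval, hk, hp, hs, ht] at hc
    simp [IExp.eval, hk, hp]
    omega

theorem saveCut_computes (hX : 1 ≤ X) (hin : σ.ivar Var.inN = I.n) (hn : I.n ≤ X) (ha : a < I.n)
    (hb : b < I.n)
    (h : IsMinCutBetween I a b (marked (σ.iarr Arr.side)) (σ.rvar RVar.cutCap)) :
    Computes R X saveCut σ fun τ => τ.rvar RVar.bestCap = σ.rvar RVar.cutCap ∧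
      IsMinCutBetween I a b (marked (τ.iarr Arr.bestSide)) (τ.rvar RVar.bestCap) := by
  refine Computes.seq (P₁ := fun τ => τ.rvar RVar.bestCap = σ.rvar RVar.cutCap)
    (Cmd.Straight.computes trivial hX (by simp [Cmd.sem, RExp.eval])) fun τ₁ f₁ cap₁ => ?_
  have inN₁ : τ₁.ivar Var.inN = I.n := (f₁.ivar _ (by decide)).trans hin
  have side₁ : τ₁.iarr Arr.side = σ.iarr Arr.side := f₁.iarr _ (by decide)
  refine Computes.mono (Computes.tabulate (g := σ.iarr Arr.side) hX trivial (by decide)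
    (by decide) (by decide) (by decide) inN₁ hn fun j _ τ hf hj _ => by
      simp only [Cmd.sem, IExp.eval, hj, hf.iarr Arr.side (by decide), side₁])
    fun τ₂ f₂ side₂ => ?_
  have cap₂ : τ₂.rvar RVar.bestCap = σ.rvar RVar.cutCap := (f₂.rvar _ (by decide)).trans cap₁
  exact ⟨cap₂, cap₂ ▸ h.congr ha hb fun x hx => by simp only [marked, side₂ x hx]⟩

theorem keepBetter_computes (hX : 1 ≤ X) (hin : σ.ivar Var.inN = I.n) (hn : I.n ≤ X)
    (ha : a < I.n) (hb : b < I.n)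
    (hbest : IsMinCutBetween I a b (marked (σ.iarr Arr.bestSide)) (σ.rvar RVar.bestCap))
    (h : IsMinCutBetween I b a (marked (σ.iarr Arr.side)) (σ.rvar RVar.cutCap)) :
    Computes R X keepBetter σ (HasBestCut I a b) := by
  refine Runs.cond hX (fun hlt => ?_) fun hle => ?_
  · refine (saveCut_computes hX hin hn hb ha h).mono fun τ _ ⟨hcap, hτ⟩ => ?_
    refine HasBestCut.symm ⟨hτ.isMinSep fun D hD => ?_, hτ.cap_eq⟩
    exact hcap.trans_le (le_of_lt hlt) |>.trans (hbest.le D hD)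
  · refine Cmd.Straight.computes trivial hX ⟨hbest.isMinSep fun D hD => ?_, hbest.cap_eq⟩
    exact (not_lt.1 hle).trans (h.le D hD)

theorem swapEnds_computes (hX : 1 ≤ X) :
    Computes R X swapEnds σ fun τ =>
      τ.ivar Var.src = σ.ivar Var.snk ∧ τ.ivar Var.snk = σ.ivar Var.src :=
  Cmd.Straight.computes (by simp [swapEnds, Cmd.Straight]) hX (by
    simp [swapEnds, Cmd.sem, IExp.eval])

theorem tryReverse_runs (hX : 1 ≤ X) (h : Stored inputLayout I σ) (hIX : 2 * I.m + I.n ≤ X)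
    (ha : σ.ivar Var.src < I.n) (hb : σ.ivar Var.snk < I.n)
    (hab : σ.ivar Var.src ≠ σ.ivar Var.snk)
    (hbest : IsMinCutBetween I (σ.ivar Var.src) (σ.ivar Var.snk) (marked (σ.iarr Arr.bestSide))
      (σ.rvar RVar.bestCap)) :
    Runs R X tryReverse σ fun τ l =>
      FewCalls I 1 l ∧ HasBestCut I (σ.ivar Var.src) (σ.ivar Var.snk) τ := by
  have hs : σ.ivar Var.inS = I.s := h.s
  have ht : σ.ivar Var.inT = I.t := h.t
  refine Runs.cond hX (fun hc => ?_) fun hc => ?_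
  · simp only [canSeparate, BExp.Holds, IExp.eval, hs, ht] at hc
    refine (swapEnds_computes hX).runs_seq fun τ₁ f₁ ⟨src₁, snk₁⟩ => ?_
    have in₁ := h.frame f₁ (by decide) (by decide) (by decide)
    refine (cutBetween_runs hX in₁ hIX (src₁ ▸ hb) (snk₁ ▸ ha) (src₁ ▸ snk₁ ▸ hab.symm)
      (src₁ ▸ hc.1) (snk₁ ▸ hc.2)).seq_computes fun τ₂ l f₂ ⟨⟨J, hl, hJ⟩, hcut⟩ => ?_
    rw [src₁, snk₁] at hcut
    have in₂ := in₁.frame f₂ (by decide) (by decide) (by decide)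
    have f₁₂ : Frame (swapEnds ;; cutBetween) σ τ₂ := f₁.seq_left.trans f₂.seq_right
    rw [← f₁₂.iarr Arr.bestSide (by decide), ← f₁₂.rvar RVar.bestCap (by decide)] at hbest
    exact (keepBetter_computes hX in₂.n (by omega) ha hb hbest hcut).mono fun τ₃ _ hτ₃ =>
      ⟨by simpa [FewCalls, hl] using hJ, hτ₃⟩
  · simp only [canSeparate, BExp.Holds, IExp.eval, hs, ht, ← not_or, not_not] at hc
    refine Computes.runs (Cmd.Straight.computes (P := (· = σ)) trivial hX rfl) ?_
    rintro _ - rfl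
    refine ⟨FewCalls.nil I 1, hbest.isMinSep fun D hD => ?_, hbest.cap_eq⟩
    obtain ⟨⟨hDs, hDt⟩, hDb, hDa⟩ := hD
    rcases hc with hc | hc
    · exact absurd (hDt.symm.trans (hc ▸ hDb)) Bool.false_ne_true
    · exact absurd ((hc ▸ hDa).symm.trans hDs) Bool.false_ne_true

theorem separate_runs (hX : 1 ≤ X) (h : Stored inputLayout I σ) (hIX : 2 * I.m + I.n ≤ X)
    (hk : σ.ivar Var.k < I.n) (hp : σ.ivar Var.parent < I.n)
    (hne : σ.ivar Var.k ≠ σ.ivar Var.parent) :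
    Runs R X separate σ fun τ l =>
      FewCalls I 2 l ∧ HasBestCut I (σ.ivar Var.k) (σ.ivar Var.parent) τ := by
  refine (chooseEnds_computes hX h hne).runs_seq fun τ₁ f₁ ⟨hat, hbs, hends⟩ => ?_
  have in₁ := h.frame f₁ (by decide) (by decide) (by decide)
  have ha : τ₁.ivar Var.src < I.n := by omega
  have hb : τ₁.ivar Var.snk < I.n := by omega
  have hab : τ₁.ivar Var.src ≠ τ₁.ivar Var.snk := by omega
  suffices hsep : Runs R X (cutBetween ;; saveCut ;; tryReverse) τ₁ fun τ l =>
      FewCalls I 2 l ∧ HasBestCut I (τ₁.ivar Var.src) (τ₁.ivar Var.snk) τ by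
    refine hsep.mono fun τ l _ hτ => ⟨hτ.1, ?_⟩
    rcases hends with ⟨hsrc, hsnk⟩ | ⟨hsrc, hsnk⟩
    · exact hsrc ▸ hsnk ▸ hτ.2
    · exact hsrc ▸ hsnk ▸ hτ.2.symm
  refine (cutBetween_runs hX in₁ hIX ha hb hab hat hbs).seq fun τ₂ l f₂ ⟨⟨J, hl, hJ⟩, hcut⟩ => ?_
  have in₂ := in₁.frame f₂ (by decide) (by decide) (by decide)
  refine (saveCut_computes hX in₂.n (by omega) ha hb hcut).runs_seq fun τ₃ f₃ ⟨_, hbest⟩ => ?_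
  have in₃ := in₂.frame f₃ (by decide) (by decide) (by decide)
  have src₃ : τ₃.ivar Var.src = τ₁.ivar Var.src :=
    (f₃.ivar _ (by decide)).trans (f₂.ivar _ (by decide))
  have snk₃ : τ₃.ivar Var.snk = τ₁.ivar Var.snk :=
    (f₃.ivar _ (by decide)).trans (f₂.ivar _ (by decide))
  rw [← src₃] at ha hab hbest ⊢
  rw [← snk₃] at hb hab hbest ⊢
  exact (tryReverse_runs hX in₃ hIX ha hb hab hbest).mono fun τ l' _ hτ =>
    ⟨FewCalls.append (k := 1) (by simpa [FewCalls, hl] using hJ) hτ.1, hτ.2⟩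

end Separate

namespace Network

variable {I : Network} {u v k : ℕ} {x : ℝ} {σ τ : State}

/-- The least capacity of a cut between `s` and `t` that separates `u` from `v`, or `⊤` if there is
no such cut. -/
noncomputable def sepCap (I : Network) (u v : ℕ) : EReal :=
  sepVal {D | I.IsCut D} I.cutWeight u v

/-- In the memory `σ`, the arrays `parent` and `weight` describe the tree on the first `k` nodes. -/
def IsTree (I : Network) (k : ℕ) (σ : State) : Prop :=
  TreeInv {D | I.IsCut D} I.cutWeight I.n k (σ.iarr Arr.parent)
    fun a => (σ.rarr RArr.weight a : EReal)

theorem IsTree.of_eq (h : I.IsTree k σ) (hpar : τ.iarr Arr.parent = σ.iarr Arr.parent)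
    (hweight : τ.rarr RArr.weight = σ.rarr RArr.weight) : I.IsTree k τ := by
  rwa [IsTree, hpar, hweight]

theorem isGLB_of_sepCap_eq (h : (x : EReal) = I.sepCap u v) :
    IsGLB (I.cutCap univ '' {D | I.IsCut D ∧ D u ≠ D v}) x := by
  refine ⟨?_, fun y hy => ?_⟩
  · rintro _ ⟨D, hD, rfl⟩
    exact EReal.coe_le_coe_iff.1 (h.trans_le (sepVal_le (w := I.cutWeight) hD.1 hD.2))
  · refine EReal.coe_le_coe_iff.1 (h ▸ le_sepVal fun D hD hne => ?_)
    exact EReal.coe_le_coe_iff.2 (hy ⟨D, ⟨hD, hne⟩, rfl⟩)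

end Network

/-- Equivalence of tests. -/
def BExp.iff (p q : BExp) : BExp := .not (.and (.not (.and p q)) (.not (.and (.not p) (.not q))))

theorem BExp.holds_iff {σ : State} {p q : BExp} :
    (BExp.iff p q).Holds σ ↔ (p.Holds σ ↔ q.Holds σ) := by
  simp only [BExp.iff, BExp.Holds]
  tauto

/-- Label each tree node with the root of its component after deleting the tree arcs of weight at
most `bestCap`. -/
def labelRoots : Cmd :=
  .tabulate Arr.root Var.j Var.k
    (.cond (.and (.ltI (.read Arr.parent (.var Var.j)) (.var Var.j))
        (.ltR (.var RVar.bestCap) (.read RArr.weight (.var Var.j))))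
      (.setI Var.tmp (.read Arr.root (.read Arr.parent (.var Var.j))))
      (.setI Var.tmp (.var Var.j)))
    (.var Var.tmp)

def takesOver : BExp :=
  .and (.ltI (.var Var.k) (.var Var.j))
    (.and (.iff (.eqI (.read Arr.bestSide (.var Var.j)) (.lit 0))
        (.eqI (.read Arr.bestSide (.var Var.k)) (.lit 0)))
      (.eqI (.read Arr.root (.read Arr.parent (.var Var.j))) (.read Arr.root (.var Var.parent))))

def reassign : Cmd :=
  .tabulate Arr.parent Var.j Var.inN
    (.cond takesOver (.setI Var.tmp (.var Var.k)) (.setI Var.tmp (.read Arr.parent (.var Var.j))))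
    (.var Var.tmp)

/-- Turn the node `k` into a tree node, given the best cut between it and its parent. -/
def attach : Cmd :=
  labelRoots ;; reassign ;; .storeR RArr.weight (.var Var.k) (.var RVar.bestCap) ;;
    .setI Var.k (.succ (.var Var.k))

def growTree : Cmd := .setI Var.parent (.read Arr.parent (.var Var.k)) ;; separate ;; attach

section GrowTree

variable {R : MaxFlowRoutine} {X k : ℕ} {σ : State} {I : Network}

theorem labelRoots_computes (hX : 1 ≤ X) (hk : σ.ivar Var.k ≤ X) :
    Computes R X labelRoots σ fun τ => ∀ a < σ.ivar Var.k, τ.iarr Arr.root a =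
      componentRoot (σ.iarr Arr.parent) (σ.rvar RVar.bestCap < σ.rarr RArr.weight ·) a := by
  refine Computes.tabulate hX ⟨trivial, trivial⟩ (by decide) (by decide) (by decide) (by decide)
    rfl hk fun j _ τ hf hj hroot => ?_
  have cap : τ.rvar RVar.bestCap = σ.rvar RVar.bestCap := hf.rvar _ (by decide)
  have weight : τ.rarr RArr.weight = σ.rarr RArr.weight := hf.rarr _ (by decide)
  have parent : τ.iarr Arr.parent = σ.iarr Arr.parent := hf.iarr _ (by decide)
  rw [componentRoot]
  simp only [Cmd.sem, BExp.Holds, IExp.eval, RExp.eval, hj, cap, weight, parent]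
  split_ifs with hc
  · simp only [Function.update_self, hroot, if_pos hc.1]
  · simp only [Function.update_self]

theorem reassign_computes (hX : 1 ≤ X) (hn : σ.ivar Var.inN ≤ X) :
    Computes R X reassign σ fun τ => ∀ x < σ.ivar Var.inN, τ.iarr Arr.parent x =
      if σ.ivar Var.k < x ∧ (σ.iarr Arr.bestSide x = 0 ↔ σ.iarr Arr.bestSide (σ.ivar Var.k) = 0) ∧
        σ.iarr Arr.root (σ.iarr Arr.parent x) = σ.iarr Arr.root (σ.ivar Var.parent)
      then σ.ivar Var.k else σ.iarr Arr.parent x := by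
  refine Computes.tabulate hX ⟨trivial, trivial⟩ (by decide) (by decide) (by decide) (by decide)
    rfl hn fun j _ τ hf hj hparent => ?_
  have k : τ.ivar Var.k = σ.ivar Var.k := hf.ivar _ (by decide)
  have p : τ.ivar Var.parent = σ.ivar Var.parent := hf.ivar _ (by decide)
  have side : τ.iarr Arr.bestSide = σ.iarr Arr.bestSide := hf.iarr _ (by decide)
  have root : τ.iarr Arr.root = σ.iarr Arr.root := hf.iarr _ (by decide)
  have parent := (hparent j).trans (if_neg (lt_irrefl j))
  have htest : takesOver.Holds τ ↔ σ.ivar Var.k < j ∧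
      (σ.iarr Arr.bestSide j = 0 ↔ σ.iarr Arr.bestSide (σ.ivar Var.k) = 0) ∧
        σ.iarr Arr.root (σ.iarr Arr.parent j) = σ.iarr Arr.root (σ.ivar Var.parent) := by
    simp only [takesOver, BExp.Holds, BExp.holds_iff, IExp.eval, hj, k, p, side, root, parent]
  by_cases hc : takesOver.Holds τ
  · simp only [Cmd.sem, if_pos hc, if_pos (htest.1 hc), IExp.eval, Function.update_self, k]
  · simp only [Cmd.sem, if_neg hc, if_neg (mt htest.2 hc), IExp.eval, Function.update_self, hj,
      parent]

theorem reattach_eq_of_componentRoot {side root : ℕ → ℕ} {x : ℕ} (htree : I.IsTree k σ)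
    (hk : k < I.n) (hcap : I.cutCap univ (marked side) = σ.rvar RVar.bestCap)
    (hroot : ∀ a < k, root a =
      componentRoot (σ.iarr Arr.parent) (σ.rvar RVar.bestCap < σ.rarr RArr.weight ·) a)
    (hx : x < I.n) :
    reattach {D | I.IsCut D} I.cutWeight (marked side) k (σ.iarr Arr.parent) x =
      if k < x ∧ (side x = 0 ↔ side k = 0) ∧
        root (σ.iarr Arr.parent x) = root (σ.iarr Arr.parent k)
      then k else σ.iarr Arr.parent x := by
  refine if_congr (and_congr_right fun hkx => and_congr ?_ ?_) rfl rfl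
  · simp only [marked, decide_eq_decide, ne_eq, not_iff_not]
  · have hpx := htree.par_lt x hx hkx.le
    have hpk := htree.par_lt k hk le_rfl
    rw [hroot _ hpx, hroot _ hpk, Network.cutWeight, hcap,
      ← htree.lt_sepVal_iff hk.le (EReal.coe_lt_top _) hpx hpk]
    simp only [EReal.coe_lt_coe_iff]

theorem attach_computes (hX : 1 ≤ X) (hin : Stored inputLayout I σ) (hn : I.n ≤ X)
    (hk : σ.ivar Var.k < I.n) (htree : I.IsTree (σ.ivar Var.k) σ)
    (hp : σ.ivar Var.parent = σ.iarr Arr.parent (σ.ivar Var.k))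
    (hbest : HasBestCut I (σ.ivar Var.k) (σ.ivar Var.parent) σ) :
    Computes R X attach σ fun τ => τ.ivar Var.k = σ.ivar Var.k + 1 ∧
      I.IsTree (σ.ivar Var.k + 1) τ := by
  refine (labelRoots_computes hX (hk.le.trans hn)).seq fun τ₁ f₁ hroot => ?_
  have inN₁ : τ₁.ivar Var.inN = I.n := (f₁.ivar _ (by decide)).trans hin.n
  refine (reassign_computes hX (inN₁.trans_le hn)).seq fun τ₂ f₂ hpar => ?_
  have k₁ : τ₁.ivar Var.k = σ.ivar Var.k := f₁.ivar _ (by decide)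
  have k₂ : τ₂.ivar Var.k = σ.ivar Var.k := (f₂.ivar _ (by decide)).trans k₁
  have cap₂ : τ₂.rvar RVar.bestCap = σ.rvar RVar.bestCap :=
    (f₂.rvar _ (by decide)).trans (f₁.rvar _ (by decide))
  have weight₂ : τ₂.rarr RArr.weight = σ.rarr RArr.weight :=
    (f₂.rarr _ (by decide)).trans (f₁.rarr _ (by decide))
  rw [inN₁, k₁, f₁.iarr Arr.bestSide (by decide), f₁.iarr Arr.parent (by decide),
    f₁.ivar Var.parent (by decide), hp] at hpar
  refine Cmd.Straight.computes (by simp [Cmd.Straight]) hX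
    ⟨by simp [Cmd.sem, IExp.eval, k₂], ?_⟩
  refine (htree.reattach hk (hp ▸ hbest.1) (EReal.coe_lt_top _)).congr hk (fun x hx => ?_)
    fun a _ => ?_
  · exact (hpar x hx).trans (reattach_eq_of_componentRoot htree hk hbest.2 hroot hx).symm
  · by_cases ha : a = σ.ivar Var.k <;>
      simp [Cmd.sem, IExp.eval, RExp.eval, Network.cutWeight, hbest.2, ha, k₂, cap₂, weight₂]

theorem growTree_runs (hX : 1 ≤ X) (h : Stored inputLayout I σ) (hIX : 2 * I.m + I.n ≤ X)
    (hk : σ.ivar Var.k < I.n) (htree : I.IsTree (σ.ivar Var.k) σ) :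
    Runs R X growTree σ fun τ l => FewCalls I 2 l ∧ τ.ivar Var.k = σ.ivar Var.k + 1 ∧
      I.IsTree (σ.ivar Var.k + 1) τ := by
  refine Computes.runs_seq
    (P₁ := fun τ => τ.ivar Var.parent = σ.iarr Arr.parent (σ.ivar Var.k))
    (Cmd.Straight.computes trivial hX (by simp [Cmd.sem, IExp.eval])) fun τ₁ f₁ hp => ?_
  have in₁ := h.frame f₁ (by decide) (by decide) (by decide)
  have htree₁ := htree.of_eq (f₁.iarr _ (by decide)) (f₁.rarr _ (by decide))
  have hpk := htree.par_lt _ hk le_rfl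
  rw [← f₁.iarr Arr.parent (by decide)] at hp hpk
  rw [← f₁.ivar Var.k (by decide)] at hk hp hpk htree₁ ⊢
  refine (separate_runs hX in₁ hIX hk (by omega) (by omega)).seq_computes
    fun τ₂ l f₂ ⟨hl, hbest⟩ => ?_
  have in₂ := in₁.frame f₂ (by decide) (by decide) (by decide)
  have htree₂ := htree₁.of_eq (f₂.iarr _ (by decide)) (f₂.rarr _ (by decide))
  rw [← f₂.iarr Arr.parent (by decide), ← f₂.ivar Var.parent (by decide)] at hp
  rw [← f₂.ivar Var.parent (by decide)] at hbest
  rw [← f₂.ivar Var.k (by decide)] at hk hp htree₂ hbest ⊢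
  exact (attach_computes hX in₂ (by omega) hk htree₂ hp hbest).mono fun τ₃ _ hτ₃ => ⟨hl, hτ₃⟩

end GrowTree

/-! ### Vitalities -/

/-- Build the tree whose path minima are the values `I.sepCap u v`. -/
def buildTree : Cmd :=
  .tabulate Arr.parent Var.j Var.inN .skip (.lit 0) ;; .setI Var.k (.lit 1) ;;
    .loop (.ltI (.var Var.k) (.var Var.inN)) growTree

def orderEnds : Cmd :=
  .cond (.ltI (.var Var.u) (.var Var.v))
    (.setI Var.tmp (.var Var.u) ;; .setI Var.u (.var Var.v) ;; .setI Var.v (.var Var.tmp)) .skip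

def climb : Cmd :=
  .cond (.ltR (.read RArr.weight (.var Var.u)) (.var RVar.bottleneck))
      (.setR RVar.bottleneck (.read RArr.weight (.var Var.u))) .skip ;;
    .setI Var.u (.read Arr.parent (.var Var.u)) ;; orderEnds

/-- Find the least weight on the tree path between `u` and `v` by climbing from the larger end until
the ends meet. -/
def pathMin : Cmd :=
  orderEnds ;; .setR RVar.bottleneck (.read RArr.weight (.var Var.u)) ;;
    .loop (.not (.eqI (.var Var.u) (.var Var.v))) climb

def findMaxFlow : Cmd :=
  (.setI Var.u (.var Var.inS) ;; .setI Var.v (.var Var.inT)) ;; pathMin ;;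
    .setR RVar.maxFlow (.var RVar.bottleneck)

def storeVitality : Cmd :=
  .setR RVar.bottleneck (.sub (.var RVar.bottleneck) (.read RArr.inCap (.var Var.e))) ;;
    .cond (.ltR (.var RVar.bottleneck) (.var RVar.maxFlow))
      (.storeR RArr.vitality (.var Var.e) (.sub (.var RVar.maxFlow) (.var RVar.bottleneck)))
      (.storeR RArr.vitality (.var Var.e) .zero) ;;
    .setI Var.e (.succ (.var Var.e))

def arcVitality : Cmd :=
  (.setI Var.u (.read Arr.inTail (.var Var.e)) ;; .setI Var.v (.read Arr.inHead (.var Var.e))) ;;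
    pathMin ;; storeVitality

def arcVitalities : Cmd :=
  .setI Var.e (.lit 0) ;; .loop (.ltI (.var Var.e) (.var Var.inM)) arcVitality

/-- The algorithm: compute the vitalities of all arcs. -/
def vitalities : Cmd := buildTree ;; findMaxFlow ;; arcVitalities

namespace Network

variable {I : Network} {x : ℝ}

theorem n_le_m_add_one (I : Network) : I.n ≤ I.m + 1 := by
  let E := Set.range fun i => s(I.tail i, I.head i)
  have hle : Nat.card (SimpleGraph.fromEdgeSet E).edgeSet ≤ Nat.card E :=
    Nat.card_mono (Set.finite_range _)
      ((SimpleGraph.edgeSet_fromEdgeSet E).trans_subset Set.sdiff_subset)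
  have hE : Nat.card E ≤ Nat.card (Fin I.m) := Finite.card_range_le _
  have hV := I.connected.card_vert_le_card_edgeSet_add_one
  rw [Nat.card_fin] at hV hE
  exact hV.trans (Nat.add_le_add_right (hle.trans hE) 1)

theorem two_le_n (I : Network) : 2 ≤ I.n := by
  have hs := I.s.2
  have ht := I.t.2
  have hst : (I.s : ℕ) ≠ I.t := Fin.val_ne_of_ne I.s_ne_t
  omega

theorem sepCap_max_min (I : Network) (u v : ℕ) : I.sepCap (max u v) (min u v) = I.sepCap u v := by
  rcases le_total u v with h | h
  · rw [max_eq_right h, min_eq_left h, sepCap, sepVal_comm, sepCap]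
  · rw [max_eq_left h, min_eq_right h]

theorem isGLB_of_sepCap_terminals_eq (h : (x : EReal) = I.sepCap I.s I.t) :
    IsGLB (I.cutCap univ '' {D | I.IsCut D}) x := by
  have hcuts : {D | I.IsCut D} = {D | I.IsCut D ∧ D I.s ≠ D I.t} :=
    Set.ext fun D => (and_iff_left_of_imp fun hD => by simp [hD.1, hD.2]).symm
  exact hcuts ▸ isGLB_of_sepCap_eq h

end Network

section Vitalities

variable {R : MaxFlowRoutine} {X : ℕ} {σ : State} {I : Network}

theorem buildTree_runs (h : Stored inputLayout I σ) (hIX : 2 * I.m + I.n ≤ X) :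
    Runs R (X * I.n) buildTree σ fun τ l => FewCalls I (2 * (I.n - 1)) l ∧ I.IsTree I.n τ := by
  have hn := I.two_le_n
  have hX : 1 ≤ X := by omega
  have hnX : I.n ≤ X * I.n := Nat.le_mul_of_pos_left _ hX
  refine (Computes.tabulate (c := .skip) (g := fun _ => 0) (by omega) trivial (by decide)
    (by decide) (by decide) (by decide) h.n hnX fun _ _ _ _ _ _ => rfl).runs_seq
      fun τ₁ f₁ hpar => ?_
  have in₁ := h.frame f₁ (by decide) (by decide) (by decide)
  refine Computes.runs_seq (P₁ := fun τ => τ.ivar Var.k = 1)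
    (Cmd.Straight.computes trivial (by omega) (by simp [Cmd.sem, IExp.eval])) fun τ₂ f₂ hk => ?_
  have in₂ := in₁.frame f₂ (by decide) (by decide) (by decide)
  rw [← f₂.iarr Arr.parent (by decide)] at hpar
  refine (Runs.loop hX (by omega) (f := I.n - 1) (fun f τ l => ∃ j, τ.ivar Var.k = j + 1 ∧
    f + (j + 1) = I.n ∧ I.IsTree (j + 1) τ ∧ FewCalls I (2 * j) l) (Nat.sub_le _ _)
    ⟨0, hk, by omega, treeInv_one hpar, FewCalls.nil I _⟩ ?_).mono ?_
  · rintro f τ l hf ⟨j, hj, hfn, htree, hl⟩ hb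
    have inτ := in₂.frame hf (by decide) (by decide) (by decide)
    have inN : τ.ivar Var.inN = I.n := inτ.n
    simp only [BExp.Holds, IExp.eval, inN] at hb
    rw [← hj] at htree
    refine (growTree_runs hX inτ hIX hb htree).mono fun υ l' _ ⟨hl', hk', htree'⟩ => ?_
    rw [hj] at hk' htree' hb
    exact ⟨f - 1, by omega, j + 1, hk', by omega, htree', hl.append hl'⟩
  · rintro τ l hf ⟨hb, f, j, hj, hfn, htree, hl⟩
    have inN : τ.ivar Var.inN = I.n := (in₂.frame hf (by decide) (by decide) (by decide)).n
    simp only [BExp.Holds, IExp.eval, inN, hj] at hb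
    obtain rfl : f = 0 := by omega
    obtain rfl : j = I.n - 1 := by omega
    exact ⟨hl, by rwa [Nat.sub_add_cancel (by omega)] at htree⟩

theorem orderEnds_sem (σ : State) :
    (orderEnds.sem σ).ivar Var.u = max (σ.ivar Var.u) (σ.ivar Var.v) ∧
      (orderEnds.sem σ).ivar Var.v = min (σ.ivar Var.u) (σ.ivar Var.v) ∧
        (orderEnds.sem σ).rvar = σ.rvar := by
  rcases lt_or_ge (σ.ivar Var.u) (σ.ivar Var.v) with h | h
  · simp [orderEnds, Cmd.sem, BExp.Holds, IExp.eval, h, h.le]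
  · simp [orderEnds, Cmd.sem, BExp.Holds, IExp.eval, h, h.not_gt]

theorem climb_sem (σ : State) :
    (climb.sem σ).ivar Var.u = max (σ.iarr Arr.parent (σ.ivar Var.u)) (σ.ivar Var.v) ∧
      (climb.sem σ).ivar Var.v = min (σ.iarr Arr.parent (σ.ivar Var.u)) (σ.ivar Var.v) ∧
        (climb.sem σ).rvar RVar.bottleneck =
          min (σ.rvar RVar.bottleneck) (σ.rarr RArr.weight (σ.ivar Var.u)) := by
  obtain ⟨hu, hv, hr⟩ := orderEnds_sem
    ((Cmd.setI Var.u (.read Arr.parent (.var Var.u))).sem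
      ((Cmd.cond (.ltR (.read RArr.weight (.var Var.u)) (.var RVar.bottleneck))
        (.setR RVar.bottleneck (.read RArr.weight (.var Var.u))) .skip).sem σ))
  simp only [climb, Cmd.sem] at hu hv hr ⊢
  rw [hu, hv, hr]
  rcases lt_or_ge (σ.rarr RArr.weight (σ.ivar Var.u)) (σ.rvar RVar.bottleneck) with h | h
  · simp [BExp.Holds, IExp.eval, RExp.eval, h, h.le]
  · simp [BExp.Holds, IExp.eval, RExp.eval, h, h.not_gt]

theorem climb_sem_min (htree : I.IsTree I.n σ) (hu : σ.ivar Var.u < I.n)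
    (hlt : σ.ivar Var.v < σ.ivar Var.u) :
    min ((climb.sem σ).rvar RVar.bottleneck : EReal)
        (I.sepCap ((climb.sem σ).ivar Var.u) ((climb.sem σ).ivar Var.v)) =
      min (σ.rvar RVar.bottleneck : EReal) (I.sepCap (σ.ivar Var.u) (σ.ivar Var.v)) := by
  obtain ⟨hu', hv', hbot⟩ := climb_sem σ
  rw [hu', hv', hbot, I.sepCap_max_min, EReal.coe_strictMono.monotone.map_min, min_assoc]
  exact congrArg (min _) (htree.sep _ hu _ hlt).symm

theorem pathMin_computes (htree : I.IsTree I.n σ) (hX : 2 * I.n ≤ X) (hu : σ.ivar Var.u < I.n)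
    (hv : σ.ivar Var.v < I.n) (hne : σ.ivar Var.u ≠ σ.ivar Var.v) :
    Computes R X pathMin σ fun τ =>
      (τ.rvar RVar.bottleneck : EReal) = I.sepCap (σ.ivar Var.u) (σ.ivar Var.v) := by
  obtain ⟨u, hσu⟩ : ∃ u, σ.ivar Var.u = u := ⟨_, rfl⟩
  obtain ⟨v, hσv⟩ : ∃ v, σ.ivar Var.v = v := ⟨_, rfl⟩
  rw [hσu] at hu hne ⊢
  rw [hσv] at hv hne ⊢
  refine Computes.seq (P₁ := fun τ => τ.ivar Var.u = max u v ∧ τ.ivar Var.v = min u v)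
    (Cmd.Straight.computes (by simp [orderEnds, Cmd.Straight]) (by omega)
      (by simp only [orderEnds_sem, hσu, hσv, and_self])) fun τ₁ f₁ ⟨u₁, v₁⟩ => ?_
  refine Computes.seq (P₁ := fun τ => τ.rvar RVar.bottleneck = σ.rarr RArr.weight (max u v))
    (Cmd.Straight.computes trivial (by omega) (by
      simp [Cmd.sem, RExp.eval, IExp.eval, u₁, f₁.rarr RArr.weight (by decide)]))
    fun τ₂ f₂ hbot => ?_
  rw [← f₂.ivar _ (by decide)] at u₁ v₁
  refine (Computes.loop (by omega) (by simp [climb, orderEnds, Cmd.Straight]) (fun f τ =>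
    f = τ.ivar Var.u + τ.ivar Var.v ∧ τ.ivar Var.v ≤ τ.ivar Var.u ∧ τ.ivar Var.u < I.n ∧
    I.sepCap u v = min (τ.rvar RVar.bottleneck : EReal) (I.sepCap (τ.ivar Var.u) (τ.ivar Var.v)))
    (f := u + v) (by omega) ?_ ?_).mono ?_
  · rw [u₁, v₁, hbot, I.sepCap_max_min, max_add_min]
    refine ⟨rfl, min_le_max, max_lt hu hv, (min_eq_right ?_).symm⟩
    exact (I.sepCap_max_min u v).symm.trans_le <|
      (htree.sep _ (max_lt hu hv) _ (min_lt_max.2 hne)).trans_le (min_le_left _ _)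
  · rintro _ τ f₃ ⟨rfl, hle, hun, hmin⟩ hb
    have hlt : τ.ivar Var.v < τ.ivar Var.u := lt_of_le_of_ne hle (Ne.symm hb)
    have f : Frame pathMin σ τ :=
      f₁.seq_left.trans (f₂.seq_left.trans f₃.loop.seq_right).seq_right
    have htree' := htree.of_eq (f.iarr _ (by decide)) (f.rarr _ (by decide))
    have hpar := htree'.par_lt_self _ hun (by omega)
    refine ⟨_, ?_, rfl, ?_, ?_, hmin.trans (climb_sem_min htree' hun hlt).symm⟩
    all_goals rw [(climb_sem τ).1]
    · rw [(climb_sem τ).2.1, max_add_min]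
      exact Nat.add_lt_add_right hpar _
    · rw [(climb_sem τ).2.1]
      exact min_le_max
    · exact max_lt (hpar.trans hun) (hlt.trans hun)
  · rintro τ - ⟨hb, f, -, -, -, hmin⟩
    have hcommon : τ.ivar Var.u = τ.ivar Var.v := not_not.1 hb
    rw [hmin, hcommon, Network.sepCap, sepVal_self, min_eq_left le_top]

theorem findMaxFlow_computes (h : Stored inputLayout I σ) (htree : I.IsTree I.n σ)
    (hX : 2 * I.n ≤ X) :
    Computes R X findMaxFlow σ fun τ => (τ.rvar RVar.maxFlow : EReal) = I.sepCap I.s I.t := by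
  have hn := I.two_le_n
  have inS : σ.ivar Var.inS = I.s := h.s
  have inT : σ.ivar Var.inT = I.t := h.t
  refine Computes.seq (P₁ := fun τ => τ.ivar Var.u = I.s ∧ τ.ivar Var.v = I.t)
    (Cmd.Straight.computes (by simp [Cmd.Straight]) (by omega)
      (by simp [Cmd.sem, IExp.eval, inS, inT])) fun τ₁ f₁ ⟨u₁, v₁⟩ => ?_
  have htree₁ := htree.of_eq (f₁.iarr _ (by decide)) (f₁.rarr _ (by decide))
  refine (pathMin_computes htree₁ hX (u₁.trans_lt I.s.2) (v₁.trans_lt I.t.2) ?_).seq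
    fun τ₂ _ hbot => ?_
  · rw [u₁, v₁]
    exact Fin.val_ne_of_ne I.s_ne_t
  · rw [u₁, v₁] at hbot
    exact Cmd.Straight.computes trivial (by omega) (by simpa [Cmd.sem, RExp.eval] using hbot)

theorem storeVitality_computes (hX : 1 ≤ X) {e : Fin I.m} (he : σ.ivar Var.e = e)
    (hcap : σ.rarr RArr.inCap e = I.cap e)
    (hF : (σ.rvar RVar.maxFlow : EReal) = I.sepCap I.s I.t)
    (hbot : (σ.rvar RVar.bottleneck : EReal) = I.sepCap (I.tail e) (I.head e)) :
    Computes R X storeVitality σ fun τ => τ.ivar Var.e = e + 1 ∧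
      τ.rarr RArr.vitality = Function.update (σ.rarr RArr.vitality) e (I.flowVit e) := by
  rw [I.flowVit_eq e (Network.isGLB_of_sepCap_terminals_eq hF) (Network.isGLB_of_sepCap_eq hbot)]
  refine Cmd.Straight.computes (by simp [storeVitality, Cmd.Straight]) hX ?_
  rcases lt_or_ge (σ.rvar RVar.bottleneck - I.cap e) (σ.rvar RVar.maxFlow) with hc | hc
  · simp [storeVitality, Cmd.sem, BExp.Holds, IExp.eval, RExp.eval, he, hcap, hc, hc.le]
  · simp [storeVitality, Cmd.sem, BExp.Holds, IExp.eval, RExp.eval, he, hcap, hc, hc.not_gt]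

theorem arcVitality_computes (h : Stored inputLayout I σ) (htree : I.IsTree I.n σ)
    (hX : 2 * I.n ≤ X) (hF : (σ.rvar RVar.maxFlow : EReal) = I.sepCap I.s I.t) {e : Fin I.m}
    (he : σ.ivar Var.e = e) :
    Computes R X arcVitality σ fun τ => τ.ivar Var.e = e + 1 ∧
      τ.rarr RArr.vitality = Function.update (σ.rarr RArr.vitality) e (I.flowVit e) := by
  have hn := I.two_le_n
  have inTail : σ.iarr Arr.inTail e = I.tail e := h.tail e
  have inHead : σ.iarr Arr.inHead e = I.head e := h.head e
  refine Computes.seq (P₁ := fun τ => τ.ivar Var.u = I.tail e ∧ τ.ivar Var.v = I.head e)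
    (Cmd.Straight.computes (by simp [Cmd.Straight]) (by omega)
      (by simp [Cmd.sem, IExp.eval, inTail, inHead, he])) fun τ₁ f₁ ⟨u₁, v₁⟩ => ?_
  have htree₁ := htree.of_eq (f₁.iarr _ (by decide)) (f₁.rarr _ (by decide))
  refine (pathMin_computes htree₁ hX (u₁.trans_lt (I.tail e).2) (v₁.trans_lt (I.head e).2)
    ?_).seq fun τ₂ f₂ hbot => ?_
  · rw [u₁, v₁]
    exact Fin.val_ne_of_ne (I.loopless e)
  · have f := f₁.seq_left.trans f₂.seq_right
    rw [u₁, v₁] at hbot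
    rw [← f.ivar Var.e (by decide)] at he
    rw [← f.rvar RVar.maxFlow (by decide)] at hF
    rw [← f.rarr RArr.vitality (by decide)]
    exact storeVitality_computes (by omega) he
      ((congrFun (f.rarr RArr.inCap (by decide)) e).trans (h.cap e)) hF hbot

theorem arcVitalities_computes (h : Stored inputLayout I σ) (htree : I.IsTree I.n σ)
    (hX : 2 * I.n ≤ X) (hm : 1 ≤ I.m) (hF : (σ.rvar RVar.maxFlow : EReal) = I.sepCap I.s I.t) :
    Computes R (X * I.m) arcVitalities σ fun τ =>
      ∀ e : Fin I.m, τ.rarr RArr.vitality e = I.flowVit e := by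
  have hX₁ : 1 ≤ X := by have := I.two_le_n; omega
  refine Computes.seq (P₁ := fun τ => τ.ivar Var.e = 0)
    (Cmd.Straight.computes trivial (Nat.mul_pos hX₁ hm) (by simp [Cmd.sem, IExp.eval]))
    fun τ₁ f₁ he => ?_
  have in₁ := h.frame f₁ (by decide) (by decide) (by decide)
  have htree₁ := htree.of_eq (f₁.iarr _ (by decide)) (f₁.rarr _ (by decide))
  rw [← f₁.rvar RVar.maxFlow (by decide)] at hF
  refine (Runs.loop hX₁ hm (f := I.m) (fun f τ l => l = [] ∧ f + τ.ivar Var.e = I.m ∧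
    ∀ e : Fin I.m, e < τ.ivar Var.e → τ.rarr RArr.vitality e = I.flowVit e) le_rfl
    ⟨rfl, by rw [he, add_zero], fun e hlt => by omega⟩ ?_).mono ?_
  · rintro f τ _ hf ⟨rfl, hfm, hvit⟩ hb
    have inτ := in₁.frame hf (by decide) (by decide) (by decide)
    have inM : τ.ivar Var.inM = I.m := inτ.m
    have htree := htree₁.of_eq (hf.iarr _ (by decide)) (hf.rarr _ (by decide))
    rw [← hf.rvar RVar.maxFlow (by decide)] at hF
    simp only [BExp.Holds, IExp.eval, inM] at hb
    obtain ⟨e, he⟩ : ∃ e : Fin I.m, τ.ivar Var.e = e := ⟨⟨_, hb⟩, rfl⟩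
    rw [he] at hfm hvit
    refine (arcVitality_computes inτ htree hX hF he).runs fun υ _ ⟨he', hupd⟩ =>
      ⟨f - 1, by omega, rfl, by omega, fun i hi => ?_⟩
    rw [hupd]
    obtain rfl | hne := eq_or_ne i e
    · exact Function.update_self ..
    · rw [Function.update_of_ne (Fin.val_ne_of_ne hne)]
      exact hvit i (by omega)
  · rintro τ _ hf ⟨hb, f, rfl, hfm, hvit⟩
    have inM : τ.ivar Var.inM = I.m := (in₁.frame hf (by decide) (by decide) (by decide)).m
    simp only [BExp.Holds, IExp.eval, inM] at hb
    exact ⟨rfl, fun e => hvit e (by omega)⟩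

theorem vitalities_runs (h : Stored inputLayout I σ) :
    Runs R (4 * (I.m * I.n)) vitalities σ fun τ l =>
      FewCalls I (2 * (I.n - 1)) l ∧ ∀ e : Fin I.m, τ.rarr outputArray e = I.flowVit e := by
  have hn := I.two_le_n
  have hm := I.n_le_m_add_one
  have hbuild : 4 * (I.m * I.n) = 4 * I.m * I.n := by ring
  have harcs : 4 * (I.m * I.n) = 4 * I.n * I.m := by ring
  have hmn : 2 * I.n ≤ 4 * (I.m * I.n) := by nlinarith
  refine Runs.seq_computes (hbuild ▸ buildTree_runs h (by omega)) fun τ₁ l f₁ ⟨hl, htree₁⟩ => ?_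
  have in₁ := h.frame f₁ (by decide) (by decide) (by decide)
  refine (findMaxFlow_computes in₁ htree₁ hmn).seq fun τ₂ f₂ hF => ?_
  have in₂ := in₁.frame f₂ (by decide) (by decide) (by decide)
  have htree₂ := htree₁.of_eq (f₂.iarr _ (by decide)) (f₂.rarr _ (by decide))
  rw [harcs]
  exact (arcVitalities_computes in₂ htree₂ (by omega) (by omega) hF).mono
    fun τ₃ _ hvit => ⟨hl, hvit⟩

end Vitalities

end MaxFlowVitality

theorem mainTheorem4 :
    ∃ (P : Cmd) (K : ℕ), ∀ (R : MaxFlowRoutine) (I : Network) (σ : State),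
      Stored inputLayout I σ →
      ∃ (σ' : State) (steps : ℕ) (calls : List Network),
        Exec R P σ σ' steps calls ∧
        (∀ e : Fin I.m, σ'.rarr outputArray e = I.flowVit e) ∧
        calls.length ≤ 2 * (I.n - 1) ∧
        (∀ J ∈ calls, J.n ≤ I.n ∧ J.m ≤ I.m) ∧
        steps ≤ K * (I.m * I.n) ∧
        ∀ MF : ℕ → ℕ → ℕ, R.RunsIn MF →
          steps + (calls.map R.time).sum ≤ K * (I.n * MF I.n I.m + I.m * I.n) := by
  refine ⟨vitalities, vitalities.rate * 4 + 2, fun R I σ h => ?_⟩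
  obtain ⟨τ, k, l, hexec, hk, hl, hvit⟩ := vitalities_runs (R := R) h
  have hsteps : k ≤ (vitalities.rate * 4 + 2) * (I.m * I.n) := by
    rw [add_mul, mul_assoc]
    exact le_add_right hk
  refine ⟨τ, k, l, hexec, hvit, hl.1, hl.2, hsteps, fun MF hMF => ?_⟩
  have htime : (l.map R.time).sum ≤ (vitalities.rate * 4 + 2) * (I.n * MF I.n I.m) :=
    calc
      (l.map R.time).sum ≤ 2 * (I.n - 1) * MF I.n I.m := hl.sum_time_le hMF
      _ ≤ 2 * (I.n * MF I.n I.m) := by rw [mul_assoc]; gcongr; exact Nat.sub_le _ _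
      _ ≤ (vitalities.rate * 4 + 2) * (I.n * MF I.n I.m) := by gcongr; exact Nat.le_add_left _ _
  rw [mul_add, add_comm]
  exact add_le_add htime hsteps
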